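/- **Setting.** Let $k\in\mathbb N=\{0,1,2,\dots\}$ and $s\in(0,1)$ with $k+s>\tfrac12$. Let $W:\mathbb R\to\mathbb R$ be a fixed continuous double-well potential: there are $\alpha_W,\beta_W>0$ with $\alpha_W(1-|z|)^2\le W(z)\le\beta_W(1-|z|)^2$ for $|z|\le 2$, and $\inf_{|z|\ge 2}W>0$. Fix $0<\alpha_a\le\beta_a<\infty$; a *kernel* is a measurable $a:\mathbb R^2\to\mathbb R$, $1$-periodic in each variable, with $\alpha_a\le a\le\beta_a$ almost everywhere. For $v\in H^{k+s}_{\rm loc}(\mathbb R)$ (identified with its continuous representative) and an interval $I$ put $$\Phi^a(v,I)=\int_I W(v)\,dx+\int_I\int_I a(x,y)\frac{|v^{(k)}(x)-v^{(k)}(y)|^2}{|x-y|^{1+2s}}\,dx\,dy,$$ $$[g]_{H^s(I)}^2=\int_I\int_I\frac{|g(x)-g(y)|^2}{|x-y|^{1+2s}}\,dx\,dy,\qquad \|v\|_{H^{k+s}(I)}=\|v\|_{L^2(I)}+[v^{(k)}]_{H^s(I)}.$$ For $T>0$ and $S\in\mathbb R$ let $\mathcal B(T,S)$ be the set of all $v\in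 H^{k+s}_{\rm loc}(\mathbb R)$ such that $|v(x)|=1$ for $|x|\ge T$ and $\Phi^a(v,(-T,T))\le S$ for some kernel $a$. For $\eta\in(0,1)$ and such a $v$, let $A^\eta(v)$ be the union of the connected components of $\{||v|-1|>\eta/2\}$ on which $||v|-1|$ reaches the value $\eta$, components with a common endpoint being merged (interior of the closure of the union). A *sign regularization* of $v$ is a function $\sigma\in C^\infty(\mathbb R)$ with $|\sigma|\le1$ and $\sigma=\operatorname{sgn}(v)$ outside $A^\eta(v)$. All constants below may depend on $k,s,W,\alpha_a,\beta_a$, and otherwise only on the quantities displayed in parentheses. **Theorem (Coercivity in $H^{k+s}_{\rm loc}$).** 1. Let $k\ge1$, $\tau\in(0,\frac12)$, $\varepsilon_0>0$, $S\in\mathbb R$. There is $C=C(\tau,\varepsilon_0,S)>0$ such that for all $\varepsilon\in(0,\varepsilon_0]$ and $v_\varepsilon\in\mathcal B(\tau/\varepsilon,S)$ $$\|v_\varepsilon^{(k)}\|_{L^2(\mathbb R)}=\|v_\varepsilon^{(k)}\|_{L^2((-\tau/\varepsilon,\tau/\varepsilon))}\le C.$$ 2. Let $k=0$, $\eta\in(0,1)$,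 $S\in\mathbb R$. There are $L=L(\eta,S)>0$ and $C=C(\eta,S)>0$ such that, for all $\tau\in(0,\frac12)$, $\varepsilon>0$ and $v_\varepsilon\in\mathcal B(\tau/\varepsilon,S)$, there is a sign regularization $\sigma_\varepsilon$ of $v_\varepsilon$ with $\|\sigma_\varepsilon'\|_\infty\le L$, and every sign regularization $\sigma_\varepsilon$ of $v_\varepsilon$ satisfies $$\|v_\varepsilon-\sigma_\varepsilon\|_{L^2(\mathbb R)}=\|v_\varepsilon-\sigma_\varepsilon\|_{L^2((-\tau/\varepsilon,\tau/\varepsilon))}\le C.$$ 3. For every $k$, $\tau\in(0,\frac12)$, $\varepsilon_0>0$, $S\in\mathbb R$ there is $M=M(\tau,\varepsilon_0,S)>0$ with $|v_\varepsilon(x)|\le M$ for all $x\in\mathbb R$, $\varepsilon\in(0,\varepsilon_0]$ and $v_\varepsilon\in\mathcal B(\tau/\varepsilon,S)$. 4. For every $k$: - (a) For all $S,M\in\mathbb R$, $\ell>0$ there is $C=C(S,M,\ell)>0$ such that $\|v_\varepsilon\|_{H^{k+s}(K)}\le C$ for all $\tau\in(0,\frac12)$, $\varepsilon>0$, all $v_\varepsilon\in\mathcal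 B(\tau/\varepsilon,S)$ with $|v_\varepsilon|\le M$, and all open intervals $K\subseteq(-\tau/\varepsilon,\tau/\varepsilon)$ of length $\ell$. - (b) If $s\ne\frac12$, then for all $\tau\in(0,\frac12)$, $\varepsilon_0>0$, $S,M\in\mathbb R$, $\ell>0$ there is $C=C(\tau,\varepsilon_0,S,M,\ell)>0$ such that $\|v_\varepsilon\|_{H^{k+s}(K)}\le C$ for all $\varepsilon\in(0,\varepsilon_0]$, all $v_\varepsilon\in\mathcal B(\tau/\varepsilon,S)$ with $|v_\varepsilon|\le M$, and all bounded open intervals $K\subset\mathbb R$ of length $\ell$. - (c) For all $s$ (including $s=\frac12$), $\tau\in(0,\frac12)$ and $S\in\mathbb R$: if $\varepsilon_n>0$, $\varepsilon_n\to0$ and $v_n\in\mathcal B(\tau/\varepsilon_n,S)$ for all $n$, then $\sup_n\|v_n\|_{H^{k+s}(K)}<\infty$ for every bounded open interval $K\subset\mathbb R$. -/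

import Mathlib

open MeasureTheory Set Filter Topology
open scoped ENNReal

noncomputable section

/-- A regular double-well potential: continuous, quadratically comparable to `(1 - |z|)²` on
`|z| ≤ 2`, and bounded away from zero on `|z| ≥ 2`. -/
structure IsDoubleWell (W : ℝ → ℝ) : Prop where
  continuous : Continuous W
  quadratic : ∃ αW > 0, ∃ βW > 0, ∀ z : ℝ, |z| ≤ 2 →
    αW * (1 - |z|) ^ 2 ≤ W z ∧ W z ≤ βW * (1 - |z|) ^ 2
  inf_pos : ∃ c > 0, ∀ z : ℝ, 2 ≤ |z| → c ≤ W z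

/-- A homogenization kernel with bounds `αa ≤ a ≤ βa`: measurable, `1`-periodic in both variables,
and with values in `[αa, βa]` almost everywhere. A uniform family of homogenization kernels is a
family all of whose members satisfy this with the same `αa > 0` and `βa`. -/
structure IsHomogenizationKernel (αa βa : ℝ) (a : ℝ → ℝ → ℝ) : Prop where
  measurable : Measurable (fun p : ℝ × ℝ => a p.1 p.2)
  periodic_left : ∀ x y : ℝ, a (x + 1) y = a x y
  periodic_right : ∀ x y : ℝ, a x (y + 1) = a x y
  bounds : ∀ᵐ p : ℝ × ℝ, αa ≤ a p.1 p.2 ∧ a p.1 p.2 ≤ βa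

/-- `g` is a weak derivative of order `n` of `v` on the real line. -/
def IsWeakDeriv (n : ℕ) (v g : ℝ → ℝ) : Prop :=
  LocallyIntegrable v ∧ LocallyIntegrable g ∧
    ∀ φ : ℝ → ℝ, ContDiff ℝ (⊤ : ℕ∞) φ → HasCompactSupport φ →
      ∫ x, v x * iteratedDeriv n φ x = (-1) ^ n * ∫ x, g x * φ x

open Classical in
/-- The weak derivative `v^{(n)}` (unique almost everywhere when it exists; `0` otherwise). -/
def weakDeriv (n : ℕ) (v : ℝ → ℝ) : ℝ → ℝ :=
  if h : ∃ g, IsWeakDeriv n v g then h.choose else 0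

/-- `∫_I ∫_I a(x,y) |g(x) - g(y)|² / |x - y|^{1+2s} dx dy`, as an extended nonnegative number. -/
def nonlocalEnergy (s : ℝ) (a : ℝ → ℝ → ℝ) (I : Set ℝ) (g : ℝ → ℝ) : ℝ≥0∞ :=
  ∫⁻ x in I, ∫⁻ y in I, ENNReal.ofReal (a x y * (g x - g y) ^ 2 / |x - y| ^ (1 + 2 * s))

/-- The Gagliardo seminorm `[g]_{H^s(I)}`. -/
def gagliardoSeminorm (s : ℝ) (I : Set ℝ) (g : ℝ → ℝ) : ℝ≥0∞ :=
  (nonlocalEnergy s (fun _ _ => 1) I g) ^ (1 / 2 : ℝ)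

/-- The norm `‖g‖_{L²(I)}`. -/
def normL2 (I : Set ℝ) (g : ℝ → ℝ) : ℝ≥0∞ :=
  eLpNorm g 2 (volume.restrict I)

/-- Membership in `H^{k+s}_loc(ℝ)`: on every bounded interval the weak derivatives up to order `k`
are square integrable and the `k`-th one has finite Gagliardo seminorm. -/
structure MemHloc (k : ℕ) (s : ℝ) (v : ℝ → ℝ) : Prop where
  exists_weakDeriv : ∀ j ≤ k, ∃ g, IsWeakDeriv j v g
  memLp : ∀ j ≤ k, ∀ b c : ℝ, MemLp (weakDeriv j v) 2 (volume.restrict (Ioo b c))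
  gagliardo_lt_top : ∀ b c : ℝ, gagliardoSeminorm s (Ioo b c) (weakDeriv k v) < ∞

/-- The norm `‖v‖_{H^{k+s}(I)} = ‖v‖_{L²(I)} + [v^{(k)}]_{H^s(I)}` of (the restriction to `I` of)
a function on the line. -/
def normH (k : ℕ) (s : ℝ) (I : Set ℝ) (v : ℝ → ℝ) : ℝ≥0∞ :=
  normL2 I v + gagliardoSeminorm s I (weakDeriv k v)

/-- The rescaled functional `Φ^a(v, I)`. -/
def rescaledEnergy (k : ℕ) (s : ℝ) (W : ℝ → ℝ) (a : ℝ → ℝ → ℝ) (v : ℝ → ℝ) (I : Set ℝ) : ℝ≥0∞ :=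
  (∫⁻ x in I, ENNReal.ofReal (W (v x))) + nonlocalEnergy s a I (weakDeriv k v)

/-- `v` belongs to `H^{k+s}_loc(ℝ)` (and is its continuous representative), `|v(x)| = 1` for
`|x| ≥ T`, and `Φ^a(v, (-T, T)) ≤ S`. -/
structure IsBoundedEnergyProfile (k : ℕ) (s : ℝ) (W : ℝ → ℝ) (a : ℝ → ℝ → ℝ) (T S : ℝ)
    (v : ℝ → ℝ) : Prop where
  memHloc : MemHloc k s v
  continuous : Continuous v
  abs_eq_one : ∀ x : ℝ, T ≤ |x| → |v x| = 1
  energy_le : rescaledEnergy k s W a v (Ioo (-T) T) ≤ ENNReal.ofReal S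

/-- The points at which `v` is at distance more than `δ` from the wells, `||v| - 1| > δ`. -/
def farSet (δ : ℝ) (v : ℝ → ℝ) : Set ℝ := {x | δ < |(|v x|) - 1|}

/-- The set `A^η` of a profile `v`: the union of those connected components of
`{||v| - 1| > η/2}` on which `||v| - 1|` reaches the value `η` (that is, which contain a transition
of `v` between two values `ω₁ + ω₂ η/2` and `ω₁ + ω₂ η`, `ω₁, ω₂ ∈ {±1}`); components sharing an
endpoint are merged by taking the interior of the closure. -/
def transitionSet (η : ℝ) (v : ℝ → ℝ) : Set ℝ :=
  interior (closure {x | x ∈ farSet (η / 2) v ∧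
    ∃ y ∈ connectedComponentIn (farSet (η / 2) v) x, η ≤ |(|v y|) - 1|})

/-- `σ` is a smooth regularization of `sgn v`: it equals `sgn v` off `A^η` and `|σ| ≤ 1`. -/
structure IsSignRegularization (η : ℝ) (v σ : ℝ → ℝ) : Prop where
  smooth : ContDiff ℝ (⊤ : ℕ∞) σ
  eq_sign : ∀ x ∉ transitionSet η v, σ x = Real.sign (v x)
  abs_le_one : ∀ x, |σ x| ≤ 1

end

/-!
Write `g = v^{(k)}`. The energy controls the potential term and, since the kernel is bounded below,
the Gagliardo seminorm of `g` on `(-T, T)`, `T = τ/ε`; the constants must not depend on `T`.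

*Case `k ≥ 1`.* The function `v` starts a chain of continuous derivatives ending in `g`
(`MemHloc.exists_chain`, from the lemma of du Bois-Reymond). The interpolation lemma
`exists_interpolation` says that if `|v| ≤ A` at some point of each short subinterval of an
interval `J`, then `∫_J g² ≤ D (A² + [g]²_{H^s(J)})`: iterating the mean value theorem bounds the mean
of `g` over some subinterval by a multiple of `A`, and the fractional Poincaré inequality does the
rest. It is used twice on intervals of fixed length, long compared with the energy. First, the set
`{|v| ≥ 2}` has small measure there, which gives a bound for `v`. Second, either the energy `e` of `v`
on `J` is bounded below, or `v` has no zero in `J`, and then `v - 1` or `v + 1` is of size `√e` at most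
points; in both cases `∫_J g² ≤ C e` (`exists_bound_of_energy_le`). This linear bound can be summed
over the pieces of `(-T, T)`. On intervals that are too short for this argument, the values of the
derivatives at `±T` bound the mean of `g` (`exists_bound_of_profile`).

*Case `k = 0`.* Now `s > 1/2`, and by the fractional Morrey inequality
(`exists_abs_sub_le_of_gagliardoSq_le`, a telescoping sum of means over dyadic intervals) profiles are
uniformly Hölder continuous on the line. Hence they are bounded, and points off the transition set
at which `v` has different signs are a definite distance apart, so that a mollified step function is
a sign regularization with bounded derivative. The transition set lies in the closed set
`{||v| - 1| ≥ η/2}`, where the potential is bounded below; so `(v - σ)² ≤ C W(v)` pointwise.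

*Local bounds.* Inside `(-T, T)` the bounds are immediate. Across the endpoints, for `s ≠ 1/2`, the
interaction of the two sides is comparable with `∫ |g - g(T)|² (T - x)^{-2s} dx`, which is finite
because `g` is of class `H^s_loc`, and is then bounded by a fractional Hardy inequality
(`exists_hardy`): comparing `x` with points `y ∈ (x/4, x/2)`, the weighted integral is reproduced with
a factor different from one, and can be absorbed. For a sequence `ε → 0` any given interval is
eventually contained in `(-T, T)`.
-/

/-! ### Lower bounds for the double well -/

lemma IsDoubleWell.nonneg {W : ℝ → ℝ} (hW : IsDoubleWell W) (z : ℝ) : 0 ≤ W z := by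
  obtain ⟨α, hα, β, -, h⟩ := hW.quadratic
  obtain ⟨c, hc, h'⟩ := hW.inf_pos
  rcases le_total |z| 2 with hz | hz
  · exact (by positivity : (0 : ℝ) ≤ α * (1 - |z|) ^ 2).trans (h z hz).1
  · exact hc.le.trans (h' z hz)

/-- Away from the wells the potential is bounded below. -/
lemma IsDoubleWell.exists_le_of_far {W : ℝ → ℝ} (hW : IsDoubleWell W) {δ : ℝ} (hδ : 0 < δ) :
    ∃ w > 0, ∀ z : ℝ, δ ≤ |(|z|) - 1| → w ≤ W z := by
  obtain ⟨α, hα, β, -, h⟩ := hW.quadratic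
  obtain ⟨c, hc, h'⟩ := hW.inf_pos
  refine ⟨min (α * δ ^ 2) c, by positivity, fun z hz => ?_⟩
  rcases le_total |z| 2 with hz2 | hz2
  · refine (min_le_left _ _).trans (le_trans ?_ (h z hz2).1)
    have : δ ^ 2 ≤ (1 - |z|) ^ 2 := by
      rw [← sq_abs (1 - |z|), abs_sub_comm]
      gcongr
    gcongr
  · exact (min_le_right _ _).trans (h' z hz2)

/-- On bounded sets the potential controls the squared distance to the wells. -/
lemma IsDoubleWell.exists_sq_le {W : ℝ → ℝ} (hW : IsDoubleWell W) (M : ℝ) :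
    ∃ C > 0, ∀ z : ℝ, |z| ≤ M → (|z| - 1) ^ 2 ≤ C * W z := by
  obtain ⟨α, hα, β, -, h⟩ := hW.quadratic
  obtain ⟨c, hc, h'⟩ := hW.inf_pos
  refine ⟨1 / α + (M + 1) ^ 2 / c, by positivity, fun z hz => ?_⟩
  have hWz := hW.nonneg z
  rw [add_mul]
  rcases le_total |z| 2 with hz2 | hz2
  · have h1 : (|z| - 1) ^ 2 ≤ 1 / α * W z := by
      rw [one_div, ← div_eq_inv_mul, le_div_iff₀ hα]
      nlinarith [(h z hz2).1]
    have : 0 ≤ (M + 1) ^ 2 / c * W z := by positivity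
    linarith
  · have h1 : (|z| - 1) ^ 2 ≤ (M + 1) ^ 2 / c * W z := by
      rw [div_mul_eq_mul_div, le_div_iff₀ hc]
      have : (|z| - 1) ^ 2 ≤ (M + 1) ^ 2 := by
        apply sq_le_sq' <;> nlinarith [abs_nonneg z]
      exact mul_le_mul this (h' z hz2) hc.le (by positivity)
    have : 0 ≤ 1 / α * W z := by positivity
    linarith

/-! ### The Gagliardo double integral -/

/-- The squared Gagliardo seminorm `∫_I ∫_I |g(x) - g(y)|² / |x - y|^{1+2s} dx dy`. -/
noncomputable def gagliardoSq (s : ℝ) (I : Set ℝ) (g : ℝ → ℝ) : ℝ≥0∞ :=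
  ∫⁻ x in I, ∫⁻ y in I, ENNReal.ofReal ((g x - g y) ^ 2 / |x - y| ^ (1 + 2 * s))

lemma nonlocalEnergy_one (s : ℝ) (I : Set ℝ) (g : ℝ → ℝ) :
    nonlocalEnergy s (fun _ _ => 1) I g = gagliardoSq s I g := by
  simp only [nonlocalEnergy, gagliardoSq, one_mul]

lemma gagliardoSeminorm_eq (s : ℝ) (I : Set ℝ) (g : ℝ → ℝ) :
    gagliardoSeminorm s I g = gagliardoSq s I g ^ (1 / 2 : ℝ) := by
  rw [gagliardoSeminorm, nonlocalEnergy_one]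

lemma gagliardoSq_mono (s : ℝ) {I J : Set ℝ} (h : I ⊆ J) (g : ℝ → ℝ) :
    gagliardoSq s I g ≤ gagliardoSq s J g :=
  (lintegral_mono_set h).trans (lintegral_mono fun _ => lintegral_mono_set h)

lemma gagliardoSq_congr (s : ℝ) {I : Set ℝ} {g h : ℝ → ℝ}
    (hgh : g =ᵐ[volume.restrict I] h) : gagliardoSq s I g = gagliardoSq s I h := by
  refine lintegral_congr_ae ?_
  filter_upwards [hgh] with x hx
  refine lintegral_congr_ae ?_
  filter_upwards [hgh] with y hy
  rw [hx, hy]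

lemma lintegral_Ioo_comp_sub_left (F : ℝ → ℝ≥0∞) (m b c : ℝ) :
    ∫⁻ x in Ioo (m - c) (m - b), F (m - x) = ∫⁻ x in Ioo b c, F x := by
  have h1 : MeasurePreserving (fun x : ℝ => m - x) volume volume :=
    Measure.measurePreserving_sub_left volume m
  have h2 : MeasurableEmbedding (fun x : ℝ => m - x) :=
    (MeasurableEquiv.subLeft m).measurableEmbedding
  have := h1.setLIntegral_comp_preimage_emb h2 F (Ioo b c)
  rwa [Set.preimage_const_sub_Ioo] at this

lemma gagliardoSq_Ioo_comp_sub_left (s m b c : ℝ) (g : ℝ → ℝ) :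
    gagliardoSq s (Ioo (m - c) (m - b)) (fun x => g (m - x)) = gagliardoSq s (Ioo b c) g := by
  have key := fun F : ℝ → ℝ≥0∞ => lintegral_Ioo_comp_sub_left F m b c
  simp only [gagliardoSq]
  rw [← key]
  refine lintegral_congr fun x => ?_
  rw [← key]
  refine lintegral_congr fun y => ?_
  rw [sub_sub_sub_cancel_left, abs_sub_comm y x]

/-- The kernel bound turns the nonlocal energy into a bound on the Gagliardo seminorm. -/
lemma IsHomogenizationKernel.gagliardoSq_le {αa βa : ℝ} {a : ℝ → ℝ → ℝ}
    (ha : IsHomogenizationKernel αa βa a) (hα : 0 < αa) (s : ℝ) (I : Set ℝ) (g : ℝ → ℝ) :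
    gagliardoSq s I g ≤ ENNReal.ofReal αa⁻¹ * nonlocalEnergy s a I g := by
  have hb := Measure.ae_ae_of_ae_prod (μ := (volume : Measure ℝ)) (ν := (volume : Measure ℝ))
    ha.bounds
  simp only [gagliardoSq, nonlocalEnergy]
  rw [← lintegral_const_mul' _ _ ENNReal.ofReal_ne_top]
  refine lintegral_mono_ae ?_
  filter_upwards [ae_restrict_of_ae hb] with x hx
  rw [← lintegral_const_mul' _ _ ENNReal.ofReal_ne_top]
  refine lintegral_mono_ae ?_
  filter_upwards [ae_restrict_of_ae hx] with y hy
  rw [← ENNReal.ofReal_mul (by positivity)]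
  apply ENNReal.ofReal_le_ofReal
  have h0 : 0 ≤ (g x - g y) ^ 2 / |x - y| ^ (1 + 2 * s) := by positivity
  rw [mul_div_assoc, ← mul_assoc]
  have : 1 ≤ αa⁻¹ * a x y := by
    rw [inv_mul_eq_div, le_div_iff₀ hα]; linarith [hy.1]
  nlinarith

/-! ### Mean values -/

/-- Jensen's inequality for the mean value of `a - g` over an interval. -/
lemma ofReal_sq_sub_average_le {p q : ℝ} (hpq : p < q) {g : ℝ → ℝ}
    (hg : IntervalIntegrable g volume p q) (a : ℝ) :
    ENNReal.ofReal ((a - (∫ t in p..q, g t) / (q - p)) ^ 2) ≤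
      ENNReal.ofReal (q - p)⁻¹ * ∫⁻ y in Ioo p q, ENNReal.ofReal ((a - g y) ^ 2) := by
  have hd : 0 < q - p := sub_pos.2 hpq
  have hgi : IntegrableOn g (Ioo p q) :=
    ((intervalIntegrable_iff_integrableOn_Ioo_of_le hpq.le).1 hg)
  have hci : IntegrableOn (fun _ : ℝ => a) (Ioo p q) := by simp
  have hvol : volume.real (Ioo p q) = q - p := by
    simp [Measure.real, hd.le]
  by_cases htop : ∫⁻ y in Ioo p q, ENNReal.ofReal ((a - g y) ^ 2) = ∞
  · rw [htop, ENNReal.mul_top]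
    · exact le_top
    · simpa using hd
  have hsq : IntegrableOn (fun y => (a - g y) ^ 2) (Ioo p q) := by
    refine ⟨(hci.aestronglyMeasurable.sub hgi.aestronglyMeasurable).pow 2, ?_⟩
    rw [hasFiniteIntegral_iff_ofReal (Eventually.of_forall fun y => by positivity)]
    exact lt_top_iff_ne_top.2 htop
  rw [← ofReal_integral_eq_lintegral_ofReal hsq (Eventually.of_forall fun y => by positivity),
    ← ENNReal.ofReal_mul (by positivity)]
  apply ENNReal.ofReal_le_ofReal
  rw [intervalIntegral.integral_of_le hpq.le, integral_Ioc_eq_integral_Ioo]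
  set A := ∫ t in Ioo p q, g t
  set m := a - A / (q - p) with hm
  have hI : ∫ y in Ioo p q, ((a - g y) - m) ^ 2 =
      (∫ y in Ioo p q, (a - g y) ^ 2) - 2 * m * ((q - p) * a - A) + (q - p) * m ^ 2 := by
    have e1 : ∀ y, ((a - g y) - m) ^ 2 = (a - g y) ^ 2 - 2 * m * (a - g y) + m ^ 2 :=
      fun y => by ring
    have i1 : IntegrableOn (fun y => 2 * m * (a - g y)) (Ioo p q) := (hci.sub hgi).const_mul _
    have i2 : IntegrableOn (fun _ : ℝ => m ^ 2) (Ioo p q) := by simp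
    have i3 : IntegrableOn (fun y => (a - g y) ^ 2 - 2 * m * (a - g y)) (Ioo p q) := hsq.sub i1
    simp_rw [e1]
    rw [integral_add i3 i2, integral_sub hsq i1, integral_const_mul, integral_sub hci hgi]
    simp only [integral_const, MeasurableSet.univ, measureReal_restrict_apply, univ_inter, hvol,
      smul_eq_mul]
    rfl
  have h0 : 0 ≤ ∫ y in Ioo p q, ((a - g y) - m) ^ 2 := integral_nonneg fun y => by positivity
  have h1 : (q - p) * a - A = (q - p) * m := by
    rw [hm]; field_simp
  rw [hI, h1] at h0
  rw [inv_mul_eq_div, le_div_iff₀ hd]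
  nlinarith

/-- Poincaré's inequality in the fractional space, with the mean value taken over a
subinterval. -/
lemma lintegral_sq_sub_average_le {s : ℝ} (hs : 0 < s) {b c p q : ℝ} (hpq : p < q) (hbp : b ≤ p)
    (hqc : q ≤ c) {g : ℝ → ℝ} (hg : IntervalIntegrable g volume p q) :
    ∫⁻ x in Ioo b c, ENNReal.ofReal ((g x - (∫ t in p..q, g t) / (q - p)) ^ 2) ≤
      ENNReal.ofReal ((c - b) ^ (1 + 2 * s) / (q - p)) * gagliardoSq s (Ioo b c) g := by
  have hd : 0 < q - p := sub_pos.2 hpq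
  have hL : 0 < c - b := by linarith
  rw [gagliardoSq, ← lintegral_const_mul' _ _ ENNReal.ofReal_ne_top]
  refine setLIntegral_mono' measurableSet_Ioo fun x hx => ?_
  refine (ofReal_sq_sub_average_le hpq hg (g x)).trans ?_
  rw [← lintegral_const_mul' _ _ ENNReal.ofReal_ne_top,
    ← lintegral_const_mul' _ _ ENNReal.ofReal_ne_top]
  refine (lintegral_mono_set (Ioo_subset_Ioo hbp hqc)).trans ?_
  refine setLIntegral_mono' measurableSet_Ioo fun y hy => ?_
  rw [← ENNReal.ofReal_mul (by positivity), ← ENNReal.ofReal_mul (by positivity)]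
  apply ENNReal.ofReal_le_ofReal
  rw [div_eq_inv_mul, mul_assoc]
  gcongr
  rcases eq_or_ne x y with rfl | hxy
  · simp
  have hpos : 0 < |x - y| := abs_pos.2 (sub_ne_zero.2 hxy)
  have hle : |x - y| ^ (1 + 2 * s) ≤ (c - b) ^ (1 + 2 * s) := by
    apply Real.rpow_le_rpow hpos.le _ (by linarith)
    rw [abs_le]; constructor <;> linarith [hx.1, hx.2, hy.1, hy.2]
  rw [mul_div_assoc', le_div_iff₀ (by positivity), mul_comm]
  gcongr

/-- The square of an interval integral is controlled by the integral of the square. -/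
lemma sq_intervalIntegral_le {p q Q : ℝ} (hpq : p ≤ q) {g : ℝ → ℝ}
    (hg : IntervalIntegrable g volume p q) (hQ : 0 ≤ Q)
    (h : ∫⁻ y in Ioo p q, ENNReal.ofReal (g y ^ 2) ≤ ENNReal.ofReal Q) :
    (∫ t in p..q, g t) ^ 2 ≤ (q - p) * Q := by
  rcases hpq.eq_or_lt with rfl | hpq
  · simp
  have hd : 0 < q - p := sub_pos.2 hpq
  have h1 := ofReal_sq_sub_average_le hpq hg 0
  simp only [zero_sub, neg_sq] at h1
  have h2 := h1.trans (mul_le_mul_right h _)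
  rw [← ENNReal.ofReal_mul (by positivity), ENNReal.ofReal_le_ofReal_iff (by positivity), div_pow,
    div_le_iff₀ (by positivity)] at h2
  calc _ ≤ _ := h2
    _ = _ := by field_simp

/-- Splitting off the mean value: an `L²` bound from a bound on the oscillation. -/
lemma lintegral_sq_le_of_sub {b c m : ℝ} (g : ℝ → ℝ) :
    ∫⁻ x in Ioo b c, ENNReal.ofReal (g x ^ 2) ≤
      2 * (∫⁻ x in Ioo b c, ENNReal.ofReal ((g x - m) ^ 2)) +
        ENNReal.ofReal (2 * m ^ 2) * ENNReal.ofReal (c - b) := by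
  have h2 : (2 : ℝ≥0∞) = ENNReal.ofReal 2 := by simp
  calc _ ≤ ∫⁻ x in Ioo b c, (2 * ENNReal.ofReal ((g x - m) ^ 2) + ENNReal.ofReal (2 * m ^ 2)) := by
        refine lintegral_mono fun x => ?_
        rw [h2, ← ENNReal.ofReal_mul (by positivity), ← ENNReal.ofReal_add (by positivity)
          (by positivity)]
        apply ENNReal.ofReal_le_ofReal
        nlinarith [sq_nonneg (g x - m - m)]
    _ = _ := by
        rw [lintegral_add_right _ measurable_const, lintegral_const_mul' _ _ (by simp)]
        simp

/-! ### Weak derivatives on the line -/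

lemma weakDeriv_spec {n : ℕ} {v : ℝ → ℝ} (h : ∃ g, IsWeakDeriv n v g) :
    IsWeakDeriv n v (weakDeriv n v) := by
  rw [weakDeriv, dif_pos h]
  exact h.choose_spec

lemma intervalIntegrable_of_locallyIntegrable {f : ℝ → ℝ} (hf : LocallyIntegrable f) (x y : ℝ) :
    IntervalIntegrable f volume x y :=
  intervalIntegrable_iff.mpr
    ((hf.integrableOn_isCompact isCompact_uIcc).mono_set uIoc_subset_uIcc)

lemma contDiff_iteratedDeriv {φ : ℝ → ℝ} (h : ContDiff ℝ (⊤ : ℕ∞) φ) (n : ℕ) :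
    ContDiff ℝ (⊤ : ℕ∞) (iteratedDeriv n φ) := by
  rw [iteratedDeriv_eq_iterate]
  exact ContDiff.iterate_deriv n h

lemma tsupport_iteratedDeriv_subset (φ : ℝ → ℝ) (n : ℕ) :
    tsupport (iteratedDeriv n φ) ⊆ tsupport φ := by
  induction n with
  | zero => simp
  | succ n ih => rw [iteratedDeriv_succ]; exact tsupport_deriv_subset.trans ih

lemma hasCompactSupport_iteratedDeriv {φ : ℝ → ℝ} (h : HasCompactSupport φ) (n : ℕ) :
    HasCompactSupport (iteratedDeriv n φ) :=
  h.of_isClosed_subset (isClosed_tsupport _) (tsupport_iteratedDeriv_subset φ n)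

lemma IsWeakDeriv.ae_eq_of_zero {v g : ℝ → ℝ} (h : IsWeakDeriv 0 v g) : v =ᵐ[volume] g := by
  refine ae_eq_of_integral_contDiff_smul_eq h.1 h.2.1 fun φ hφ hc => ?_
  have := h.2.2 φ hφ hc
  simpa [mul_comm] using this

lemma IsWeakDeriv.one_of_succ {n : ℕ} {v g g' : ℝ → ℝ} (h : IsWeakDeriv n v g)
    (h' : IsWeakDeriv (n + 1) v g') : IsWeakDeriv 1 g g' := by
  refine ⟨h.2.1, h'.2.1, fun φ hφ hc => ?_⟩
  have h1 := h.2.2 (deriv φ) (contDiff_infty_iff_deriv.1 hφ).2 hc.deriv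
  have h2 := h'.2.2 φ hφ hc
  rw [iteratedDeriv_succ', h1, pow_succ] at h2
  have h3 : ((-1 : ℝ) ^ n) ≠ 0 := by positivity
  rw [iteratedDeriv_one, pow_one]
  apply mul_left_cancel₀ h3
  rw [h2]; ring

/-- On an open set where `v` is constant, its weak derivatives vanish. -/
lemma IsWeakDeriv.ae_eq_zero_of_const {n : ℕ} (hn : 1 ≤ n) {v g : ℝ → ℝ} (h : IsWeakDeriv n v g)
    {U : Set ℝ} (hU : IsOpen U) {c : ℝ} (hv : ∀ x ∈ U, v x = c) : ∀ᵐ x, x ∈ U → g x = 0 := by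
  refine hU.ae_eq_zero_of_integral_contDiff_smul_eq_zero (h.2.1.locallyIntegrableOn U)
    fun φ hφ hc hs => ?_
  obtain ⟨m, rfl⟩ : ∃ m, n = m + 1 := ⟨n - 1, by omega⟩
  have h1 := h.2.2 φ hφ hc
  have h2 : ∀ x, v x * iteratedDeriv (m + 1) φ x = c * iteratedDeriv (m + 1) φ x := by
    intro x
    by_cases hx : x ∈ tsupport φ
    · rw [hv x (hs hx)]
    · rw [image_eq_zero_of_notMem_tsupport fun h => hx (tsupport_iteratedDeriv_subset _ _ h)]
      simp
  have h3 : ∫ x, iteratedDeriv (m + 1) φ x = 0 := by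
    have hd := contDiff_iteratedDeriv hφ m
    refine integral_eq_zero_of_hasDerivAt_of_integrable (f := iteratedDeriv m φ) (fun x => ?_)
      ((contDiff_iteratedDeriv hφ (m + 1)).continuous.integrable_of_hasCompactSupport
        (hasCompactSupport_iteratedDeriv hc _))
      (hd.continuous.integrable_of_hasCompactSupport (hasCompactSupport_iteratedDeriv hc _))
    rw [iteratedDeriv_succ]
    exact (hd.differentiable (by simp) x).hasDerivAt
  simp_rw [h2] at h1
  rw [integral_const_mul, h3, mul_zero] at h1
  have h4 : ((-1 : ℝ) ^ (m + 1)) ≠ 0 := by positivity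
  have h5 := (mul_eq_zero.1 h1.symm).resolve_left h4
  simpa [mul_comm] using h5

/-- Integration by parts of a primitive against a test function. -/
lemma integral_primitive_mul_deriv {h φ : ℝ → ℝ} (hh : LocallyIntegrable h)
    (hφ : ContDiff ℝ (⊤ : ℕ∞) φ) (hc : HasCompactSupport φ) :
    ∫ x, (∫ t in (0 : ℝ)..x, h t) * deriv φ x = -∫ x, h x * φ x := by
  obtain ⟨R, hR, hR0⟩ := hc.exists_pos_le_norm
  obtain ⟨R', hR', hR0'⟩ := hc.deriv.exists_pos_le_norm
  set r := max R R' with hr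
  have e1 : ∫ x, (∫ t in (0 : ℝ)..x, h t) * deriv φ x =
      ∫ x in (-r)..r, (∫ t in (0 : ℝ)..x, h t) * deriv φ x := by
    refine (intervalIntegral.integral_eq_integral_of_support_subset fun x hx => ?_).symm
    by_contra hx'
    apply hx
    have : R' ≤ ‖x‖ := by
      rw [Real.norm_eq_abs]; by_contra! hlt
      have := abs_lt.1 (hlt.trans_le (le_max_right R R'))
      exact hx' ⟨this.1, this.2.le⟩
    simp [hR0' x this]
  have e2 : ∫ x, h x * φ x = ∫ x in (-r)..r, h x * φ x := by
    refine (intervalIntegral.integral_eq_integral_of_support_subset fun x hx => ?_).symm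
    by_contra hx'
    apply hx
    have : R ≤ ‖x‖ := by
      rw [Real.norm_eq_abs]; by_contra! hlt
      have := abs_lt.1 (hlt.trans_le (le_max_left R R'))
      exact hx' ⟨this.1, this.2.le⟩
    simp [hR0 x this]
  have hrpos : 0 < r := hR.trans_le (le_max_left _ _)
  have ac1 : AbsolutelyContinuousOnInterval (fun x => ∫ t in (0 : ℝ)..x, h t) (-r) r :=
    (intervalIntegrable_of_locallyIntegrable hh _ _).absolutelyContinuousOnInterval_intervalIntegral
      (by rw [uIcc_of_le (by linarith)]; exact ⟨by linarith, hrpos.le⟩)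
  have ac2 : AbsolutelyContinuousOnInterval φ (-r) r :=
    ((hφ.of_le (by exact_mod_cast le_top)).contDiffOn).absolutelyContinuousOnInterval
  rw [e1, e2, ac1.integral_mul_deriv_eq_deriv_mul ac2, hR0 r, hR0 (-r)]
  · have : ∫ x in (-r)..r, deriv (fun x => ∫ t in (0 : ℝ)..x, h t) x * φ x =
        ∫ x in (-r)..r, h x * φ x := by
      refine intervalIntegral.integral_congr_ae ?_
      filter_upwards [_root_.LocallyIntegrable.ae_hasDerivAt_integral hh] with x hx _
      rw [(hx 0).deriv]
    rw [this]; simp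
  · rw [norm_neg, Real.norm_eq_abs, abs_of_pos hrpos]; exact le_max_left _ _
  · rw [Real.norm_eq_abs, abs_of_pos hrpos]; exact le_max_left _ _

/-- A smooth compactly supported function with zero integral is the derivative of another. -/
lemma exists_deriv_eq_of_integral_eq_zero {ψ : ℝ → ℝ} (hψ : ContDiff ℝ (⊤ : ℕ∞) ψ)
    (hc : HasCompactSupport ψ) (h0 : ∫ x, ψ x = 0) :
    ∃ φ : ℝ → ℝ, ContDiff ℝ (⊤ : ℕ∞) φ ∧ HasCompactSupport φ ∧ deriv φ = ψ := by
  obtain ⟨R, hR, hR0⟩ := hc.exists_pos_le_norm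
  have hint : ∀ x y, IntervalIntegrable ψ volume x y := fun x y =>
    hψ.continuous.intervalIntegrable x y
  have hd : ∀ x, HasDerivAt (fun x => ∫ t in (-R)..x, ψ t) (ψ x) x := fun x =>
    (hψ.continuous.integral_hasStrictDerivAt (-R) x).hasDerivAt
  have hderiv : deriv (fun x => ∫ t in (-R)..x, ψ t) = ψ := funext fun x => (hd x).deriv
  have hzero : ∀ x, R ≤ |x| → ψ x = 0 := fun x hx => hR0 x hx
  refine ⟨fun x => ∫ t in (-R)..x, ψ t, ?_, ?_, hderiv⟩
  · exact contDiff_infty_iff_deriv.2 ⟨fun x => (hd x).differentiableAt, by rw [hderiv]; exact hψ⟩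
  · refine HasCompactSupport.intro (isCompact_Icc (a := -R) (b := R)) fun x hx => ?_
    have hout : x < -R ∨ R < x := by
      by_contra! hcon
      exact hx ⟨hcon.1, hcon.2⟩
    rcases hout with hx | hx
    · rw [intervalIntegral.integral_symm, intervalIntegral.integral_congr (g := fun _ => 0)]
      · simp
      · intro t ht
        rw [uIcc_of_le hx.le] at ht
        exact hzero t (by rw [abs_of_nonpos (by linarith [ht.2])]; linarith [ht.2])
    · rw [intervalIntegral.integral_eq_integral_of_support_subset, h0]
      intro t ht
      by_contra ht'
      refine ht (hzero t ?_)
      by_contra! hlt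
      have := abs_lt.1 hlt
      exact ht' ⟨this.1, by linarith [this.2]⟩

/-- The lemma of du Bois-Reymond: a function with a weak derivative is, up to a constant, its
primitive. -/
lemma IsWeakDeriv.exists_ae_eq_primitive {u h : ℝ → ℝ} (hu : IsWeakDeriv 1 u h) :
    ∃ c, u =ᵐ[volume] fun x => c + ∫ t in (0 : ℝ)..x, h t := by
  set H : ℝ → ℝ := fun x => ∫ t in (0 : ℝ)..x, h t with hH
  have hHc : Continuous H := intervalIntegral.continuous_primitive
    (fun a b => intervalIntegrable_of_locallyIntegrable hu.2.1 a b) 0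
  let ρ : ContDiffBump (0 : ℝ) := ⟨1, 2, one_pos, one_lt_two⟩
  set r : ℝ → ℝ := ρ.normed volume with hr
  have hr1 : ContDiff ℝ (⊤ : ℕ∞) r := ρ.contDiff_normed
  have hr2 : HasCompactSupport r := ρ.hasCompactSupport_normed
  have hr3 : ∫ x, r x = 1 := ρ.integral_normed
  have hw : LocallyIntegrable (fun x => u x - H x) := hu.1.sub hHc.locallyIntegrable
  have hwint : ∀ ψ : ℝ → ℝ, ContDiff ℝ (⊤ : ℕ∞) ψ → HasCompactSupport ψ →
      Integrable fun x => (u x - H x) * ψ x := fun ψ h1 h2 =>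
    hw.integrable_smul_right_of_hasCompactSupport h1.continuous h2
  have horth : ∀ φ : ℝ → ℝ, ContDiff ℝ (⊤ : ℕ∞) φ → HasCompactSupport φ →
      ∫ x, (u x - H x) * deriv φ x = 0 := by
    intro φ h1 h2
    have h3 := hu.2.2 φ h1 h2
    have h4 := integral_primitive_mul_deriv hu.2.1 h1 h2
    have hd := (contDiff_infty_iff_deriv.1 h1).2
    have i1 : Integrable fun x => u x * deriv φ x :=
      hu.1.integrable_smul_right_of_hasCompactSupport hd.continuous h2.deriv
    have i2 : Integrable fun x => H x * deriv φ x :=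
      hHc.locallyIntegrable.integrable_smul_right_of_hasCompactSupport hd.continuous h2.deriv
    rw [iteratedDeriv_one] at h3
    simp_rw [sub_mul]
    rw [integral_sub i1 i2, h3, h4]
    ring
  refine ⟨∫ x, (u x - H x) * r x, ?_⟩
  set c := ∫ x, (u x - H x) * r x with hc
  have key : ∀ᵐ x, u x - H x = c := by
    refine ae_eq_of_integral_contDiff_smul_eq hw (locallyIntegrable_const c) fun ψ h1 h2 => ?_
    have hψi : Integrable ψ := h1.continuous.integrable_of_hasCompactSupport h2
    have hri : Integrable r := hr1.continuous.integrable_of_hasCompactSupport hr2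
    obtain ⟨φ, hφ1, hφ2, hφ3⟩ := exists_deriv_eq_of_integral_eq_zero
      (ψ := fun x => ψ x - (∫ y, ψ y) * r x) (h1.sub (contDiff_const.mul hr1))
      (h2.sub (hr2.mul_left)) (by
        rw [integral_sub hψi (hri.const_mul _), integral_const_mul, hr3]; ring)
    have h3 := horth φ hφ1 hφ2
    rw [hφ3] at h3
    have e : ∀ x, (u x - H x) * (ψ x - (∫ y, ψ y) * r x) =
        (u x - H x) * ψ x - (∫ y, ψ y) * ((u x - H x) * r x) := fun x => by ring
    simp_rw [e] at h3
    rw [integral_sub (hwint ψ h1 h2) ((hwint r hr1 hr2).const_mul _), integral_const_mul] at h3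
    simp only [smul_eq_mul]
    rw [integral_mul_const]
    simp_rw [mul_comm (ψ _)]
    linarith
  filter_upwards [key] with x hx
  linarith

/-- A chain of derivatives of order `k`: the functions `u 0, …, u (k - 1)` are continuous, each
`u j` with `j < k` is a primitive of `u (j + 1)`, and `u k` is locally integrable. -/
structure IsDerivChain (k : ℕ) (u : ℕ → ℝ → ℝ) : Prop where
  continuous : ∀ j < k, Continuous (u j)
  locallyIntegrable : LocallyIntegrable (u k)
  integral_eq : ∀ j < k, ∀ x y : ℝ, ∫ t in x..y, u (j + 1) t = u j y - u j x

lemma IsDerivChain.intervalIntegrable {k : ℕ} {u : ℕ → ℝ → ℝ} (h : IsDerivChain k u) {j : ℕ}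
    (hj : j ≤ k) (x y : ℝ) : IntervalIntegrable (u j) volume x y := by
  rcases hj.eq_or_lt with rfl | hj
  · exact intervalIntegrable_of_locallyIntegrable h.locallyIntegrable x y
  · exact (h.continuous j hj).intervalIntegrable x y

/-- Subtracting a constant from the first member of a chain gives a chain. -/
lemma IsDerivChain.sub_const {k : ℕ} (hk : 1 ≤ k) {u : ℕ → ℝ → ℝ} (h : IsDerivChain k u)
    (c : ℝ) : IsDerivChain k (fun j => if j = 0 then fun x => u 0 x - c else u j) where
  continuous j hj := by
    by_cases h0 : j = 0
    · subst h0; exact (h.continuous 0 hj).sub continuous_const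
    · simpa [h0] using h.continuous j hj
  locallyIntegrable := by
    have : k ≠ 0 := by omega
    simpa [this] using h.locallyIntegrable
  integral_eq j hj x y := by
    by_cases h0 : j = 0
    · subst h0; simpa using h.integral_eq 0 hj x y
    · simpa [h0] using h.integral_eq j hj x y

/-- A continuous function of class `H^{k+s}_loc` starts a chain of derivatives that consists of
representatives of its weak derivatives. -/
lemma MemHloc.exists_chain {k : ℕ} {s : ℝ} {v : ℝ → ℝ} (h : MemHloc k s v) (hv : Continuous v)
    (hk : 1 ≤ k) :
    ∃ u : ℕ → ℝ → ℝ, IsDerivChain k u ∧ u 0 = v ∧ u k = weakDeriv k v ∧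
      ∀ j ≤ k, u j =ᵐ[volume] weakDeriv j v := by
  have hw : ∀ j ≤ k, IsWeakDeriv j v (weakDeriv j v) := fun j hj =>
    weakDeriv_spec (h.exists_weakDeriv j hj)
  have h1 : ∀ j, ∃ c, j < k →
      weakDeriv j v =ᵐ[volume] fun x => c + ∫ t in (0 : ℝ)..x, weakDeriv (j + 1) v t := by
    intro j
    by_cases hj : j < k
    · obtain ⟨c, hc⟩ := ((hw j hj.le).one_of_succ (hw (j + 1) hj)).exists_ae_eq_primitive
      exact ⟨c, fun _ => hc⟩
    · exact ⟨0, fun h => absurd h hj⟩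
  choose c hc using h1
  set u : ℕ → ℝ → ℝ := fun j =>
    if j < k then fun x => c j + ∫ t in (0 : ℝ)..x, weakDeriv (j + 1) v t else weakDeriv j v
    with hu
  have hii : ∀ j ≤ k, ∀ x y, IntervalIntegrable (weakDeriv j v) volume x y := fun j hj x y =>
    intervalIntegrable_of_locallyIntegrable (hw j hj).2.1 x y
  have hue : ∀ j ≤ k, u j =ᵐ[volume] weakDeriv j v := by
    intro j hj
    by_cases hjk : j < k
    · simp only [hu, hjk, if_true]; exact (hc j hjk).symm
    · simp only [hu, hjk, if_false]; rfl
  have hcont : ∀ j < k, Continuous (u j) := by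
    intro j hj
    simp only [hu, hj, if_true]
    exact continuous_const.add (intervalIntegral.continuous_primitive (hii (j + 1) hj) 0)
  have huk : u k = weakDeriv k v := by simp [hu]
  refine ⟨u, ⟨hcont, by rw [huk]; exact (hw k le_rfl).2.1, fun j hj x y => ?_⟩, ?_, huk, hue⟩
  · rw [intervalIntegral.integral_congr_ae (g := weakDeriv (j + 1) v)
      ((hue (j + 1) hj).mono fun t ht _ => ht)]
    simp only [hu, hj, if_true]
    rw [add_sub_add_left_eq_sub, intervalIntegral.integral_interval_sub_left
      (hii (j + 1) hj _ _) (hii (j + 1) hj _ _)]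
  · have : u 0 =ᵐ[volume] v := (hue 0 (by omega)).trans (hw 0 (by omega)).ae_eq_of_zero.symm
    exact ((hcont 0 (by omega)).ae_eq_iff_eq volume hv).1 this

/-! ### Hölder continuity for `s > 1/2` -/

/-- The endpoint value of a continuous function is close to its mean: the means over the intervals
`(b, b + (c - b) / 2^n)` converge geometrically to the value at `b`. -/
lemma abs_sub_average_le {s : ℝ} (hs : 1 / 2 < s) {v : ℝ → ℝ} (hv : Continuous v) {b c E : ℝ}
    (hbc : b < c) (hE : 0 ≤ E) (h : gagliardoSq s (Ioo b c) v ≤ ENNReal.ofReal E) :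
    |v b - (∫ t in b..c, v t) / (c - b)| ≤
      √2 / (1 - (1 / 2 : ℝ) ^ (s - 1 / 2)) * (c - b) ^ (s - 1 / 2) * √E := by
  set ℓ := c - b with hℓ
  have hℓ0 : 0 < ℓ := sub_pos.2 hbc
  set θ : ℝ := (1 / 2 : ℝ) ^ (s - 1 / 2) with hθ
  have hθ0 : 0 < θ := by positivity
  have hθ1 : θ < 1 := Real.rpow_lt_one (by norm_num) (by norm_num) (by linarith)
  set l : ℕ → ℝ := fun n => ℓ * (1 / 2) ^ n with hl
  have hl0 : ∀ n, 0 < l n := fun n => by positivity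
  have hl1 : ∀ n, l n ≤ ℓ := fun n =>
    mul_le_of_le_one_right hℓ0.le (pow_le_one₀ (by norm_num) (by norm_num))
  have hls : ∀ n, l (n + 1) = l n / 2 := fun n => by simp only [hl, pow_succ]; ring
  set a : ℕ → ℝ := fun n => (∫ t in b..(b + l n), v t) / l n with ha
  have hii : ∀ x y, IntervalIntegrable v volume x y := fun x y => hv.intervalIntegrable x y
  have hstep : ∀ n, dist (a n) (a (n + 1)) ≤ (√2 * ℓ ^ (s - 1 / 2) * √E) * θ ^ n := by
    intro n
    rw [dist_comm, Real.dist_eq]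
    have h1 := ofReal_sq_sub_average_le (p := b) (q := b + l n) (by linarith [hl0 n])
      (hii _ _) (a (n + 1))
    have h2 := lintegral_sq_sub_average_le (s := s) (by linarith) (b := b) (c := b + l n) (p := b)
      (q := b + l (n + 1)) (by linarith [hl0 (n + 1)]) le_rfl
      (by rw [hls]; linarith [hl0 n]) (hii _ _)
    have h3 := (gagliardoSq_mono s (Ioo_subset_Ioo (le_refl b)
      (by linarith [hl1 n] : b + l n ≤ c)) v).trans h
    simp only [add_sub_cancel_left] at h1 h2
    have h4 : ∫⁻ y in Ioo b (b + l n), ENNReal.ofReal ((a (n + 1) - v y) ^ 2) ≤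
        ENNReal.ofReal (l n ^ (1 + 2 * s) / l (n + 1)) * ENNReal.ofReal E := by
      refine le_trans ?_ (h2.trans (mul_le_mul_right h3 _))
      refine lintegral_mono fun y => ENNReal.ofReal_le_ofReal ?_
      simp only [ha]
      rw [← neg_sub, neg_sq]
    have h5 := h1.trans (mul_le_mul_right h4 _)
    rw [← ENNReal.ofReal_mul (by have := hl0 n; have := hl0 (n + 1); positivity),
      ← ENNReal.ofReal_mul (by have := hl0 n; positivity),
      ENNReal.ofReal_le_ofReal_iff (by have := hl0 n; have := hl0 (n + 1); positivity)] at h5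
    apply abs_le_of_sq_le_sq _ (by positivity)
    refine h5.trans (le_of_eq ?_)
    have e1 : l n ^ (1 + 2 * s) = l n ^ 2 * (l n ^ (s - 1 / 2)) ^ 2 := by
      rw [← Real.rpow_natCast (l n) 2, ← Real.rpow_mul_natCast (hl0 n).le,
        ← Real.rpow_add (hl0 n)]
      congr 1; push_cast; ring
    have e2 : l n ^ (s - 1 / 2) = ℓ ^ (s - 1 / 2) * θ ^ n := by
      simp only [hl, hθ]
      rw [Real.mul_rpow hℓ0.le (by positivity), Real.rpow_pow_comm (by norm_num)]
    have hn := (hl0 n).ne'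
    have e3 : (√2 * ℓ ^ (s - 1 / 2) * √E * θ ^ n) ^ 2 =
        √2 ^ 2 * √E ^ 2 * (ℓ ^ (s - 1 / 2) * θ ^ n) ^ 2 := by ring
    rw [hls, e1, e2, e3, Real.sq_sqrt zero_le_two, Real.sq_sqrt hE]
    generalize l n = z at hn
    field_simp
  have hlim : Tendsto a atTop (𝓝 (v b)) := by
    have hd : HasDerivAt (fun x => ∫ t in b..x, v t) (v b) b :=
      (hv.integral_hasStrictDerivAt b b).hasDerivAt
    have h1 := hasDerivAt_iff_tendsto_slope_zero.1 hd
    have h2 : Tendsto l atTop (𝓝[≠] 0) := by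
      refine tendsto_nhdsWithin_iff.2 ⟨?_, Eventually.of_forall fun n => (hl0 n).ne'⟩
      have := (tendsto_pow_atTop_nhds_zero_of_lt_one (r := (1 / 2 : ℝ)) (by norm_num)
        (by norm_num)).const_mul ℓ
      simpa [hl] using this
    have h3 := h1.comp h2
    refine h3.congr fun n => ?_
    simp [ha, div_eq_inv_mul]
  have h6 := dist_le_of_le_geometric_of_tendsto₀ θ _ hθ1 hstep hlim
  have ha0 : a 0 = (∫ t in b..c, v t) / ℓ := by
    simp only [ha, hl, pow_zero, mul_one]
    rw [hℓ, add_sub_cancel]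
  rw [dist_comm, Real.dist_eq, ha0] at h6
  refine h6.trans (le_of_eq ?_)
  ring

/-- The fractional Morrey inequality on the line. -/
lemma exists_abs_sub_le_of_gagliardoSq_le {s : ℝ} (hs : 1 / 2 < s) :
    ∃ C > 0, ∀ v : ℝ → ℝ, Continuous v → ∀ b c E : ℝ, b ≤ c → 0 ≤ E →
      gagliardoSq s (Ioo b c) v ≤ ENNReal.ofReal E →
      |v b - v c| ≤ C * (c - b) ^ (s - 1 / 2) * √E := by
  have hθ1 : (1 / 2 : ℝ) ^ (s - 1 / 2) < 1 :=
    Real.rpow_lt_one (by norm_num) (by norm_num) (by linarith)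
  have hK : 0 < √2 / (1 - (1 / 2 : ℝ) ^ (s - 1 / 2)) := div_pos (by positivity) (by linarith)
  refine ⟨2 * (√2 / (1 - (1 / 2 : ℝ) ^ (s - 1 / 2))), by positivity,
    fun v hv b c E hbc hE h => ?_⟩
  rcases hbc.eq_or_lt with rfl | hbc
  · rw [sub_self, abs_zero, sub_self, Real.zero_rpow (by linarith)]
    simp
  have h1 := abs_sub_average_le hs hv hbc hE h
  have h2 := abs_sub_average_le hs (v := fun x => v (b + c - x)) (by fun_prop) hbc hE (by
    have := gagliardoSq_Ioo_comp_sub_left s (b + c) b c v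
    simp only [add_sub_cancel_left, add_sub_cancel_right] at this
    rwa [this])
  rw [intervalIntegral.integral_comp_sub_left] at h2
  simp only [add_sub_cancel_left, add_sub_cancel_right] at h2
  rw [abs_le] at h1 h2 ⊢
  constructor <;> linarith [h1.1, h1.2, h2.1, h2.2]

/-! ### Interpolation along a chain of derivatives -/

/-- An `L²` bound from a bound on the mean over a subinterval and the Gagliardo seminorm. -/
lemma lintegral_sq_le_of_average {s : ℝ} (hs : 0 < s) {b c p q d m G : ℝ} (hd : 0 < d)
    (hdpq : d ≤ q - p) (hbp : b ≤ p) (hqc : q ≤ c) {g : ℝ → ℝ}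
    (hg : IntervalIntegrable g volume p q) (hm : |(∫ t in p..q, g t) / (q - p)| ≤ m)
    (hG : 0 ≤ G) (h : gagliardoSq s (Ioo b c) g ≤ ENNReal.ofReal G) :
    ∫⁻ x in Ioo b c, ENNReal.ofReal (g x ^ 2) ≤
      ENNReal.ofReal (2 * ((c - b) ^ (1 + 2 * s) / d * G + (c - b) * m ^ 2)) := by
  have hL : 0 < c - b := by linarith
  have hm2 : ((∫ t in p..q, g t) / (q - p)) ^ 2 ≤ m ^ 2 := sq_le_sq' (by linarith [abs_le.1 hm])
    (abs_le.1 hm).2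
  refine (lintegral_sq_le_of_sub (m := (∫ t in p..q, g t) / (q - p)) g).trans ?_
  have h1 := (lintegral_sq_sub_average_le hs (by linarith) hbp hqc hg).trans
    (mul_le_mul_right h _)
  rw [← ENNReal.ofReal_mul (by have : 0 < q - p := by linarith
                               positivity)] at h1
  have h2 : (2 : ℝ≥0∞) = ENNReal.ofReal 2 := by simp
  refine (add_le_add (mul_le_mul_right h1 _) le_rfl).trans ?_
  rw [h2, ← ENNReal.ofReal_mul zero_le_two, ← ENNReal.ofReal_mul (by positivity),
    ← ENNReal.ofReal_add (by have : 0 < q - p := by linarith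
                             positivity) (by positivity)]
  apply ENNReal.ofReal_le_ofReal
  have h3 : (c - b) ^ (1 + 2 * s) / (q - p) * G ≤ (c - b) ^ (1 + 2 * s) / d * G := by gcongr
  have h4 := mul_le_mul_of_nonneg_left hm2 hL.le
  nlinarith

lemma IsDerivChain.hasDerivAt {k : ℕ} {u : ℕ → ℝ → ℝ} (h : IsDerivChain k u) {j : ℕ}
    (hj : j + 1 < k) (x : ℝ) : HasDerivAt (u j) (u (j + 1) x) x := by
  have h1 := ((h.continuous (j + 1) hj).integral_hasStrictDerivAt 0 x).hasDerivAt.const_add (u j 0)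
  refine h1.congr_of_eventuallyEq (Eventually.of_forall fun y => ?_)
  simp only [h.integral_eq j (by omega)]
  ring

lemma IsDerivChain.shift {k : ℕ} {u : ℕ → ℝ → ℝ} (h : IsDerivChain (k + 1) u) :
    IsDerivChain k (fun j => u (j + 1)) :=
  ⟨fun j hj => h.continuous (j + 1) (by omega), h.locallyIntegrable,
    fun j hj => h.integral_eq (j + 1) (by omega)⟩

/-- If `u 0` is bounded by `A` at some point of every subinterval of length `d`, the mean value
theorem makes `u j` bounded by `(2 / d) ^ j * A` at some point of every subinterval of length
`3 ^ j * d`. -/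
lemma IsDerivChain.exists_abs_le {k : ℕ} {u : ℕ → ℝ → ℝ} (h : IsDerivChain k u) {b c d A : ℝ}
    (hd : 0 < d) (hA : 0 ≤ A)
    (hit : ∀ p, b ≤ p → p + d ≤ c → ∃ y ∈ Icc p (p + d), |u 0 y| ≤ A) :
    ∀ j < k, ∀ p, b ≤ p → p + 3 ^ j * d ≤ c →
      ∃ y ∈ Icc p (p + 3 ^ j * d), |u j y| ≤ (2 / d) ^ j * A := by
  intro j
  induction j with
  | zero => intro _ p h1 h2; simpa using hit p h1 (by simpa using h2)
  | succ j ih =>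
    intro hj p h1 h2
    set e := (3 : ℝ) ^ j * d with he
    have hde : d ≤ e := le_mul_of_one_le_left hd.le (one_le_pow₀ (by norm_num))
    have he3 : (3 : ℝ) ^ (j + 1) * d = 3 * e := by rw [he, pow_succ]; ring
    rw [he3] at h2 ⊢
    obtain ⟨y, hy, hy'⟩ := ih (by omega) p h1 (by linarith)
    obtain ⟨z, hz, hz'⟩ := ih (by omega) (p + 2 * e) (by linarith) (by linarith)
    have hyz : d ≤ z - y := by linarith [hy.2, hz.1]
    obtain ⟨x, hx, hx'⟩ := exists_hasDerivAt_eq_slope (u j) (u (j + 1)) (a := y) (b := z)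
      (by linarith) (h.continuous j (by omega)).continuousOn
      (fun x _ => h.hasDerivAt hj x)
    refine ⟨x, ⟨by linarith [hx.1, hy.1], by linarith [hx.2, hz.2]⟩, ?_⟩
    rw [hx', abs_div, abs_of_pos (by linarith : 0 < z - y), div_le_iff₀ (by linarith)]
    have h3 : |u j z - u j y| ≤ 2 * ((2 / d) ^ j * A) := by
      refine (abs_sub _ _).trans ?_
      linarith
    refine h3.trans ?_
    have h4 : 2 * ((2 / d) ^ j * A) = (2 / d) ^ (j + 1) * A * d := by
      rw [pow_succ]; field_simp
    rw [h4]
    gcongr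

/-- Bounds for the mean of the last member of a chain over a long subinterval. -/
lemma IsDerivChain.exists_average_le {k : ℕ} (hk : 1 ≤ k) {u : ℕ → ℝ → ℝ} (h : IsDerivChain k u)
    {b c d A : ℝ} (hd : 0 < d) (hA : 0 ≤ A) (hbc : b + 3 ^ k * d ≤ c)
    (hit : ∀ p, b ≤ p → p + d ≤ c → ∃ y ∈ Icc p (p + d), |u 0 y| ≤ A) :
    ∃ p q, b ≤ p ∧ q ≤ c ∧ d ≤ q - p ∧ |(∫ t in p..q, u k t) / (q - p)| ≤ (2 / d) ^ k * A := by
  obtain ⟨j, rfl⟩ : ∃ j, k = j + 1 := ⟨k - 1, by omega⟩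
  set e := (3 : ℝ) ^ j * d with he
  have hde : d ≤ e := le_mul_of_one_le_left hd.le (one_le_pow₀ (by norm_num))
  have he3 : (3 : ℝ) ^ (j + 1) * d = 3 * e := by rw [he, pow_succ]; ring
  rw [he3] at hbc
  obtain ⟨y, hy, hy'⟩ := h.exists_abs_le hd hA hit j (by omega) b le_rfl (by linarith)
  obtain ⟨z, hz, hz'⟩ := h.exists_abs_le hd hA hit j (by omega) (b + 2 * e) (by linarith)
    (by linarith)
  have hyz : d ≤ z - y := by linarith [hy.2, hz.1]
  refine ⟨y, z, hy.1, by linarith [hz.2], hyz, ?_⟩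
  rw [h.integral_eq j (by omega), abs_div, abs_of_pos (by linarith : 0 < z - y),
    div_le_iff₀ (by linarith)]
  have h3 : |u j z - u j y| ≤ 2 * ((2 / d) ^ j * A) := by
    refine (abs_sub _ _).trans ?_
    linarith
  refine h3.trans ?_
  have h4 : 2 * ((2 / d) ^ j * A) = (2 / d) ^ (j + 1) * A * d := by
    rw [pow_succ]; field_simp
  rw [h4]
  gcongr

/-- Integrating back down a chain: an `L²` bound for the last member, and a bound at one point for
each other member, control all members. -/
lemma exists_chain_bound (k : ℕ) {L : ℝ} (hL : 0 ≤ L) :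
    ∃ D > 0, ∀ u : ℕ → ℝ → ℝ, IsDerivChain k u → ∀ b c B Q : ℝ, b ≤ c → c - b ≤ L → 0 ≤ Q →
      ∫⁻ x in Ioo b c, ENNReal.ofReal (u k x ^ 2) ≤ ENNReal.ofReal Q →
      (∀ j < k, ∃ y ∈ Icc b c, |u j y| ≤ B) →
      (∀ j < k, ∀ x ∈ Icc b c, u j x ^ 2 ≤ D * (B ^ 2 + Q)) ∧
      (∀ j ≤ k, ∫⁻ x in Ioo b c, ENNReal.ofReal (u j x ^ 2) ≤
        ENNReal.ofReal (D * (B ^ 2 + Q))) := by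
  induction k with
  | zero =>
    refine ⟨1, one_pos, fun u _ b c B Q _ _ hQ h1 _ => ⟨fun j hj => absurd hj (by omega), ?_⟩⟩
    intro j hj
    obtain rfl : j = 0 := by omega
    refine h1.trans (ENNReal.ofReal_le_ofReal ?_)
    nlinarith [sq_nonneg B]
  | succ k ih =>
    obtain ⟨D, hD, hDb⟩ := ih
    refine ⟨D + (1 + L) * (2 + 2 * L * D), by positivity,
      fun u hu b c B Q hbc hcL hQ h1 hpt => ?_⟩
    obtain ⟨i1, i2⟩ := hDb _ hu.shift b c B Q hbc hcL hQ h1 fun j hj => hpt (j + 1) (by omega)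
    set R := B ^ 2 + Q with hR
    have hR0 : 0 ≤ R := by positivity
    have hmono : D * R ≤ (D + (1 + L) * (2 + 2 * L * D)) * R := by
      gcongr
      have : 0 ≤ (1 + L) * (2 + 2 * L * D) := by positivity
      linarith
    have hsup : ∀ x ∈ Icc b c, u 0 x ^ 2 ≤ (2 + 2 * L * D) * R := by
      intro x hx
      obtain ⟨y, hy, hyB⟩ := hpt 0 (by omega)
      have hdiff : (u 0 x - u 0 y) ^ 2 ≤ L * (D * R) := by
        have key : ∀ p q, b ≤ p → p ≤ q → q ≤ c → (u 0 q - u 0 p) ^ 2 ≤ L * (D * R) := by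
          intro p q hbp hpq hqc
          rw [← hu.integral_eq 0 (by omega)]
          have := sq_intervalIntegral_le hpq (hu.intervalIntegrable (j := 0 + 1) (by omega) p q)
            (by positivity : 0 ≤ D * R)
            ((lintegral_mono_set (Ioo_subset_Ioo hbp hqc)).trans (i2 0 (by omega)))
          refine this.trans ?_
          gcongr
          linarith
        rcases le_total x y with hxy | hxy
        · rw [← neg_sub, neg_sq]; exact key x y hx.1 hxy hy.2
        · exact key y x hy.1 hxy hx.2
      have hyB2 : u 0 y ^ 2 ≤ B ^ 2 := sq_le_sq' (by linarith [abs_le.1 hyB]) (abs_le.1 hyB).2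
      have : B ^ 2 ≤ R := by rw [hR]; linarith
      nlinarith [sq_nonneg (u 0 x - u 0 y - u 0 y)]
    have hsup' : ∀ x ∈ Icc b c, u 0 x ^ 2 ≤ (D + (1 + L) * (2 + 2 * L * D)) * R := by
      intro x hx
      refine (hsup x hx).trans (mul_le_mul_of_nonneg_right ?_ hR0)
      nlinarith [mul_nonneg hL (by positivity : 0 ≤ 2 + 2 * L * D)]
    refine ⟨fun j hj x hx => ?_, fun j hj => ?_⟩
    · rcases Nat.eq_zero_or_pos j with rfl | hj0
      · exact hsup' x hx
      · obtain ⟨i, rfl⟩ : ∃ i, j = i + 1 := ⟨j - 1, by omega⟩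
        exact (i1 i (by omega) x hx).trans hmono
    · rcases Nat.eq_zero_or_pos j with rfl | hj0
      · have : ∫⁻ x in Ioo b c, ENNReal.ofReal (u 0 x ^ 2) ≤
            ∫⁻ _ in Ioo b c, ENNReal.ofReal ((2 + 2 * L * D) * R) :=
          setLIntegral_mono' measurableSet_Ioo fun x hx =>
            ENNReal.ofReal_le_ofReal (hsup x (Ioo_subset_Icc_self hx))
        refine this.trans ?_
        rw [setLIntegral_const, Real.volume_Ioo, ← ENNReal.ofReal_mul (by positivity)]
        apply ENNReal.ofReal_le_ofReal
        have h5 : (2 + 2 * L * D) * R * (c - b) ≤ (2 + 2 * L * D) * R * L := by gcongr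
        have h6 : 0 ≤ (2 + 2 * L * D) * R := by positivity
        nlinarith [mul_nonneg hD.le hR0]
      · obtain ⟨i, rfl⟩ : ∃ i, j = i + 1 := ⟨j - 1, by omega⟩
        exact (i2 i (by omega)).trans (ENNReal.ofReal_le_ofReal hmono)

/-- Interpolation on an interval: if `u 0` is at most `A` at some point of every subinterval of
length `d`, then all members of the chain are controlled by `A` and the Gagliardo seminorm of
the last one. -/
lemma exists_interpolation {k : ℕ} (hk : 1 ≤ k) {s : ℝ} (hs : 0 < s) {d L : ℝ} (hd : 0 < d)
    (hL : 0 ≤ L) :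
    ∃ D > 0, ∀ u : ℕ → ℝ → ℝ, IsDerivChain k u → ∀ b c A G : ℝ, c - b ≤ L → b + 3 ^ k * d ≤ c →
      0 ≤ A → 0 ≤ G → (∀ p, b ≤ p → p + d ≤ c → ∃ y ∈ Icc p (p + d), |u 0 y| ≤ A) →
      gagliardoSq s (Ioo b c) (u k) ≤ ENNReal.ofReal G →
      (∀ x ∈ Icc b c, u 0 x ^ 2 ≤ D * (A ^ 2 + G)) ∧
      (∀ j ≤ k, ∫⁻ x in Ioo b c, ENNReal.ofReal (u j x ^ 2) ≤
        ENNReal.ofReal (D * (A ^ 2 + G))) := by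
  obtain ⟨D, hD, hDb⟩ := exists_chain_bound k hL
  set N : ℝ := (1 + 2 / d) ^ k with hN
  have hN0 : 0 < N := by positivity
  set K : ℝ := N ^ 2 + 2 * (L ^ (1 + 2 * s) / d + L * N ^ 2) with hK
  refine ⟨D * K, by positivity, fun u hu b c A G hcL hbc hA hG hit hgag => ?_⟩
  have hkd : 0 < (3 : ℝ) ^ k * d := by positivity
  have hNle : ∀ j ≤ k, (2 / d) ^ j * A ≤ N * A := by
    intro j hj
    have : (2 / d) ^ j ≤ N :=
      (pow_le_pow_left₀ (by positivity) (by linarith) j).trans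
        (pow_le_pow_right₀ (by have : 0 < 2 / d := by positivity
                               linarith) hj)
    gcongr
  obtain ⟨p, q, hbp, hqc, hpq, hav⟩ := hu.exists_average_le hk hd hA hbc hit
  have h1 := lintegral_sq_le_of_average hs hd hpq hbp hqc (hu.intervalIntegrable le_rfl p q)
    (hav.trans (hNle k le_rfl)) hG hgag
  have hcb : 0 ≤ c - b := by linarith
  obtain ⟨i1, i2⟩ := hDb u hu b c (N * A) _ (by linarith) hcL (by positivity) h1
    (fun j hj => by
      have h3j : (3 : ℝ) ^ j * d ≤ 3 ^ k * d := by
        gcongr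
        · norm_num
      obtain ⟨y, hy, hy'⟩ := hu.exists_abs_le hd hA hit j hj b le_rfl (by linarith)
      exact ⟨y, ⟨hy.1, by linarith [hy.2]⟩, hy'.trans (hNle j hj.le)⟩)
  have hfin : D * ((N * A) ^ 2 + 2 * ((c - b) ^ (1 + 2 * s) / d * G + (c - b) * (N * A) ^ 2)) ≤
      D * K * (A ^ 2 + G) := by
    rw [mul_assoc]
    have e1 : (c - b) ^ (1 + 2 * s) / d * G ≤ L ^ (1 + 2 * s) / d * G := by gcongr
    have e2 : (c - b) * (N * A) ^ 2 ≤ L * (N * A) ^ 2 := by gcongr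
    have e3 : 0 ≤ L ^ (1 + 2 * s) / d * A ^ 2 := by positivity
    have e4 : 0 ≤ (N ^ 2 + 2 * (L * N ^ 2)) * G := by positivity
    have e5 : K * (A ^ 2 + G) = (N * A) ^ 2 + 2 * (L ^ (1 + 2 * s) / d * G + L * (N * A) ^ 2) +
        2 * (L ^ (1 + 2 * s) / d * A ^ 2) + (N ^ 2 + 2 * (L * N ^ 2)) * G := by rw [hK]; ring
    gcongr
    rw [e5]
    linarith
  exact ⟨fun x hx => (i1 0 (by omega) x hx).trans hfin,
    fun j hj => (i2 j hj).trans (ENNReal.ofReal_le_ofReal hfin)⟩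

/-! ### The energy controls the derivative of highest order on intervals -/

lemma exists_notMem_of_lintegral_le {W v : ℝ → ℝ} {w e p d : ℝ} (hw : 0 < w) (hd : 0 < d)
    {P : Set ℝ} (hP : ∀ z ∈ P, w ≤ W z) (he : e < w * d)
    (h : ∫⁻ x in Ioo p (p + d), ENNReal.ofReal (W (v x)) ≤ ENNReal.ofReal e) :
    ∃ y ∈ Icc p (p + d), v y ∉ P := by
  by_contra! hcon
  have h1 : ∫⁻ _ in Ioo p (p + d), ENNReal.ofReal w ≤
      ∫⁻ x in Ioo p (p + d), ENNReal.ofReal (W (v x)) :=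
    setLIntegral_mono' measurableSet_Ioo fun x hx =>
      ENNReal.ofReal_le_ofReal (hP _ (hcon x (Ioo_subset_Icc_self hx)))
  rw [setLIntegral_const, Real.volume_Ioo, add_sub_cancel_left, ← ENNReal.ofReal_mul hw.le] at h1
  exact absurd (h1.trans h) (not_le.2 ((ENNReal.ofReal_lt_ofReal_iff (by positivity)).2 he))

/-- On an interval that is long compared with the energy it carries, the `L²` norm of the
derivative of order `k` is controlled linearly by the energy. If the energy is not small this
follows from boundedness; if it is small, then the function does not vanish, so that it stays
within the square root of the energy of one of the constants `±1` at most points. -/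
lemma exists_bound_of_energy_le {W : ℝ → ℝ} (hW : IsDoubleWell W) {k : ℕ} (hk : 1 ≤ k) {s : ℝ}
    (hs : 0 < s) {κ S d L w₂ : ℝ} (hκ : 0 ≤ κ) (hd : 0 < d) (hL : 0 ≤ L) (hw₂ : 0 < w₂)
    (hw₂W : ∀ z, 2 ≤ |z| → w₂ ≤ W z) (hS : S < w₂ * d) :
    ∃ C > 0, ∀ u : ℕ → ℝ → ℝ, IsDerivChain k u → ∀ b c e : ℝ, c - b ≤ L → b + 3 ^ k * d ≤ c →
      0 < e → e ≤ S →
      ∫⁻ x in Ioo b c, ENNReal.ofReal (W (u 0 x)) ≤ ENNReal.ofReal e →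
      gagliardoSq s (Ioo b c) (u k) ≤ ENNReal.ofReal (κ * e) →
      (∀ x ∈ Icc b c, |u 0 x| ≤ C) ∧
      ∫⁻ x in Ioo b c, ENNReal.ofReal (u k x ^ 2) ≤ ENNReal.ofReal (C * e) := by
  obtain ⟨D, hD, hDb⟩ := exists_interpolation hk hs hd hL
  set Q : ℝ := D * (2 ^ 2 + κ * max S 0) with hQ
  have hQ0 : 0 < Q := by positivity
  obtain ⟨C₁, hC₁, hC₁W⟩ := hW.exists_sq_le (√Q)
  obtain ⟨w, hw, hwW⟩ := hW.exists_le_of_far (δ := 1 / 2) (by norm_num)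
  set r : ℝ := min (3 ^ k * d) (1 / (8 * Q)) with hr
  have hr0 : 0 < r := by positivity
  refine ⟨√Q + Q / (w * r) + D * (2 * C₁ / d + κ), by positivity,
    fun u hu b c e hcL hbc he heS hWe hgag => ?_⟩
  have hkd : 0 < (3 : ℝ) ^ k * d := by positivity
  have hd3 : d ≤ 3 ^ k * d := le_mul_of_one_le_left hd.le (one_le_pow₀ (by norm_num))
  have hsub : ∀ p d', b ≤ p → p + d' ≤ c →
      ∫⁻ x in Ioo p (p + d'), ENNReal.ofReal (W (u 0 x)) ≤ ENNReal.ofReal e := fun p d' h1 h2 =>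
    (lintegral_mono_set (Ioo_subset_Ioo h1 h2)).trans hWe
  obtain ⟨i1, i2⟩ := hDb u hu b c 2 (κ * e) hcL hbc zero_le_two (by positivity)
    (fun p h1 h2 => by
      obtain ⟨y, hy, hy'⟩ := exists_notMem_of_lintegral_le (P := {z | 2 ≤ |z|}) hw₂ hd
        hw₂W (by linarith) (hsub p d h1 h2)
      exact ⟨y, hy, (not_le.1 hy').le⟩) hgag
  have hle : D * (2 ^ 2 + κ * e) ≤ Q := by
    rw [hQ]; gcongr; exact heS.trans (le_max_left _ _)
  have hsup : ∀ x ∈ Icc b c, |u 0 x| ≤ √Q := fun x hx =>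
    Real.le_sqrt_of_sq_le (by rw [sq_abs]; exact (i1 x hx).trans hle)
  have hpos1 : 0 ≤ Q / (w * r) := by positivity
  have hpos2 : 0 ≤ D * (2 * C₁ / d + κ) := by positivity
  refine ⟨fun x hx => (hsup x hx).trans (by linarith), ?_⟩
  by_cases hew : w * r ≤ e
  · refine (i2 k le_rfl).trans (ENNReal.ofReal_le_ofReal (hle.trans ?_))
    have : Q ≤ Q / (w * r) * e := by
      rw [div_mul_eq_mul_div, le_div_iff₀ (by positivity)]
      gcongr
    have h3 : 0 ≤ (√Q + D * (2 * C₁ / d + κ)) * e := by positivity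
    nlinarith
  · push Not at hew
    have hne : ∀ x ∈ Icc b c, u 0 x ≠ 0 := by
      intro x₀ hx₀ h0
      -- `|u 0| ≤ 1/2` near a zero, and such a stretch costs at least `w * r`
      have hrle : r ≤ c - b := (min_le_left _ _).trans (by linarith)
      obtain ⟨p, hp1, hp2, hp3⟩ : ∃ p, b ≤ p ∧ p + r ≤ c ∧ x₀ ∈ Icc p (p + r) := by
        rcases le_total (x₀ + r) c with h | h
        · exact ⟨x₀, hx₀.1, h, le_rfl, by linarith⟩
        · exact ⟨c - r, by linarith, by linarith, by linarith, by linarith [hx₀.2]⟩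
      obtain ⟨y, hy, hy'⟩ := exists_notMem_of_lintegral_le (P := {z | 1 / 2 ≤ |(|z|) - 1|}) hw hr0
        hwW hew (hsub p r hp1 hp2)
      apply hy'
      have key : ∀ p' q', b ≤ p' → p' ≤ q' → q' ≤ c → q' - p' ≤ r →
          (u 0 q' - u 0 p') ^ 2 ≤ 1 / 8 := by
        intro p' q' h1 h2 h3 h4
        rw [← hu.integral_eq 0 (by omega)]
        have := sq_intervalIntegral_le h2 (hu.intervalIntegrable (j := 0 + 1) hk p' q') hQ0.le
          ((lintegral_mono_set (Ioo_subset_Ioo h1 h3)).trans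
            ((i2 1 hk).trans (ENNReal.ofReal_le_ofReal hle)))
        refine this.trans ?_
        calc (q' - p') * Q ≤ 1 / (8 * Q) * Q := by
              gcongr
              exact h4.trans (min_le_right _ _)
          _ = 1 / 8 := by field_simp
      have hsq : u 0 y ^ 2 ≤ 1 / 8 := by
        rcases le_total x₀ y with h | h
        · have := key x₀ y hx₀.1 h (by linarith [hy.2]) (by linarith [hy.2, hp3.1])
          rwa [h0, sub_zero] at this
        · have := key y x₀ (by linarith [hy.1]) h hx₀.2 (by linarith [hy.1, hp3.2])
          rwa [h0, zero_sub, neg_sq] at this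
      have habs : |u 0 y| ≤ 1 / 2 := abs_le_of_sq_le_sq (by norm_num; linarith) (by norm_num)
      change 1 / 2 ≤ |(|u 0 y|) - 1|
      rw [abs_of_nonpos (by linarith)]
      linarith
    have hcont : ContinuousOn (u 0) (Icc b c) := (hu.continuous 0 (by omega)).continuousOn
    obtain ⟨σ, hσ⟩ : ∃ σ : ℝ, ∀ x ∈ Icc b c, |u 0 x - σ| = |(|u 0 x|) - 1| := by
      have hsgn : (∀ x ∈ Icc b c, 0 < u 0 x) ∨ (∀ x ∈ Icc b c, u 0 x < 0) := by
        by_contra! hcon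
        obtain ⟨⟨x, hx, hx'⟩, ⟨y, hy, hy'⟩⟩ := hcon
        obtain ⟨z, hz, hz'⟩ := isPreconnected_Icc.intermediate_value hx hy hcont ⟨hx', hy'⟩
        exact hne z hz hz'
      rcases hsgn with h | h
      · exact ⟨1, fun x hx => by rw [abs_of_pos (h x hx)]⟩
      · refine ⟨-1, fun x hx => ?_⟩
        rw [abs_of_neg (h x hx), ← abs_neg]
        congr 1; ring
    set A : ℝ := √(2 * C₁ * e / d) with hA
    have hA2 : A ^ 2 = 2 * C₁ * e / d := Real.sq_sqrt (by positivity)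
    have hk0 : k ≠ 0 := by omega
    obtain ⟨-, j2⟩ := hDb _ (hu.sub_const hk σ) b c A (κ * e) hcL hbc (Real.sqrt_nonneg _)
      (by positivity)
      (fun p h1 h2 => by
        obtain ⟨y, hy, hy'⟩ := exists_notMem_of_lintegral_le
          (P := {z | |z| ≤ √Q ∧ A < |(|z|) - 1|}) (w := A ^ 2 / C₁) (by rw [hA2]; positivity) hd
          (fun z hz => by
            rw [div_le_iff₀ hC₁, mul_comm]
            refine le_trans ?_ (hC₁W z hz.1)
            rw [← sq_abs (|z| - 1)]
            exact pow_le_pow_left₀ (Real.sqrt_nonneg _) hz.2.le 2)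
          (by rw [hA2]; field_simp; linarith) (hsub p d h1 h2)
        have hyI : y ∈ Icc b c := ⟨h1.trans hy.1, hy.2.trans h2⟩
        refine ⟨y, hy, ?_⟩
        simp only [if_true]
        rw [hσ y hyI]
        by_contra! hlt
        exact hy' ⟨hsup y hyI, hlt⟩)
      (by simpa [hk0] using hgag)
    have := j2 k le_rfl
    simp only [hk0, if_false] at this
    refine this.trans (ENNReal.ofReal_le_ofReal ?_)
    rw [hA2]
    have e1 : D * (2 * C₁ * e / d + κ * e) = D * (2 * C₁ / d + κ) * e := by ring
    rw [e1]
    have h3 : 0 ≤ (√Q + Q / (w * r)) * e := by positivity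
    nlinarith

/-! ### Profiles of bounded energy -/

namespace IsBoundedEnergyProfile

variable {k : ℕ} {s : ℝ} {W : ℝ → ℝ} {a : ℝ → ℝ → ℝ} {T S : ℝ} {v : ℝ → ℝ}

lemma lintegral_potential_le (h : IsBoundedEnergyProfile k s W a T S v) :
    ∫⁻ x in Ioo (-T) T, ENNReal.ofReal (W (v x)) ≤ ENNReal.ofReal S :=
  le_self_add.trans h.energy_le

lemma gagliardoSq_le (h : IsBoundedEnergyProfile k s W a T S v) {αa βa : ℝ} (hα : 0 < αa)
    (ha : IsHomogenizationKernel αa βa a) :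
    gagliardoSq s (Ioo (-T) T) (weakDeriv k v) ≤ ENNReal.ofReal (αa⁻¹ * S) := by
  rw [ENNReal.ofReal_mul (by positivity)]
  exact (ha.gagliardoSq_le hα s _ _).trans (mul_le_mul_right (le_add_self.trans h.energy_le) _)

lemma eq_or_eq_of_isPreconnected (h : IsBoundedEnergyProfile k s W a T S v) {I : Set ℝ}
    (hI : IsPreconnected I) (hT : ∀ x ∈ I, T ≤ |x|) :
    (∀ x ∈ I, v x = 1) ∨ (∀ x ∈ I, v x = -1) :=
  hI.eq_or_eq_neg_of_sq_eq (f := v) (g := fun _ => 1) h.continuous.continuousOn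
    continuousOn_const (fun x hx => by
      have := h.abs_eq_one x (hT x hx)
      simp only [Pi.pow_apply, one_pow]
      rw [← sq_abs, this, one_pow]) (by simp)

lemma eq_of_le (h : IsBoundedEnergyProfile k s W a T S v) (hT : 0 < T) {x : ℝ} (hx : T ≤ x) :
    v x = v T := by
  rcases h.eq_or_eq_of_isPreconnected (isPreconnected_Ici (a := T))
    (fun x hx => by rw [abs_of_pos (hT.trans_le hx)]; exact hx) with h1 | h1 <;>
  rw [h1 x hx, h1 T self_mem_Ici]

lemma eq_of_le_neg (h : IsBoundedEnergyProfile k s W a T S v) (hT : 0 < T) {x : ℝ}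
    (hx : x ≤ -T) : v x = v (-T) := by
  rcases h.eq_or_eq_of_isPreconnected (isPreconnected_Iic (a := -T))
    (fun x hx => by
      have : x ≤ -T := hx
      rw [abs_of_neg (by linarith)]; linarith) with h1 | h1 <;>
  rw [h1 x hx, h1 (-T) self_mem_Iic]

/-- The derivatives of a profile vanish outside `[-T, T]`. -/
lemma weakDeriv_eq_zero (h : IsBoundedEnergyProfile k s W a T S v) (hT : 0 < T) {j : ℕ}
    (hj : 1 ≤ j) (hjk : j ≤ k) : ∀ᵐ x, T < |x| → weakDeriv j v x = 0 := by
  have hw := weakDeriv_spec (h.memHloc.exists_weakDeriv j hjk)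
  filter_upwards [hw.ae_eq_zero_of_const hj isOpen_Ioi (fun x hx => h.eq_of_le hT (le_of_lt hx)),
    hw.ae_eq_zero_of_const hj isOpen_Iio (fun x hx => h.eq_of_le_neg hT (le_of_lt hx))]
    with x h1 h2 hx
  rcases lt_abs.1 hx with hx | hx
  · exact h1 hx
  · exact h2 (by simp only [mem_Iio]; linarith)

/-- The members of the chain of derivatives are at most `1` at the endpoints of `[-T, T]`. -/
lemma abs_chain_le_one (h : IsBoundedEnergyProfile k s W a T S v) (hT : 0 < T)
    {u : ℕ → ℝ → ℝ} (hu : IsDerivChain k u) (hu0 : u 0 = v)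
    (hae : ∀ j ≤ k, u j =ᵐ[volume] weakDeriv j v) {j : ℕ} (hj : j < k) :
    |u j T| ≤ 1 ∧ |u j (-T)| ≤ 1 := by
  rcases Nat.eq_zero_or_pos j with rfl | hj0
  · rw [hu0, h.abs_eq_one T (le_abs_self T),
      h.abs_eq_one (-T) (by rw [abs_neg]; exact le_abs_self T)]
    simp
  · have hz : ∀ U : Set ℝ, IsOpen U → (∀ x ∈ U, T < |x|) → EqOn (u j) (fun _ => 0) U := by
      intro U hU hUT
      refine Measure.eqOn_open_of_ae_eq (μ := volume) ?_ hU (hu.continuous j hj).continuousOn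
        continuousOn_const
      filter_upwards [ae_restrict_of_ae (hae j hj.le),
        ae_restrict_of_ae (h.weakDeriv_eq_zero hT hj0 hj.le), ae_restrict_mem hU.measurableSet]
        with x h1 h2 h3
      rw [h1, h2 (hUT x h3)]
    have hr := (hz (Ioi T) isOpen_Ioi fun x hx => lt_abs.2 (Or.inl hx)).closure
      (hu.continuous j hj) continuous_const
    have hl := (hz (Iio (-T)) isOpen_Iio fun x hx => lt_abs.2 (Or.inr (by
      have : x < -T := hx
      linarith))).closure (hu.continuous j hj) continuous_const
    rw [closure_Ioi] at hr
    rw [closure_Iio] at hl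
    rw [hr self_mem_Ici, hl self_mem_Iic]
    simp

end IsBoundedEnergyProfile

lemma lintegral_Ioo_eq_sum {x : ℕ → ℝ} (hx : Monotone x) (F : ℝ → ℝ≥0∞) (n : ℕ) :
    ∫⁻ t in Ioo (x 0) (x n), F t = ∑ i ∈ Finset.range n, ∫⁻ t in Ioo (x i) (x (i + 1)), F t := by
  have e : ∀ p q : ℝ, ∫⁻ t in Ioo p q, F t = ∫⁻ t in Ioc p q, F t := fun p q =>
    setLIntegral_congr Ioo_ae_eq_Ioc
  simp_rw [e]
  induction n with
  | zero => simp
  | succ n ih =>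
    rw [Finset.sum_range_succ, ← ih, ← lintegral_union measurableSet_Ioc
      (Ioc_disjoint_Ioc_of_le le_rfl),
      Ioc_union_Ioc_eq_Ioc (hx (Nat.zero_le n)) (hx (Nat.le_succ n))]

/-- The energies carried by consecutive intervals add up to at most the total energy. -/
lemma sum_rescaledEnergy_le {k : ℕ} {s : ℝ} {W : ℝ → ℝ} {a : ℝ → ℝ → ℝ} {v : ℝ → ℝ} {x : ℕ → ℝ}
    (hx : Monotone x) (n : ℕ) :
    ∑ i ∈ Finset.range n, rescaledEnergy k s W a v (Ioo (x i) (x (i + 1))) ≤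
      rescaledEnergy k s W a v (Ioo (x 0) (x n)) := by
  simp only [rescaledEnergy, nonlocalEnergy]
  rw [Finset.sum_add_distrib, lintegral_Ioo_eq_sum hx (fun x => ENNReal.ofReal (W (v x))),
    lintegral_Ioo_eq_sum hx (fun y => ∫⁻ z in Ioo (x 0) (x n), _)]
  refine add_le_add le_rfl (Finset.sum_le_sum fun i hi => lintegral_mono fun y => ?_)
  exact lintegral_mono_set (Ioo_subset_Ioo (hx (Nat.zero_le i)) (hx (Finset.mem_range.1 hi)))

/-- For `k ≥ 1`, the derivative of order `k` of a profile is bounded in `L²`, and the profile is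
bounded, uniformly over intervals `(-T, T)` of length bounded below. Long intervals are cut into
pieces; on short ones the boundary conditions at `±T` control the mean of the derivative. -/
lemma exists_bound_of_profile {k : ℕ} (hk : 1 ≤ k) {s : ℝ} (hs : 0 < s) {W : ℝ → ℝ}
    (hW : IsDoubleWell W) {αa βa : ℝ} (hα : 0 < αa) {T₀ : ℝ} (hT₀ : 0 < T₀) (S : ℝ) :
    ∃ C > 0, ∀ T, T₀ ≤ T → ∀ (a : ℝ → ℝ → ℝ) (v : ℝ → ℝ), IsHomogenizationKernel αa βa a →
      IsBoundedEnergyProfile k s W a T S v →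
      ∫⁻ x in Ioo (-T) T, ENNReal.ofReal (weakDeriv k v x ^ 2) ≤ ENNReal.ofReal C ∧
      ∀ x, |v x| ≤ C := by
  obtain ⟨w₂, hw₂, hw₂W⟩ := hW.inf_pos
  set S' : ℝ := max S 0 + 1 with hS'
  have hS'0 : 0 < S' := by positivity
  set d : ℝ := (S' + 1) / w₂ with hd
  have hd0 : 0 < d := by positivity
  have hSd : S' < w₂ * d := by rw [hd]; field_simp; linarith
  set ℓ : ℝ := 3 ^ k * d with hℓ
  have hℓ0 : 0 < ℓ := by positivity
  obtain ⟨C₁, hC₁, hC₁b⟩ := exists_bound_of_energy_le hW hk hs (κ := αa⁻¹) (S := S')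
    (by positivity) hd0 (L := 2 * ℓ) (by positivity) hw₂ hw₂W hSd
  obtain ⟨D, hD, hDb⟩ := exists_chain_bound k (L := ℓ) hℓ0.le
  set Q : ℝ := 2 * (ℓ ^ (1 + 2 * s) / (2 * T₀) * (αa⁻¹ * S') + ℓ * (1 / T₀) ^ 2) with hQ
  have hQ0 : 0 < Q := by positivity
  refine ⟨C₁ * S' + C₁ + Q + √(D * (1 ^ 2 + Q)) + 1, by positivity, fun T hT a v ha hv => ?_⟩
  have hT0 : 0 < T := hT₀.trans_le hT
  obtain ⟨u, hu, hu0, huk, hae⟩ := hv.memHloc.exists_chain hv.continuous hk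
  have hpos1 : 0 ≤ √(D * (1 ^ 2 + Q)) := Real.sqrt_nonneg _
  have hpos2 : 0 < C₁ * S' := by positivity
  -- it is enough to bound the profile in the interior
  suffices hmain : ∫⁻ x in Ioo (-T) T, ENNReal.ofReal (u k x ^ 2) ≤
      ENNReal.ofReal (C₁ * S' + Q) ∧ ∀ x ∈ Icc (-T) T, |u 0 x| ≤ C₁ + √(D * (1 ^ 2 + Q)) by
    rw [huk, hu0] at hmain
    refine ⟨hmain.1.trans (ENNReal.ofReal_le_ofReal (by linarith)), fun x => ?_⟩
    rcases le_total T |x| with hx | hx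
    · rw [hv.abs_eq_one x hx]; linarith
    · have := hmain.2 x (abs_le.1 hx)
      linarith
  rcases lt_or_ge (2 * T) ℓ with hcase | hcase
  · -- a short interval
    have hgag : gagliardoSq s (Ioo (-T) T) (u k) ≤ ENNReal.ofReal (αa⁻¹ * S') := by
      rw [huk]
      refine (hv.gagliardoSq_le hα ha).trans (ENNReal.ofReal_le_ofReal ?_)
      gcongr
      linarith [le_max_left S 0]
    have hends := fun j (hj : j < k) => hv.abs_chain_le_one hT0 hu hu0 hae hj
    have hav : |(∫ t in (-T)..T, u k t) / (T - -T)| ≤ 1 / T₀ := by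
      obtain ⟨j, rfl⟩ : ∃ j, k = j + 1 := ⟨k - 1, by omega⟩
      rw [hu.integral_eq j (by omega), abs_div, abs_of_pos (by linarith : 0 < T - -T),
        div_le_div_iff₀ (by linarith) hT₀, one_mul]
      have := abs_sub (u j T) (u j (-T))
      have := hends j (by omega)
      nlinarith
    have h1 := lintegral_sq_le_of_average hs (d := 2 * T₀) (by positivity) (by linarith) le_rfl
      le_rfl (hu.intervalIntegrable le_rfl (-T) T) hav (by positivity) hgag
    have h2 : ∫⁻ x in Ioo (-T) T, ENNReal.ofReal (u k x ^ 2) ≤ ENNReal.ofReal Q := by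
      refine h1.trans (ENNReal.ofReal_le_ofReal ?_)
      rw [hQ]
      have : T - -T ≤ ℓ := by linarith
      have : 0 ≤ T - -T := by linarith
      gcongr
    refine ⟨h2.trans (ENNReal.ofReal_le_ofReal (by linarith)), fun x hx => ?_⟩
    obtain ⟨i1, -⟩ := hDb u hu (-T) T 1 Q (by linarith) (by linarith) hQ0.le h2
      (fun j hj => ⟨T, ⟨by linarith, le_rfl⟩, (hends j hj).1⟩)
    have := Real.le_sqrt_of_sq_le (x := |u 0 x|) (y := D * (1 ^ 2 + Q))
      (by rw [sq_abs]; exact i1 0 (by omega) x hx)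
    linarith
  · -- a long interval, cut into `n` pieces of equal length between `ℓ` and `2 * ℓ`
    set n : ℕ := ⌊2 * T / ℓ⌋₊ with hn
    have hn1 : 1 ≤ n := Nat.le_floor (by rw [Nat.cast_one, le_div_iff₀ hℓ0, one_mul]; exact hcase)
    have hn0 : (0 : ℝ) < n := by exact_mod_cast hn1
    have hnle : (n : ℝ) * ℓ ≤ 2 * T := by
      rw [← le_div_iff₀ hℓ0]; exact Nat.floor_le (by positivity)
    have hnlt : 2 * T < (n + 1) * ℓ := by
      rw [← div_lt_iff₀ hℓ0]; exact Nat.lt_floor_add_one _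
    set h : ℝ := 2 * T / n with hh
    have hh0 : 0 < h := by positivity
    have hh1 : ℓ ≤ h := by rw [hh, le_div_iff₀ hn0]; linarith
    have hh2 : h ≤ 2 * ℓ := by
      rw [hh, div_le_iff₀ hn0]
      have : (1 : ℝ) ≤ n := by exact_mod_cast hn1
      nlinarith
    set x : ℕ → ℝ := fun i => -T + i * h with hx
    have hxm : Monotone x := by
      intro i j hij
      simp only [hx]
      have : (i : ℝ) ≤ j := by exact_mod_cast hij
      gcongr
    have hx0 : x 0 = -T := by simp [hx]
    have hxn : x n = T := by simp only [hx, hh]; field_simp; ring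
    have hxs : ∀ i, x (i + 1) - x i = h := fun i => by simp only [hx]; push_cast; ring
    have hsum := sum_rescaledEnergy_le (k := k) (s := s) (W := W) (a := a) (v := v) hxm n
    rw [hx0, hxn] at hsum
    have hsum2 := hsum.trans hv.energy_le
    set E : ℕ → ℝ≥0∞ := fun i => rescaledEnergy k s W a v (Ioo (x i) (x (i + 1))) with hE
    have hElt : ∀ i ∈ Finset.range n, E i ≠ ∞ := fun i hi =>
      ((Finset.single_le_sum (f := E) (fun _ _ => zero_le) hi).trans hsum2).trans_lt
        ENNReal.ofReal_lt_top |>.ne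
    have hES : ∑ i ∈ Finset.range n, (E i).toReal ≤ max S 0 := by
      rw [← ENNReal.toReal_sum hElt]
      refine (ENNReal.toReal_mono ENNReal.ofReal_ne_top hsum2).trans ?_
      rw [ENNReal.toReal_ofReal']
    -- the summand `1 / n` keeps the energies positive
    set e : ℕ → ℝ := fun i => (E i).toReal + 1 / n with he
    have he0 : ∀ i, 0 < e i := fun i => by positivity
    have hesum : ∑ i ∈ Finset.range n, e i ≤ S' := by
      simp only [he]
      rw [Finset.sum_add_distrib, Finset.sum_const, Finset.card_range, nsmul_eq_mul, hS',
        mul_one_div_cancel hn0.ne']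
      linarith
    have heS : ∀ i ∈ Finset.range n, e i ≤ S' := fun i hi =>
      (Finset.single_le_sum (f := e) (fun i _ => (he0 i).le) hi).trans hesum
    have hpiece : ∀ i ∈ Finset.range n, (∀ y ∈ Icc (x i) (x (i + 1)), |u 0 y| ≤ C₁) ∧
        ∫⁻ y in Ioo (x i) (x (i + 1)), ENNReal.ofReal (u k y ^ 2) ≤
          ENNReal.ofReal (C₁ * e i) := by
      intro i hi
      have hEe : E i ≤ ENNReal.ofReal (e i) := by
        rw [← ENNReal.ofReal_toReal (hElt i hi)]
        apply ENNReal.ofReal_le_ofReal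
        simp only [he]
        have : 0 < 1 / (n : ℝ) := by positivity
        linarith
      refine hC₁b u hu (x i) (x (i + 1)) (e i) (by rw [hxs]; exact hh2) (by linarith [hxs i])
        (he0 i) (heS i hi) ?_ ?_
      · rw [hu0]; exact le_self_add.trans hEe
      · rw [huk, ENNReal.ofReal_mul (by positivity)]
        exact (ha.gagliardoSq_le hα s _ _).trans (mul_le_mul_right (le_add_self.trans hEe) _)
    constructor
    · have := lintegral_Ioo_eq_sum hxm (fun y => ENNReal.ofReal (u k y ^ 2)) n
      rw [hx0, hxn] at this
      rw [this]
      refine (Finset.sum_le_sum fun i hi => (hpiece i hi).2).trans ?_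
      rw [← ENNReal.ofReal_sum_of_nonneg fun i _ => mul_nonneg hC₁.le (he0 i).le]
      apply ENNReal.ofReal_le_ofReal
      rw [← Finset.mul_sum]
      have := mul_le_mul_of_nonneg_left hesum hC₁.le
      linarith
    · intro y hy
      obtain ⟨i, hi, hyi⟩ : ∃ i ∈ Finset.range n, y ∈ Icc (x i) (x (i + 1)) := by
        rcases eq_or_ne y T with rfl | hyT
        · refine ⟨n - 1, Finset.mem_range.2 (by omega), ?_⟩
          have : n - 1 + 1 = n := by omega
          rw [this, hxn]
          exact ⟨by rw [← hxn]; exact hxm (by omega), le_rfl⟩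
        · have hylt : y < T := lt_of_le_of_ne hy.2 hyT
          have hq0 : 0 ≤ (y + T) / h := div_nonneg (by linarith [hy.1]) hh0.le
          have h1 := Nat.floor_le hq0
          have h2 := Nat.lt_floor_add_one ((y + T) / h)
          rw [le_div_iff₀ hh0] at h1
          rw [div_lt_iff₀ hh0] at h2
          refine ⟨⌊(y + T) / h⌋₊, Finset.mem_range.2 ?_, ?_, ?_⟩
          · rw [Nat.floor_lt hq0, div_lt_iff₀ hh0, hh]
            field_simp
            linarith
          · simp only [hx]; linarith
          · simp only [hx]; push_cast; linarith
      have := (hpiece i hi).1 y hyi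
      linarith

/-! ### The case `k = 0`: Hölder bounds and sign regularizations -/

/-- For `k = 0` profiles are Hölder continuous on the whole line, uniformly. -/
lemma exists_holder_of_profile {s : ℝ} (hs : 1 / 2 < s) {αa βa : ℝ} (hα : 0 < αa) (S : ℝ) :
    ∃ H > 0, ∀ T > 0, ∀ (W : ℝ → ℝ) (a : ℝ → ℝ → ℝ) (v : ℝ → ℝ),
      IsHomogenizationKernel αa βa a → IsBoundedEnergyProfile 0 s W a T S v →
      ∀ x y, |v x - v y| ≤ H * |x - y| ^ (s - 1 / 2) := by
  obtain ⟨C, hC, hCb⟩ := exists_abs_sub_le_of_gagliardoSq_le hs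
  set E : ℝ := αa⁻¹ * (max S 0 + 1) with hE
  have hE0 : 0 < E := by positivity
  refine ⟨C * √E, by positivity, fun T hT W a v ha hv => ?_⟩
  have hae : weakDeriv 0 v =ᵐ[volume] v :=
    (weakDeriv_spec (hv.memHloc.exists_weakDeriv 0 le_rfl)).ae_eq_of_zero.symm
  have hgag : gagliardoSq s (Ioo (-T) T) v ≤ ENNReal.ofReal E := by
    rw [← gagliardoSq_congr s (ae_restrict_of_ae hae)]
    refine (hv.gagliardoSq_le hα ha).trans (ENNReal.ofReal_le_ofReal ?_)
    rw [hE]; gcongr; linarith [le_max_left S 0]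
  have hproj : ∀ x, v x = v (max (-T) (min T x)) := by
    intro x
    rcases le_total T x with h | h
    · rw [min_eq_left h, max_eq_right (by linarith)]; exact hv.eq_of_le hT h
    · rw [min_eq_right h]
      rcases le_total (-T) x with h' | h'
      · rw [max_eq_right h']
      · rw [max_eq_left h']; exact hv.eq_of_le_neg hT h'
  have key : ∀ x y, x ≤ y → |v x - v y| ≤ C * √E * (y - x) ^ (s - 1 / 2) := by
    intro x y hxy
    rw [hproj x, hproj y]
    set x' := max (-T) (min T x)
    set y' := max (-T) (min T y)
    have hxy' : x' ≤ y' := max_le_max le_rfl (min_le_min le_rfl hxy)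
    have hlen : y' - x' ≤ y - x := by
      have h1 := abs_max_sub_max_le_max (-T) (min T y) (-T) (min T x)
      have h2 := abs_min_sub_min_le_max T y T x
      simp only [sub_self, abs_zero] at h1 h2
      rw [max_eq_right (abs_nonneg (min T y - min T x))] at h1
      rw [max_eq_right (abs_nonneg (y - x))] at h2
      rw [abs_of_nonneg (by linarith : 0 ≤ y - x)] at h2
      linarith [le_abs_self (y' - x')]
    have hx1 : -T ≤ x' := le_max_left _ _
    have hy1 : y' ≤ T := max_le (by linarith) (min_le_left _ _)
    have := hCb v hv.continuous x' y' E hxy' hE0.le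
      ((gagliardoSq_mono s (Ioo_subset_Ioo hx1 hy1) v).trans hgag)
    refine this.trans ?_
    rw [mul_right_comm]
    gcongr
  intro x y
  rcases le_total x y with h | h
  · rw [abs_sub_comm x y, abs_of_nonneg (by linarith : 0 ≤ y - x)]; exact key x y h
  · rw [abs_sub_comm, abs_of_nonneg (by linarith : 0 ≤ x - y)]; exact key y x h

/-- For `k = 0` profiles are bounded, uniformly in the length of the interval. -/
lemma exists_abs_le_of_profile {s : ℝ} (hs : 1 / 2 < s) {W : ℝ → ℝ} (hW : IsDoubleWell W)
    {αa βa : ℝ} (hα : 0 < αa) (S : ℝ) :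
    ∃ M > 0, ∀ T > 0, ∀ (a : ℝ → ℝ → ℝ) (v : ℝ → ℝ),
      IsHomogenizationKernel αa βa a → IsBoundedEnergyProfile 0 s W a T S v → ∀ x, |v x| ≤ M := by
  obtain ⟨H, hH, hHb⟩ := exists_holder_of_profile hs (βa := βa) hα S
  obtain ⟨w, hw, hwW⟩ := hW.inf_pos
  set d : ℝ := (max S 0 + 1) / w with hd
  have hd0 : 0 < d := by positivity
  have hSd : S < w * d := by
    rw [hd]; field_simp; linarith [le_max_left S 0]
  refine ⟨2 + H * d ^ (s - 1 / 2), by positivity, fun T hT a v ha hv x => ?_⟩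
  have hpos : 0 < H * d ^ (s - 1 / 2) := by positivity
  rcases le_total T |x| with hx | hx
  · rw [hv.abs_eq_one x hx]; linarith
  obtain ⟨y, hy, hy2⟩ : ∃ y ∈ Icc x (x + d), |v y| ≤ 2 := by
    rcases le_total T (x + d) with h | h
    · refine ⟨T, ⟨(abs_le.1 hx).2, h⟩, ?_⟩
      rw [hv.abs_eq_one T (le_abs_self T)]; norm_num
    · obtain ⟨y, hy, hy'⟩ := exists_notMem_of_lintegral_le (P := {z | 2 ≤ |z|}) hw hd0 hwW hSd
        ((lintegral_mono_set (Ioo_subset_Ioo (abs_le.1 hx).1 h)).trans hv.lintegral_potential_le)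
      exact ⟨y, hy, (not_le.1 hy').le⟩
  have h1 := hHb T hT W a v ha hv x y
  have h2 : |x - y| ^ (s - 1 / 2) ≤ d ^ (s - 1 / 2) := by
    apply Real.rpow_le_rpow (abs_nonneg _) _ (by linarith)
    rw [abs_le]; constructor <;> linarith [hy.1, hy.2]
  have h3 := abs_sub_abs_le_abs_sub (v x) (v y)
  have h4 := mul_le_mul_of_nonneg_left h2 hH.le
  linarith

lemma transitionSet_subset {η : ℝ} {v : ℝ → ℝ} (hv : Continuous v) :
    transitionSet η v ⊆ {x | η / 2 ≤ |(|v x|) - 1|} := by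
  refine interior_subset.trans (closure_minimal (fun x hx => ?_) ?_)
  · have h : η / 2 < |(|v x|) - 1| := hx.1
    exact h.le
  · exact isClosed_le continuous_const (by fun_prop)

/-- Off the transition set the profile is closer than `η` to the wells. -/
lemma lt_of_notMem_transitionSet {η : ℝ} (hη : 0 < η) {v : ℝ → ℝ} (hv : Continuous v) {x : ℝ}
    (hx : x ∉ transitionSet η v) : |(|v x|) - 1| < η := by
  by_contra! hcon
  apply hx
  have hopen : IsOpen (farSet (η / 2) v) := isOpen_lt continuous_const (by fun_prop)
  have hxF : x ∈ farSet (η / 2) v := by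
    change η / 2 < |(|v x|) - 1|
    linarith
  rw [transitionSet, mem_interior]
  refine ⟨connectedComponentIn (farSet (η / 2) v) x, fun z hz => subset_closure
    ⟨connectedComponentIn_subset _ _ hz, x, ?_, hcon⟩, hopen.connectedComponentIn,
    mem_connectedComponentIn hxF⟩
  rw [← connectedComponentIn_eq hz]
  exact mem_connectedComponentIn hxF

lemma abs_sub_sign {z : ℝ} (hz : z ≠ 0) : |z - Real.sign z| = |(|z|) - 1| := by
  rcases hz.lt_or_gt with h | h
  · rw [Real.sign_of_neg h, abs_of_neg h, ← abs_neg]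
    congr 1; ring
  · rw [Real.sign_of_pos h, abs_of_pos h]

open Convolution in
lemma abs_convolution_le_integral {h f : ℝ → ℝ} (hh : Integrable h) (hf : ∀ x, |f x| ≤ 1) (x : ℝ) :
    |(h ⋆[ContinuousLinearMap.lsmul ℝ ℝ, volume] f) x| ≤ ∫ t, |h t| := by
  rw [convolution_def, ← Real.norm_eq_abs]
  refine norm_integral_le_of_norm_le hh.abs (Eventually.of_forall fun t => ?_)
  rw [ContinuousLinearMap.lsmul_apply, norm_smul, Real.norm_eq_abs, Real.norm_eq_abs]
  exact mul_le_of_le_one_right (abs_nonneg _) (hf _)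

open Convolution in
/-- Two sets at distance at least `d` are separated by a smooth function whose derivative is
bounded in terms of `d` alone: a mollified step function. -/
lemma exists_smooth_separation {d : ℝ} (hd : 0 < d) :
    ∃ L > 0, ∀ P N : Set ℝ, (∀ x ∈ P, ∀ y ∈ N, d ≤ |x - y|) →
      ∃ σ : ℝ → ℝ, ContDiff ℝ (⊤ : ℕ∞) σ ∧ (∀ x, |σ x| ≤ 1) ∧ (∀ x ∈ P, σ x = 1) ∧
        (∀ x ∈ N, σ x = -1) ∧ ∀ x, |deriv σ x| ≤ L := by
  classical
  let φ : ContDiffBump (0 : ℝ) := ⟨d / 8, d / 4, by positivity, by linarith⟩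
  set ρ : ℝ → ℝ := φ.normed volume with hρ
  have hρ1 : ContDiff ℝ (⊤ : ℕ∞) ρ := φ.contDiff_normed
  have hρ2 : HasCompactSupport ρ := φ.hasCompactSupport_normed
  have hρ3 : ∫ x, ρ x = 1 := φ.integral_normed
  have hρ4 : ∀ x, 0 ≤ ρ x := φ.nonneg_normed
  have hρ5 : Integrable ρ := hρ1.continuous.integrable_of_hasCompactSupport hρ2
  have hρ6 : Integrable (deriv ρ) :=
    (contDiff_infty_iff_deriv.1 hρ1).2.continuous.integrable_of_hasCompactSupport hρ2.deriv
  have hL0 : 0 ≤ ∫ t, |deriv ρ t| := integral_nonneg fun t => abs_nonneg _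
  refine ⟨(∫ t, |deriv ρ t|) + 1, by positivity, fun P N hPN => ?_⟩
  set f : ℝ → ℝ := fun x => if x ∈ Metric.thickening (d / 2) P then 1 else -1 with hf
  have hf1 : ∀ x, |f x| ≤ 1 := by
    intro x; simp only [hf]; split_ifs <;> simp
  have hfm : Measurable f := Measurable.ite Metric.isOpen_thickening.measurableSet
    measurable_const measurable_const
  have hfl : LocallyIntegrable f := by
    refine (locallyIntegrable_const (1 : ℝ)).mono hfm.aestronglyMeasurable
      (Eventually.of_forall fun x => ?_)
    simpa using hf1 x
  refine ⟨ρ ⋆[ContinuousLinearMap.lsmul ℝ ℝ, volume] f,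
    hρ2.contDiff_convolution_left _ hρ1 hfl, fun x => ?_, fun x hx => ?_, fun x hx => ?_,
    fun x => ?_⟩
  · refine (abs_convolution_le_integral hρ5 hf1 x).trans ?_
    simp_rw [abs_of_nonneg (hρ4 _)]
    exact hρ3.le
  · have hin : ∀ z ∈ Metric.ball x φ.rOut, f z = 1 := by
      intro z hz
      have hz' : dist z x < d / 4 := hz
      simp only [hf]
      rw [if_pos]
      exact Metric.mem_thickening_iff.2 ⟨x, hx, by linarith⟩
    have hxx := hin x (Metric.mem_ball_self φ.rOut_pos)
    rw [hρ, φ.normed_convolution_eq_right fun z hz => (hin z hz).trans hxx.symm, hxx]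
  · have hin : ∀ z ∈ Metric.ball x φ.rOut, f z = -1 := by
      intro z hz
      have hz' : dist z x < d / 4 := hz
      simp only [hf]
      rw [if_neg]
      intro hmem
      obtain ⟨y, hy, hyz⟩ := Metric.mem_thickening_iff.1 hmem
      have h1 := hPN y hy x hx
      rw [← Real.dist_eq] at h1
      have h2 := dist_triangle y z x
      rw [dist_comm y z] at h2
      linarith
    have hxx := hin x (Metric.mem_ball_self φ.rOut_pos)
    rw [hρ, φ.normed_convolution_eq_right fun z hz => (hin z hz).trans hxx.symm, hxx]
  · rw [(hρ2.hasDerivAt_convolution_left _ (hρ1.of_le (by exact_mod_cast le_top)) hfl x).deriv]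
    exact (abs_convolution_le_integral hρ6 hf1 x).trans (by linarith)

/-- A profile at points of different sign off the transition set differs by at least `2 (1 - η)`,
so that by Hölder continuity such points are a definite distance apart. -/
lemma exists_sign_regularization {s : ℝ} (hs : 1 / 2 < s) {αa βa : ℝ} (hα : 0 < αa) {η : ℝ}
    (hη : η ∈ Ioo (0 : ℝ) 1) (S : ℝ) :
    ∃ L > 0, ∀ T > 0, ∀ (W : ℝ → ℝ) (a : ℝ → ℝ → ℝ) (v : ℝ → ℝ),
      IsHomogenizationKernel αa βa a → IsBoundedEnergyProfile 0 s W a T S v →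
      ∃ σ : ℝ → ℝ, IsSignRegularization η v σ ∧ ∀ x, |deriv σ x| ≤ L := by
  obtain ⟨H, hH, hHb⟩ := exists_holder_of_profile hs (βa := βa) hα S
  have h1η : 0 < 1 - η := by linarith [hη.2]
  have hs2 : 0 < s - 1 / 2 := by linarith
  set d : ℝ := (2 * (1 - η) / H) ^ (s - 1 / 2)⁻¹ with hd
  have hd0 : 0 < d := by positivity
  obtain ⟨L, hL, hLb⟩ := exists_smooth_separation hd0
  refine ⟨L, hL, fun T hT W a v ha hv => ?_⟩
  have hfar : ∀ x ∉ transitionSet η v, 1 - η < |v x| := fun x hx => by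
    have := (abs_lt.1 (lt_of_notMem_transitionSet hη.1 hv.continuous hx)).1
    linarith
  obtain ⟨σ, h1, h2, h3, h4, h5⟩ := hLb {x | x ∉ transitionSet η v ∧ 0 < v x}
    {x | x ∉ transitionSet η v ∧ v x < 0} (by
      rintro x ⟨hx, hx0⟩ y ⟨hy, hy0⟩
      have hx1 := hfar x hx
      have hy1 := hfar y hy
      rw [abs_of_pos hx0] at hx1
      rw [abs_of_neg hy0] at hy1
      by_contra! hlt
      have hh := hHb T hT W a v ha hv x y
      have h6 : |x - y| ^ (s - 1 / 2) ≤ d ^ (s - 1 / 2) :=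
        Real.rpow_le_rpow (abs_nonneg _) hlt.le hs2.le
      rw [hd, Real.rpow_inv_rpow (by positivity) hs2.ne'] at h6
      have h7 := mul_le_mul_of_nonneg_left h6 hH.le
      rw [mul_div_cancel₀ _ hH.ne'] at h7
      linarith [le_abs_self (v x - v y)])
  refine ⟨σ, ⟨h1, fun x hx => ?_, h2⟩, h5⟩
  have hne : v x ≠ 0 := by
    have := hfar x hx
    intro h0
    rw [h0, abs_zero] at this
    linarith
  rcases hne.lt_or_gt with h | h
  · rw [h4 x ⟨hx, h⟩, Real.sign_of_neg h]
  · rw [h3 x ⟨hx, h⟩, Real.sign_of_pos h]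

/-- Off the interval `(-T, T)`, a profile agrees with its sign regularizations. -/
lemma IsBoundedEnergyProfile.eq_of_isSignRegularization {k : ℕ} {s : ℝ} {W : ℝ → ℝ}
    {a : ℝ → ℝ → ℝ} {T S : ℝ} {v : ℝ → ℝ} (hv : IsBoundedEnergyProfile k s W a T S v) {η : ℝ}
    (hη : 0 < η) {σ : ℝ → ℝ} (hσ : IsSignRegularization η v σ) {x : ℝ} (hx : T ≤ |x|) :
    v x = σ x := by
  have h1 := hv.abs_eq_one x hx
  have h2 : x ∉ transitionSet η v := fun hmem => by
    have : η / 2 ≤ |(|v x|) - 1| := transitionSet_subset hv.continuous hmem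
    rw [h1] at this
    norm_num at this
    linarith
  have h3 : v x ≠ 0 := fun h0 => by rw [h0, abs_zero] at h1; exact zero_ne_one h1
  have h4 := abs_sub_sign h3
  rw [h1, sub_self, abs_zero, abs_eq_zero, sub_eq_zero] at h4
  rw [hσ.eq_sign x h2, ← h4]

/-- The squared distance of a bounded profile to its sign regularizations is controlled by the
potential, pointwise. -/
lemma exists_sq_sub_sign_regularization_le {W : ℝ → ℝ} (hW : IsDoubleWell W) {η : ℝ}
    (hη : η ∈ Ioo (0 : ℝ) 1) {M : ℝ} (hM : 0 ≤ M) :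
    ∃ C > 0, ∀ v σ : ℝ → ℝ, Continuous v → (∀ x, |v x| ≤ M) → IsSignRegularization η v σ →
      ∀ x, (v x - σ x) ^ 2 ≤ C * W (v x) := by
  obtain ⟨C, hC, hCb⟩ := hW.exists_sq_le M
  obtain ⟨w, hw, hwW⟩ := hW.exists_le_of_far (δ := η / 2) (by linarith [hη.1])
  refine ⟨C + (M + 1) ^ 2 / w, by positivity, fun v σ hv hvM hσ x => ?_⟩
  have hWx := hW.nonneg (v x)
  rw [add_mul]
  by_cases hx : x ∈ transitionSet η v
  · have h1 := hwW _ (transitionSet_subset hv hx)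
    have h2 : |v x - σ x| ≤ M + 1 := by
      have := abs_sub (v x) (σ x)
      linarith [hvM x, hσ.abs_le_one x]
    have h3 : (v x - σ x) ^ 2 ≤ (M + 1) ^ 2 := by
      rw [← sq_abs]; gcongr
    have h4 : (M + 1) ^ 2 ≤ (M + 1) ^ 2 / w * W (v x) := by
      rw [div_mul_eq_mul_div, le_div_iff₀ hw]; gcongr
    have : 0 ≤ C * W (v x) := by positivity
    linarith
  · have h1 := lt_of_notMem_transitionSet hη.1 hv hx
    have h2 : v x ≠ 0 := fun h0 => by
      rw [h0] at h1; norm_num at h1; linarith [hη.2]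
    have h3 : (v x - σ x) ^ 2 = (|v x| - 1) ^ 2 := by
      rw [hσ.eq_sign x hx, ← sq_abs, abs_sub_sign h2, sq_abs]
    have h4 : 0 ≤ (M + 1) ^ 2 / w * W (v x) := by positivity
    linarith [hCb (v x) (hvM x)]

/-! ### A fractional Hardy inequality for `s ≠ 1/2` -/

/-- The region `{x/4 < y < x/2, 0 < x < L}` on which values at `x` and `y` are compared. -/
def comparisonRegion (L : ℝ) : Set (ℝ × ℝ) :=
  {z | 0 < z.1 ∧ z.1 < L ∧ z.1 / 4 < z.2 ∧ z.2 < z.1 / 2}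

lemma measurableSet_comparisonRegion (L : ℝ) : MeasurableSet (comparisonRegion L) := by
  refine IsOpen.measurableSet ?_
  refine (isOpen_lt continuous_const continuous_fst).inter
    ((isOpen_lt continuous_fst continuous_const).inter ((isOpen_lt (by fun_prop) continuous_snd).inter
      (isOpen_lt continuous_snd (by fun_prop))))

lemma lintegral_comparisonRegion (L : ℝ) {F : ℝ × ℝ → ℝ≥0∞} (hF : Measurable F) :
    ∫⁻ z in comparisonRegion L, F z =
      ∫⁻ x in Ioo 0 L, ∫⁻ y in Ioo (x / 4) (x / 2), F (x, y) := by
  have hR := measurableSet_comparisonRegion L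
  rw [← lintegral_indicator hR, Measure.volume_eq_prod,
    lintegral_prod _ (hF.indicator hR).aemeasurable, ← lintegral_indicator measurableSet_Ioo]
  refine lintegral_congr fun x => ?_
  by_cases hx : x ∈ Ioo 0 L
  · rw [indicator_of_mem hx, ← lintegral_indicator measurableSet_Ioo]
    refine lintegral_congr fun y => ?_
    by_cases hy : y ∈ Ioo (x / 4) (x / 2)
    · rw [indicator_of_mem hy, indicator_of_mem]
      exact ⟨hx.1, hx.2, hy.1, hy.2⟩
    · rw [indicator_of_notMem hy, indicator_of_notMem]
      exact fun h => hy ⟨h.2.2.1, h.2.2.2⟩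
  · rw [indicator_of_notMem hx]
    refine (lintegral_congr fun y => ?_).trans lintegral_zero
    rw [indicator_of_notMem]
    exact fun h => hx ⟨h.1, h.2.1⟩

lemma lintegral_comparisonRegion_symm (L : ℝ) {F : ℝ × ℝ → ℝ≥0∞} (hF : Measurable F) :
    ∫⁻ z in comparisonRegion L, F z =
      ∫⁻ y in Ioo 0 L, ∫⁻ x in Ioo (2 * y) (min (4 * y) L), F (x, y) := by
  have hR := measurableSet_comparisonRegion L
  rw [← lintegral_indicator hR, Measure.volume_eq_prod,
    lintegral_prod_symm _ (hF.indicator hR).aemeasurable, ← lintegral_indicator measurableSet_Ioo]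
  refine lintegral_congr fun y => ?_
  by_cases hy : y ∈ Ioo 0 L
  · rw [indicator_of_mem hy, ← lintegral_indicator measurableSet_Ioo]
    refine lintegral_congr fun x => ?_
    by_cases hx : x ∈ Ioo (2 * y) (min (4 * y) L)
    · rw [indicator_of_mem hx, indicator_of_mem]
      have h1 := hx.1
      have h2 := lt_min_iff.1 hx.2
      exact ⟨by linarith [hy.1], h2.2, by simp only; linarith [h2.1], by simp only; linarith⟩
    · rw [indicator_of_notMem hx, indicator_of_notMem]
      rintro ⟨h1, h2, h3, h4⟩
      simp only at h1 h2 h3 h4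
      exact hx ⟨by linarith, lt_min (by linarith) h2⟩
  · rw [indicator_of_notMem hy]
    refine (lintegral_congr fun x => ?_).trans lintegral_zero
    rw [indicator_of_notMem]
    rintro ⟨h1, h2, h3, h4⟩
    simp only at h1 h2 h3 h4
    exact hy ⟨by linarith, by linarith⟩

lemma lintegral_inv_sq {y : ℝ} (hy : 0 < y) :
    ∫⁻ x in Ioo (2 * y) (4 * y), ENNReal.ofReal (x ^ 2)⁻¹ = ENNReal.ofReal (1 / (4 * y)) := by
  have hpos : ∀ x ∈ uIcc (2 * y) (4 * y), x ≠ 0 := fun x hx => by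
    rw [uIcc_of_le (by linarith)] at hx
    linarith [hx.1]
  have hcont : ContinuousOn (fun x : ℝ => (x ^ 2)⁻¹) (uIcc (2 * y) (4 * y)) :=
    (continuousOn_pow 2).inv₀ fun x hx => pow_ne_zero 2 (hpos x hx)
  have hint := hcont.intervalIntegrable (μ := volume)
  have h1 := intervalIntegral.integral_eq_sub_of_hasDerivAt (f := fun x : ℝ => -x⁻¹)
    (f' := fun x => (x ^ 2)⁻¹) (a := 2 * y) (b := 4 * y)
    (fun x hx => by
      have := (hasDerivAt_inv (hpos x hx)).neg
      rwa [neg_neg] at this) hint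
  rw [← ofReal_integral_eq_lintegral_ofReal
    ((intervalIntegrable_iff_integrableOn_Ioo_of_le (by linarith)).1 hint)
    (Eventually.of_forall fun x => by positivity), ← integral_Ioc_eq_integral_Ioo,
    ← intervalIntegral.integral_of_le (by linarith), h1]
  congr 1
  field_simp
  norm_num

/-- The weight `x⁻² y^{1-2s}` is comparable to the Gagliardo kernel on the comparison region, and
its integrals in `x` and in `y` are multiples of `y^{-2s}` and, up to a factor different from one,
`x^{-2s}`; this factor gives the inequality. -/
noncomputable def hardyWeight (s : ℝ) (z : ℝ × ℝ) : ℝ := (z.1 ^ 2)⁻¹ * z.2 ^ (1 - 2 * s)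

lemma hardyWeight_nonneg (s : ℝ) {L : ℝ} {z : ℝ × ℝ} (hz : z ∈ comparisonRegion L) :
    0 ≤ hardyWeight s z := by
  have h1 : 0 < z.2 := by linarith [hz.1, hz.2.2.1]
  rw [hardyWeight]; positivity

lemma measurable_hardyWeight (s : ℝ) : Measurable (hardyWeight s) := by
  unfold hardyWeight; fun_prop

lemma hardyWeight_le {s : ℝ} (hs0 : 0 < s) (hs1 : s < 1) {L : ℝ} {z : ℝ × ℝ}
    (hz : z ∈ comparisonRegion L) : hardyWeight s z ≤ 4 * (|z.1 - z.2| ^ (1 + 2 * s))⁻¹ := by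
  obtain ⟨x, y⟩ := z
  obtain ⟨hx, -, hy1, hy2⟩ := hz
  simp only at hx hy1 hy2
  have hy : 0 < y := by linarith
  have h1 : y ^ (1 - 2 * s) ≤ 4 * x ^ (1 - 2 * s) := by
    rcases le_total (2 * s) 1 with h | h
    · have : y ^ (1 - 2 * s) ≤ x ^ (1 - 2 * s) :=
        Real.rpow_le_rpow hy.le (by linarith) (by linarith)
      have h0 : 0 ≤ x ^ (1 - 2 * s) := by positivity
      linarith
    · have h2 : y ^ (1 - 2 * s) ≤ (x / 4) ^ (1 - 2 * s) :=
        Real.rpow_le_rpow_of_nonpos (by positivity) hy1.le (by linarith)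
      have h3 : (x / 4) ^ (1 - 2 * s) = 4 ^ (2 * s - 1) * x ^ (1 - 2 * s) := by
        rw [div_eq_mul_inv, Real.mul_rpow hx.le (by norm_num), Real.inv_rpow (by norm_num),
          ← Real.rpow_neg (by norm_num)]
        ring_nf
      have h4 : (4 : ℝ) ^ (2 * s - 1) ≤ 4 ^ (1 : ℝ) :=
        Real.rpow_le_rpow_of_exponent_le (by norm_num) (by linarith)
      rw [Real.rpow_one] at h4
      rw [h3] at h2
      exact h2.trans (by gcongr)
  have h2 : (x ^ 2)⁻¹ * x ^ (1 - 2 * s) = (x ^ (1 + 2 * s))⁻¹ := by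
    rw [← Real.rpow_natCast x 2, ← Real.rpow_neg hx.le, ← Real.rpow_neg hx.le,
      ← Real.rpow_add hx]
    congr 1; push_cast; ring
  have h3 : |x - y| ≤ x := by rw [abs_le]; constructor <;> linarith
  have h4 : 0 < |x - y| := abs_pos.2 (by linarith)
  calc (x ^ 2)⁻¹ * y ^ (1 - 2 * s) ≤ (x ^ 2)⁻¹ * (4 * x ^ (1 - 2 * s)) := by gcongr
    _ = 4 * (x ^ (1 + 2 * s))⁻¹ := by rw [← h2]; ring
    _ ≤ 4 * (|x - y| ^ (1 + 2 * s))⁻¹ := by gcongr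

section Hardy

variable {s L : ℝ} {h : ℝ → ℝ}

lemma lintegral_hardyWeight_right_le (hh : Measurable h) :
    ∫⁻ z in comparisonRegion L, ENNReal.ofReal (h z.2 ^ 2 * hardyWeight s z) ≤
      ENNReal.ofReal (1 / 4) * ∫⁻ x in Ioo 0 L, ENNReal.ofReal (h x ^ 2 * x ^ (-(2 * s))) := by
  have hw := measurable_hardyWeight s
  rw [lintegral_comparisonRegion_symm L (by fun_prop),
    ← lintegral_const_mul' _ _ ENNReal.ofReal_ne_top]
  refine setLIntegral_mono' measurableSet_Ioo fun y hy => ?_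
  have hy0 := hy.1
  refine (lintegral_mono_set (Ioo_subset_Ioo_right (min_le_left _ _))).trans (le_of_eq ?_)
  have e : ∀ x : ℝ, ENNReal.ofReal (h y ^ 2 * hardyWeight s (x, y)) =
      ENNReal.ofReal (h y ^ 2 * y ^ (1 - 2 * s)) * ENNReal.ofReal (x ^ 2)⁻¹ := fun x => by
    rw [← ENNReal.ofReal_mul (by positivity), hardyWeight]
    congr 1; ring
  simp_rw [e]
  rw [lintegral_const_mul' _ _ ENNReal.ofReal_ne_top, lintegral_inv_sq hy0,
    ← ENNReal.ofReal_mul (by positivity), ← ENNReal.ofReal_mul (by positivity)]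
  congr 1
  have : y ^ (1 - 2 * s) = y * y ^ (-(2 * s)) := by
    rw [sub_eq_add_neg, Real.rpow_add hy0, Real.rpow_one]
  rw [this]
  field_simp

lemma le_lintegral_hardyWeight_right (hh : Measurable h) :
    ENNReal.ofReal (1 / 4) * ∫⁻ x in Ioo 0 (L / 4), ENNReal.ofReal (h x ^ 2 * x ^ (-(2 * s))) ≤
      ∫⁻ z in comparisonRegion L, ENNReal.ofReal (h z.2 ^ 2 * hardyWeight s z) := by
  have hw := measurable_hardyWeight s
  rw [lintegral_comparisonRegion_symm L (by fun_prop),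
    ← lintegral_const_mul' _ _ ENNReal.ofReal_ne_top]
  rcases le_or_gt L 0 with hL | hL
  · rw [Ioo_eq_empty (by linarith)]; simp
  refine le_trans ?_ (lintegral_mono_set (Ioo_subset_Ioo_right (by linarith : L / 4 ≤ L)))
  refine setLIntegral_mono' measurableSet_Ioo fun y hy => ?_
  have hy0 := hy.1
  rw [min_eq_left (by linarith [hy.2])]
  refine le_of_eq ?_
  have e : ∀ x : ℝ, ENNReal.ofReal (h y ^ 2 * hardyWeight s (x, y)) =
      ENNReal.ofReal (h y ^ 2 * y ^ (1 - 2 * s)) * ENNReal.ofReal (x ^ 2)⁻¹ := fun x => by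
    rw [← ENNReal.ofReal_mul (by positivity), hardyWeight]
    congr 1; ring
  simp_rw [e]
  rw [lintegral_const_mul' _ _ ENNReal.ofReal_ne_top, lintegral_inv_sq hy0,
    ← ENNReal.ofReal_mul (by positivity), ← ENNReal.ofReal_mul (by positivity)]
  congr 1
  have : y ^ (1 - 2 * s) = y * y ^ (-(2 * s)) := by
    rw [sub_eq_add_neg, Real.rpow_add hy0, Real.rpow_one]
  rw [this]
  field_simp

lemma hardy_half_rpow {x : ℝ} (hx : 0 < x) :
    (x ^ 2)⁻¹ * (x / 2) ^ (1 - 2 * s) * (x / 4) = 2 ^ (2 * s - 1) / 4 * x ^ (-(2 * s)) := by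
  rw [div_eq_mul_inv x 2, Real.mul_rpow hx.le (by norm_num), Real.inv_rpow (by norm_num),
    ← Real.rpow_neg (by norm_num), sub_eq_add_neg 1 (2 * s), Real.rpow_add hx, Real.rpow_one]
  have : -(1 + -(2 * s)) = 2 * s - 1 := by ring
  rw [this]
  field_simp

lemma lintegral_hardyWeight_left_le (hs : 2 * s ≤ 1) (hh : Measurable h) :
    ∫⁻ z in comparisonRegion L, ENNReal.ofReal (h z.1 ^ 2 * hardyWeight s z) ≤
      ENNReal.ofReal (2 ^ (2 * s - 1) / 4) *
        ∫⁻ x in Ioo 0 L, ENNReal.ofReal (h x ^ 2 * x ^ (-(2 * s))) := by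
  have hw := measurable_hardyWeight s
  rw [lintegral_comparisonRegion L (by fun_prop), ← lintegral_const_mul' _ _ ENNReal.ofReal_ne_top]
  refine setLIntegral_mono' measurableSet_Ioo fun x hx => ?_
  have hx0 := hx.1
  have h1 : ∫⁻ y in Ioo (x / 4) (x / 2), ENNReal.ofReal (h x ^ 2 * hardyWeight s (x, y)) ≤
      ∫⁻ _ in Ioo (x / 4) (x / 2),
        ENNReal.ofReal (h x ^ 2 * ((x ^ 2)⁻¹ * (x / 2) ^ (1 - 2 * s))) := by
    refine setLIntegral_mono' measurableSet_Ioo fun y hy => ENNReal.ofReal_le_ofReal ?_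
    simp only [hardyWeight]
    have : 0 < y := by linarith [hy.1]
    have := Real.rpow_le_rpow this.le hy.2.le (by linarith : 0 ≤ 1 - 2 * s)
    gcongr
  refine h1.trans (le_of_eq ?_)
  rw [setLIntegral_const, Real.volume_Ioo, ← ENNReal.ofReal_mul (by positivity),
    ← ENNReal.ofReal_mul (by positivity)]
  congr 1
  rw [show x / 2 - x / 4 = x / 4 by ring, mul_assoc, hardy_half_rpow hx0]
  ring

lemma le_lintegral_hardyWeight_left (hs : 1 ≤ 2 * s) (hh : Measurable h) :
    ENNReal.ofReal (2 ^ (2 * s - 1) / 4) *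
        ∫⁻ x in Ioo 0 L, ENNReal.ofReal (h x ^ 2 * x ^ (-(2 * s))) ≤
      ∫⁻ z in comparisonRegion L, ENNReal.ofReal (h z.1 ^ 2 * hardyWeight s z) := by
  have hw := measurable_hardyWeight s
  rw [lintegral_comparisonRegion L (by fun_prop), ← lintegral_const_mul' _ _ ENNReal.ofReal_ne_top]
  refine setLIntegral_mono' measurableSet_Ioo fun x hx => ?_
  have hx0 := hx.1
  have h1 : ∫⁻ _ in Ioo (x / 4) (x / 2),
        ENNReal.ofReal (h x ^ 2 * ((x ^ 2)⁻¹ * (x / 2) ^ (1 - 2 * s))) ≤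
      ∫⁻ y in Ioo (x / 4) (x / 2), ENNReal.ofReal (h x ^ 2 * hardyWeight s (x, y)) := by
    refine setLIntegral_mono' measurableSet_Ioo fun y hy => ENNReal.ofReal_le_ofReal ?_
    simp only [hardyWeight]
    have : 0 < y := by linarith [hy.1]
    have := Real.rpow_le_rpow_of_nonpos this hy.2.le (by linarith : 1 - 2 * s ≤ 0)
    gcongr
  refine le_trans (le_of_eq ?_) h1
  rw [setLIntegral_const, Real.volume_Ioo, ← ENNReal.ofReal_mul (by positivity),
    ← ENNReal.ofReal_mul (by positivity)]
  congr 1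
  rw [show x / 2 - x / 4 = x / 4 by ring, mul_assoc, hardy_half_rpow hx0]
  ring

lemma lintegral_hardyWeight_diff_le (hs0 : 0 < s) (hs1 : s < 1) (hh : Measurable h) :
    ∫⁻ z in comparisonRegion L, ENNReal.ofReal ((h z.1 - h z.2) ^ 2 * hardyWeight s z) ≤
      4 * gagliardoSq s (Ioo 0 L) h := by
  have h4 : (4 : ℝ≥0∞) = ENNReal.ofReal 4 := by simp
  have h1 : ∫⁻ z in comparisonRegion L, ENNReal.ofReal ((h z.1 - h z.2) ^ 2 * hardyWeight s z) ≤
      ∫⁻ z in comparisonRegion L,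
        4 * ENNReal.ofReal ((h z.1 - h z.2) ^ 2 / |z.1 - z.2| ^ (1 + 2 * s)) := by
    refine setLIntegral_mono' (measurableSet_comparisonRegion L) fun z hz => ?_
    rw [h4, ← ENNReal.ofReal_mul (by norm_num)]
    apply ENNReal.ofReal_le_ofReal
    have := mul_le_mul_of_nonneg_left (hardyWeight_le hs0 hs1 hz) (sq_nonneg (h z.1 - h z.2))
    refine this.trans (le_of_eq ?_)
    ring
  refine h1.trans ?_
  rw [lintegral_const_mul' _ _ (by simp), lintegral_comparisonRegion L (by fun_prop), gagliardoSq]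
  refine mul_le_mul_right ?_ _
  refine setLIntegral_mono' measurableSet_Ioo fun x hx => lintegral_mono_set ?_
  exact Ioo_subset_Ioo (by linarith [hx.1]) (by linarith [hx.1, hx.2])

lemma lintegral_comparison {δ : ℝ} (hδ : 0 < δ) {p q : ℝ × ℝ → ℝ} (hq : Measurable q) :
    ∫⁻ z in comparisonRegion L, ENNReal.ofReal (p z ^ 2 * hardyWeight s z) ≤
      ENNReal.ofReal (1 + δ) *
          (∫⁻ z in comparisonRegion L, ENNReal.ofReal (q z ^ 2 * hardyWeight s z)) +
        ENNReal.ofReal (1 + 1 / δ) *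
          ∫⁻ z in comparisonRegion L, ENNReal.ofReal ((p z - q z) ^ 2 * hardyWeight s z) := by
  have hw := measurable_hardyWeight s
  rw [← lintegral_const_mul' _ _ ENNReal.ofReal_ne_top,
    ← lintegral_const_mul' _ _ ENNReal.ofReal_ne_top, ← lintegral_add_left (by fun_prop)]
  refine setLIntegral_mono' (measurableSet_comparisonRegion L) fun z hz => ?_
  have h0 := hardyWeight_nonneg s hz
  rw [← ENNReal.ofReal_mul (by positivity), ← ENNReal.ofReal_mul (by positivity),
    ← ENNReal.ofReal_add (by positivity) (by positivity)]
  apply ENNReal.ofReal_le_ofReal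
  have key : p z ^ 2 ≤ (1 + δ) * q z ^ 2 + (1 + 1 / δ) * (p z - q z) ^ 2 := by
    have e : (1 + δ) * q z ^ 2 + (1 + 1 / δ) * (p z - q z) ^ 2 - p z ^ 2 =
        (δ * q z - (p z - q z)) ^ 2 / δ := by field_simp; ring
    have : 0 ≤ (δ * q z - (p z - q z)) ^ 2 / δ := by positivity
    linarith
  have := mul_le_mul_of_nonneg_right key h0
  linarith

/-- The fractional Hardy inequality on `(0, L)` for `s ≠ 1/2`, for functions for which the left side
is finite. -/
lemma exists_hardy (hs0 : 0 < s) (hs1 : s < 1) (hs : s ≠ 1 / 2) (hL : 0 < L) :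
    ∃ C > 0, ∀ h : ℝ → ℝ, Measurable h → ∀ E Q : ℝ, 0 ≤ E → 0 ≤ Q →
      ∫⁻ x in Ioo 0 L, ENNReal.ofReal (h x ^ 2 * x ^ (-(2 * s))) ≠ ∞ →
      gagliardoSq s (Ioo 0 L) h ≤ ENNReal.ofReal E →
      ∫⁻ x in Ioo 0 L, ENNReal.ofReal (h x ^ 2) ≤ ENNReal.ofReal Q →
      ∫⁻ x in Ioo 0 L, ENNReal.ofReal (h x ^ 2 * x ^ (-(2 * s))) ≤
        ENNReal.ofReal (C * (E + Q)) := by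
  have h4 : (4 : ℝ≥0∞) = ENNReal.ofReal 4 := by simp
  rcases hs.lt_or_gt with hs | hs
  · set θ : ℝ := 2 ^ (2 * s - 1) with hθ
    have hθ0 : 0 < θ := by positivity
    have hθ1 : θ < 1 := Real.rpow_lt_one_of_one_lt_of_neg (by norm_num) (by linarith)
    -- `δ` is chosen so that `(1 + δ) * θ` is the midpoint of `θ` and `1`
    set δ : ℝ := (1 - θ) / (2 * θ) with hδ
    have hδ0 : 0 < δ := div_pos (by linarith) (by positivity)
    have hδθ : (1 + δ) * θ = (1 + θ) / 2 := by rw [hδ]; field_simp; ring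
    set B : ℝ := (L / 4) ^ (-(2 * s)) with hB
    have hB0 : 0 < B := by positivity
    refine ⟨(8 / (1 - θ)) * (4 * (1 + 1 / δ) + B), by
      have : 0 < 1 - θ := by linarith
      positivity, fun h hh E Q hE hQ hfin hgag hL2 => ?_⟩
    set X := ∫⁻ x in Ioo 0 L, ENNReal.ofReal (h x ^ 2 * x ^ (-(2 * s))) with hX
    set Y := ∫⁻ x in Ioo 0 (L / 4), ENNReal.ofReal (h x ^ 2 * x ^ (-(2 * s))) with hY
    have hYX : Y ≤ X := lintegral_mono_set (Ioo_subset_Ioo_right (by linarith))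
    have hYfin : Y ≠ ∞ := ne_top_of_le_ne_top hfin hYX
    have hXY : X ≤ Y + ENNReal.ofReal (B * Q) := by
      have hsub : Ioo (0 : ℝ) L ⊆ Ioo 0 (L / 4) ∪ Ico (L / 4) L := fun x hx => by
        rcases lt_or_ge x (L / 4) with h | h
        · exact Or.inl ⟨hx.1, h⟩
        · exact Or.inr ⟨h, hx.2⟩
      refine (lintegral_mono_set hsub).trans ((lintegral_union_le _ _ _).trans ?_)
      refine add_le_add le_rfl ?_
      have : ∫⁻ x in Ico (L / 4) L, ENNReal.ofReal (h x ^ 2 * x ^ (-(2 * s))) ≤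
          ∫⁻ x in Ico (L / 4) L, ENNReal.ofReal B * ENNReal.ofReal (h x ^ 2) := by
        refine setLIntegral_mono' measurableSet_Ico fun x hx => ?_
        rw [← ENNReal.ofReal_mul hB0.le, mul_comm]
        apply ENNReal.ofReal_le_ofReal
        have := Real.rpow_le_rpow_of_nonpos (by positivity) hx.1
          (by linarith : -(2 * s) ≤ 0)
        gcongr
      refine this.trans ?_
      rw [lintegral_const_mul' _ _ ENNReal.ofReal_ne_top, ENNReal.ofReal_mul hB0.le]
      gcongr
      refine (lintegral_mono_set fun x hx => ?_).trans hL2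
      exact ⟨by linarith [hx.1], hx.2⟩
    have h1 := (le_lintegral_hardyWeight_right (s := s) (L := L) hh).trans
      (lintegral_comparison (s := s) (L := L) hδ0 (p := fun z => h z.2) (q := fun z => h z.1)
        (by fun_prop))
    have h2 := lintegral_hardyWeight_left_le (s := s) (L := L) (by linarith) hh
    have h3 : ∫⁻ z in comparisonRegion L, ENNReal.ofReal ((h z.2 - h z.1) ^ 2 * hardyWeight s z) ≤
        4 * gagliardoSq s (Ioo 0 L) h := by
      refine le_trans (le_of_eq (lintegral_congr fun z => ?_))
        (lintegral_hardyWeight_diff_le hs0 hs1 hh)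
      rw [← neg_sub, neg_sq]
    have h5 := h1.trans (add_le_add (mul_le_mul_right h2 _)
      (mul_le_mul_right (h3.trans (mul_le_mul_right hgag _)) _))
    rw [← hX, ← hY] at h5
    have h6 := h5.trans (add_le_add (mul_le_mul_right (mul_le_mul_right hXY _) _) le_rfl)
    obtain ⟨y, hy0, hyY⟩ : ∃ y : ℝ, 0 ≤ y ∧ Y = ENNReal.ofReal y :=
      ⟨Y.toReal, ENNReal.toReal_nonneg, (ENNReal.ofReal_toReal hYfin).symm⟩
    rw [hyY, h4, ← ENNReal.ofReal_add hy0 (by positivity), ← ENNReal.ofReal_mul (by positivity),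
      ← ENNReal.ofReal_mul (by positivity), ← ENNReal.ofReal_mul (by positivity),
      ← ENNReal.ofReal_mul (by positivity), ← ENNReal.ofReal_mul (by positivity),
      ← ENNReal.ofReal_add (by positivity) (by positivity),
      ENNReal.ofReal_le_ofReal_iff (by positivity)] at h6
    refine hXY.trans ?_
    rw [hyY, ← ENNReal.ofReal_add hy0 (by positivity)]
    apply ENNReal.ofReal_le_ofReal
    have e1 : (1 + δ) * (2 ^ (2 * s - 1) / 4 * (y + B * Q)) = (1 + θ) / 8 * (y + B * Q) := by
      rw [← hθ]
      calc _ = ((1 + δ) * θ) / 4 * (y + B * Q) := by ring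
        _ = _ := by rw [hδθ]; ring
    rw [e1] at h6
    rw [mul_assoc, div_mul_eq_mul_div, le_div_iff₀ (by linarith)]
    have p1 : 0 ≤ B * Q := by positivity
    have p2 : 0 ≤ B * E := by positivity
    have p3 : 0 ≤ (1 + 1 / δ) * Q := by positivity
    nlinarith
  · set θ : ℝ := 2 ^ (2 * s - 1) with hθ
    have hθ1 : 1 < θ := Real.one_lt_rpow (by norm_num) (by linarith)
    -- `δ` is chosen so that `1 + δ` is the midpoint of `1` and `θ`
    set δ : ℝ := (θ - 1) / 2 with hδ
    have hδ0 : 0 < δ := by rw [hδ]; linarith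
    refine ⟨(8 / (θ - 1)) * (4 * (1 + 1 / δ)), by
      have : 0 < θ - 1 := by linarith
      positivity, fun h hh E Q hE hQ hfin hgag hL2 => ?_⟩
    set X := ∫⁻ x in Ioo 0 L, ENNReal.ofReal (h x ^ 2 * x ^ (-(2 * s))) with hX
    have h1 := (le_lintegral_hardyWeight_left (s := s) (L := L) (by linarith) hh).trans
      (lintegral_comparison (s := s) (L := L) hδ0 (p := fun z => h z.1) (q := fun z => h z.2)
        (by fun_prop))
    have h2 := lintegral_hardyWeight_right_le (s := s) (L := L) hh
    have h3 := lintegral_hardyWeight_diff_le (L := L) hs0 hs1 hh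
    have h5 := h1.trans (add_le_add (mul_le_mul_right h2 _)
      (mul_le_mul_right (h3.trans (mul_le_mul_right hgag _)) _))
    rw [← hX] at h5
    obtain ⟨x, hx0, hxX⟩ : ∃ x : ℝ, 0 ≤ x ∧ X = ENNReal.ofReal x :=
      ⟨X.toReal, ENNReal.toReal_nonneg, (ENNReal.ofReal_toReal hfin).symm⟩
    rw [hxX, h4, ← ENNReal.ofReal_mul (by positivity), ← ENNReal.ofReal_mul (by positivity),
      ← ENNReal.ofReal_mul (by positivity), ← ENNReal.ofReal_mul (by positivity),
      ← ENNReal.ofReal_mul (by positivity),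
      ← ENNReal.ofReal_add (by positivity) (by positivity),
      ENNReal.ofReal_le_ofReal_iff (by positivity)] at h5
    rw [hxX]
    apply ENNReal.ofReal_le_ofReal
    rw [← hθ] at h5
    have e1 : (1 + δ) * (1 / 4 * x) = (1 + θ) / 8 * x := by rw [hδ]; ring
    rw [e1] at h5
    rw [mul_assoc, div_mul_eq_mul_div, le_div_iff₀ (by linarith)]
    have p3 : 0 ≤ (1 + 1 / δ) * Q := by positivity
    nlinarith

end Hardy

/-! ### Crossing the endpoints for `s ≠ 1/2` -/

lemma gagliardoSq_eq_lintegral_prod {g : ℝ → ℝ} (hg : Measurable g) (s : ℝ) (I : Set ℝ) :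
    gagliardoSq s I g =
      ∫⁻ z in I ×ˢ I, ENNReal.ofReal ((g z.1 - g z.2) ^ 2 / |z.1 - z.2| ^ (1 + 2 * s)) := by
  rw [Measure.volume_eq_prod, ← Measure.prod_restrict, lintegral_prod _ (by fun_prop), gagliardoSq]

lemma lintegral_kernel_le {s : ℝ} (hs : 0 < s) {L x : ℝ} (hL : 0 < L) (hx : 0 < x) :
    ∫⁻ y in Ioc (-L) 0, ENNReal.ofReal (|x - y| ^ (1 + 2 * s))⁻¹ ≤
      ENNReal.ofReal (1 / (2 * s) * x ^ (-(2 * s))) := by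
  have hpos : ∀ y ∈ uIcc (-L) 0, x - y ≠ 0 := fun y hy => by
    rw [uIcc_of_le (by linarith)] at hy
    linarith [hy.2]
  have hcont : ContinuousOn (fun y : ℝ => (x - y) ^ (-(2 * s) - 1)) (uIcc (-L) 0) :=
    (continuousOn_const.sub continuousOn_id).rpow_const fun y hy => Or.inl (hpos y hy)
  have hint := hcont.intervalIntegrable (μ := volume)
  have h1 := intervalIntegral.integral_eq_sub_of_hasDerivAt
    (f := fun y : ℝ => 1 / (2 * s) * (x - y) ^ (-(2 * s)))
    (f' := fun y => (x - y) ^ (-(2 * s) - 1)) (a := -L) (b := 0)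
    (fun y hy => by
      have h2 := ((((hasDerivAt_id y).const_sub x).rpow_const (p := -(2 * s))
        (Or.inl (hpos y hy))).const_mul (1 / (2 * s)))
      refine h2.congr_deriv ?_
      simp only [id]
      field_simp) hint
  have h3 : ∫⁻ y in Ioc (-L) 0, ENNReal.ofReal (|x - y| ^ (1 + 2 * s))⁻¹ =
      ∫⁻ y in Ioc (-L) 0, ENNReal.ofReal ((x - y) ^ (-(2 * s) - 1)) := by
    refine setLIntegral_congr_fun measurableSet_Ioc fun y hy => ?_
    have hxy : 0 < x - y := by linarith [hy.2]
    rw [abs_of_pos hxy, ← Real.rpow_neg hxy.le]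
    congr 2; ring
  rw [h3, ← ofReal_integral_eq_lintegral_ofReal
    ((intervalIntegrable_iff_integrableOn_Ioc_of_le (by linarith)).1 hint)
    ((ae_restrict_mem measurableSet_Ioc).mono fun y hy => by
      have : 0 < x - y := by linarith [hy.2]
      positivity),
    ← intervalIntegral.integral_of_le (by linarith), h1]
  apply ENNReal.ofReal_le_ofReal
  have : 0 ≤ 1 / (2 * s) * (x - -L) ^ (-(2 * s)) := by
    have : 0 < x - -L := by linarith
    positivity
  simp only [sub_zero]
  linarith

lemma le_lintegral_kernel {s : ℝ} (hs : 0 < s) {L x : ℝ} (hx : 0 < x) (hxL : x ≤ L) :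
    ENNReal.ofReal ((2 ^ (1 + 2 * s))⁻¹ * x ^ (-(2 * s))) ≤
      ∫⁻ y in Ioc (-L) 0, ENNReal.ofReal (|x - y| ^ (1 + 2 * s))⁻¹ := by
  have h1 : ∫⁻ _ in Ioc (-x) 0, ENNReal.ofReal ((2 * x) ^ (1 + 2 * s))⁻¹ ≤
      ∫⁻ y in Ioc (-x) 0, ENNReal.ofReal (|x - y| ^ (1 + 2 * s))⁻¹ := by
    refine setLIntegral_mono' measurableSet_Ioc fun y hy => ENNReal.ofReal_le_ofReal ?_
    have hxy : 0 < x - y := by linarith [hy.2]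
    rw [abs_of_pos hxy]
    gcongr
    linarith [hy.1]
  refine le_trans (le_of_eq ?_) (h1.trans (lintegral_mono_set (Ioc_subset_Ioc_left (by linarith))))
  rw [setLIntegral_const, Real.volume_Ioc, ← ENNReal.ofReal_mul (by positivity)]
  congr 1
  rw [Real.mul_rpow zero_le_two hx.le, Real.rpow_add hx, Real.rpow_one, Real.rpow_neg hx.le]
  field_simp
  ring

/-- A function that vanishes on one side of a point and is of class `H^s` near it is, for
`s ≠ 1/2`, controlled in `H^s` across the point by its norm on the other side. -/
lemma exists_gagliardoSq_le_of_eq_zero {s L : ℝ} (hs0 : 0 < s) (hs1 : s < 1) (hs : s ≠ 1 / 2)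
    (hL : 0 < L) :
    ∃ C > 0, ∀ f : ℝ → ℝ, Measurable f → (∀ x ≤ 0, f x = 0) → ∀ E Q : ℝ, 0 ≤ E → 0 ≤ Q →
      gagliardoSq s (Ioo (-L) L) f ≠ ∞ →
      gagliardoSq s (Ioo 0 L) f ≤ ENNReal.ofReal E →
      ∫⁻ x in Ioo 0 L, ENNReal.ofReal (f x ^ 2) ≤ ENNReal.ofReal Q →
      gagliardoSq s (Ioo (-L) L) f ≤ ENNReal.ofReal (C * (E + Q)) := by
  obtain ⟨C, hC, hCb⟩ := exists_hardy hs0 hs1 hs hL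
  refine ⟨1 + C / s, by positivity, fun f hf hf0 E Q hE hQ hfin hgag hL2 => ?_⟩
  set F : ℝ × ℝ → ℝ≥0∞ := fun z =>
    ENNReal.ofReal ((f z.1 - f z.2) ^ 2 / |z.1 - z.2| ^ (1 + 2 * s)) with hF
  have hFm : Measurable F := by fun_prop
  set X := ∫⁻ x in Ioo 0 L, ENNReal.ofReal (f x ^ 2 * x ^ (-(2 * s))) with hX
  -- the interaction of the two sides
  set K := ∫⁻ z in Ioo 0 L ×ˢ Ioc (-L) 0, F z with hK
  have hKeq : K = ∫⁻ x in Ioo 0 L, ENNReal.ofReal (f x ^ 2) *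
      ∫⁻ y in Ioc (-L) 0, ENNReal.ofReal (|x - y| ^ (1 + 2 * s))⁻¹ := by
    rw [hK, Measure.volume_eq_prod, ← Measure.prod_restrict, lintegral_prod _ hFm.aemeasurable]
    refine lintegral_congr fun x => ?_
    rw [← lintegral_const_mul' _ _ ENNReal.ofReal_ne_top]
    refine setLIntegral_congr_fun measurableSet_Ioc fun y hy => ?_
    simp only [hF]
    rw [hf0 y hy.2, sub_zero, ← ENNReal.ofReal_mul (by positivity), div_eq_mul_inv]
  have hKX : K ≤ ENNReal.ofReal (1 / (2 * s)) * X := by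
    rw [hKeq, hX, ← lintegral_const_mul' _ _ ENNReal.ofReal_ne_top]
    refine setLIntegral_mono' measurableSet_Ioo fun x hx => ?_
    refine (mul_le_mul_right (lintegral_kernel_le hs0 hL hx.1) _).trans (le_of_eq ?_)
    rw [← ENNReal.ofReal_mul (by positivity), ← ENNReal.ofReal_mul (by positivity)]
    congr 1; ring
  have hXK : ENNReal.ofReal (2 ^ (1 + 2 * s))⁻¹ * X ≤ K := by
    rw [hKeq, hX, ← lintegral_const_mul' _ _ ENNReal.ofReal_ne_top]
    refine setLIntegral_mono' measurableSet_Ioo fun x hx => ?_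
    refine le_trans (le_of_eq ?_) (mul_le_mul_right (le_lintegral_kernel hs0 hx.1 hx.2.le) _)
    rw [← ENNReal.ofReal_mul (by positivity), ← ENNReal.ofReal_mul (by positivity)]
    congr 1; ring
  rw [gagliardoSq_eq_lintegral_prod hf] at hfin hgag ⊢
  have hKfin : K ≠ ∞ := by
    refine ne_top_of_le_ne_top hfin (lintegral_mono_set ?_)
    refine prod_mono (Ioo_subset_Ioo_left (by linarith)) fun y hy => ⟨hy.1, by linarith [hy.2]⟩
  have hXfin : X ≠ ∞ := by
    intro h
    rw [h, ENNReal.mul_top (by simp only [ne_eq, ENNReal.ofReal_eq_zero, not_le]; positivity),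
      top_le_iff] at hXK
    exact hKfin hXK
  have hXb := hCb f hf E Q hE hQ hXfin (by rw [gagliardoSq_eq_lintegral_prod hf]; exact hgag) hL2
  have hKb : K ≤ ENNReal.ofReal (C / (2 * s) * (E + Q)) := by
    refine hKX.trans ((mul_le_mul_right hXb _).trans (le_of_eq ?_))
    rw [← ENNReal.ofReal_mul (by positivity)]
    congr 1; ring
  have hKs : ∫⁻ z in Ioc (-L) 0 ×ˢ Ioo 0 L, F z = K := by
    rw [hK, Measure.volume_eq_prod, ← Measure.prod_restrict, ← Measure.prod_restrict,
      lintegral_prod _ hFm.aemeasurable, lintegral_prod_symm _ hFm.aemeasurable]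
    refine lintegral_congr fun x => lintegral_congr fun y => ?_
    simp only [hF]
    rw [abs_sub_comm x y, ← neg_sub (f x), neg_sq]
  have hZ : ∫⁻ z in Ioc (-L) 0 ×ˢ Ioc (-L) 0, F z = 0 := by
    rw [setLIntegral_congr_fun (g := fun _ => 0) (measurableSet_Ioc.prod measurableSet_Ioc)]
    · simp
    · intro z hz
      simp only [hF]
      rw [hf0 z.1 hz.1.2, hf0 z.2 hz.2.2]
      simp
  have hcover : Ioo (-L) L ×ˢ Ioo (-L) L ⊆ (Ioo 0 L ×ˢ Ioo 0 L ∪ Ioo 0 L ×ˢ Ioc (-L) 0) ∪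
      (Ioc (-L) 0 ×ˢ Ioo 0 L ∪ Ioc (-L) 0 ×ˢ Ioc (-L) 0) := by
    rintro ⟨x, y⟩ ⟨hx, hy⟩
    simp only at hx hy
    rcases le_or_gt x 0 with h1 | h1 <;> rcases le_or_gt y 0 with h2 | h2
    · exact Or.inr (Or.inr ⟨⟨hx.1, h1⟩, ⟨hy.1, h2⟩⟩)
    · exact Or.inr (Or.inl ⟨⟨hx.1, h1⟩, ⟨h2, hy.2⟩⟩)
    · exact Or.inl (Or.inr ⟨⟨h1, hx.2⟩, ⟨hy.1, h2⟩⟩)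
    · exact Or.inl (Or.inl ⟨⟨h1, hx.2⟩, ⟨h2, hy.2⟩⟩)
  calc ∫⁻ z in Ioo (-L) L ×ˢ Ioo (-L) L, F z
      ≤ (ENNReal.ofReal E + ENNReal.ofReal (C / (2 * s) * (E + Q))) +
        (ENNReal.ofReal (C / (2 * s) * (E + Q)) + 0) := by
        refine (lintegral_mono_set hcover).trans ((lintegral_union_le _ _ _).trans ?_)
        refine add_le_add ((lintegral_union_le _ _ _).trans (add_le_add hgag hKb))
          ((lintegral_union_le _ _ _).trans (add_le_add ?_ hZ.le))
        rw [hKs]; exact hKb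
    _ ≤ ENNReal.ofReal ((1 + C / s) * (E + Q)) := by
        rw [add_zero, ← ENNReal.ofReal_add hE (by positivity),
          ← ENNReal.ofReal_add (by positivity) (by positivity)]
        apply ENNReal.ofReal_le_ofReal
        have : (1 + C / s) * (E + Q) =
            E + C / (2 * s) * (E + Q) + C / (2 * s) * (E + Q) + Q := by field_simp; ring
        linarith

lemma gagliardoSq_sub_const (s : ℝ) (I : Set ℝ) (g : ℝ → ℝ) (m : ℝ) :
    gagliardoSq s I (fun x => g x - m) = gagliardoSq s I g := by
  simp only [gagliardoSq, sub_sub_sub_cancel_right]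

/-- Functions that are constant to the right and to the left of `(-T, T)` are controlled in `H^s`
on all intervals of a given length. Two points at distance less than `L` lie both in `(-T, T)`, or
both within `L` of the same endpoint, unless the function agrees at them. -/
lemma exists_gagliardoSq_le_of_const {s L ℓ : ℝ} (hs0 : 0 < s) (hs1 : s < 1) (hs : s ≠ 1 / 2)
    (hL : 0 < L) (hℓ : 0 < ℓ) :
    ∃ C > 0, ∀ T, L ≤ T → ∀ g : ℝ → ℝ, Measurable g → ∀ m n : ℝ, (∀ x, T ≤ x → g x = m) →
      (∀ x, x ≤ -T → g x = n) → (∀ b c, gagliardoSq s (Ioo b c) g ≠ ∞) →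
      ∀ E Q : ℝ, 0 ≤ E → 0 ≤ Q → gagliardoSq s (Ioo (-T) T) g ≤ ENNReal.ofReal E →
      ∫⁻ x in Ioo (T - L) T, ENNReal.ofReal ((g x - m) ^ 2) ≤ ENNReal.ofReal Q →
      ∫⁻ x in Ioo (-T) (-T + L), ENNReal.ofReal ((g x - n) ^ 2) ≤ ENNReal.ofReal Q →
      ∀ b c : ℝ, c - b = ℓ → ∫⁻ x in Ioo b c, ENNReal.ofReal (g x ^ 2) ≤ ENNReal.ofReal Q →
      gagliardoSq s (Ioo b c) g ≤ ENNReal.ofReal (C * (E + Q)) := by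
  obtain ⟨C, hC, hCb⟩ := exists_gagliardoSq_le_of_eq_zero hs0 hs1 hs hL
  set A : ℝ := 2 * (L ^ (1 + 2 * s))⁻¹ with hA
  have hA0 : 0 < A := by positivity
  refine ⟨1 + 2 * C + A * (2 * ℓ), by positivity,
    fun T hT g hg m n hm hn hfin E Q hE hQ hgag hQm hQn b c hbc hQK => ?_⟩
  have hR : gagliardoSq s (Ioo (T - L) (T + L)) g ≤ ENNReal.ofReal (C * (E + Q)) := by
    have e := gagliardoSq_Ioo_comp_sub_left s T (T - L) (T + L) g
    have e' := gagliardoSq_Ioo_comp_sub_left s T (T - L) T g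
    have e'' := lintegral_Ioo_comp_sub_left (fun x => ENNReal.ofReal ((g x - m) ^ 2)) T (T - L) T
    rw [sub_sub_cancel, sub_add_cancel_left, ← gagliardoSq_sub_const _ _ _ m] at e
    rw [sub_sub_cancel, sub_self, ← gagliardoSq_sub_const _ _ _ m] at e'
    rw [sub_sub_cancel, sub_self] at e''
    rw [← e]
    refine hCb _ (by fun_prop) (fun x hx => by rw [hm _ (by linarith), sub_self]) E Q hE hQ
      (by rw [e]; exact hfin _ _) ?_ (by rw [e'']; exact hQm)
    rw [e']
    exact (gagliardoSq_mono s (Ioo_subset_Ioo_left (by linarith)) g).trans hgag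
  have hLe : gagliardoSq s (Ioo (-T - L) (-T + L)) g ≤ ENNReal.ofReal (C * (E + Q)) := by
    -- shifting by `-T` is the composition of two reflections
    have e : ∀ b c, gagliardoSq s (Ioo (b + T) (c + T)) (fun x => g (x - T) - n) =
        gagliardoSq s (Ioo b c) g := fun b c => by
      have h1 := gagliardoSq_Ioo_comp_sub_left s 0 b c g
      have h2 := gagliardoSq_Ioo_comp_sub_left s T (0 - c) (0 - b) (fun x => g (0 - x))
      rw [h1] at h2
      rw [gagliardoSq_sub_const, ← h2]
      congr 1
      · congr 1 <;> ring
      · funext x; congr 1; ring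
    have e'' : ∫⁻ x in Ioo 0 L, ENNReal.ofReal ((g (x - T) - n) ^ 2) =
        ∫⁻ x in Ioo (-T) (-T + L), ENNReal.ofReal ((g x - n) ^ 2) := by
      have h1 := lintegral_Ioo_comp_sub_left (fun x => ENNReal.ofReal ((g x - n) ^ 2)) 0 (-T)
        (-T + L)
      have h2 := lintegral_Ioo_comp_sub_left (fun x => ENNReal.ofReal ((g (0 - x) - n) ^ 2)) T
        (0 - (-T + L)) (0 - -T)
      rw [h1] at h2
      rw [← h2]
      have i1 : T - (0 - -T) = 0 := by ring
      have i2 : T - (0 - (-T + L)) = L := by ring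
      rw [i1, i2]
      refine lintegral_congr fun x => ?_
      congr 4; ring
    have e1 := e (-T - L) (-T + L)
    have e2 := e (-T) (-T + L)
    have i1 : -T - L + T = -L := by ring
    have i2 : -T + L + T = L := by ring
    have i3 : -T + T = 0 := by ring
    rw [i1, i2] at e1
    rw [i2, i3] at e2
    rw [← e1]
    refine hCb _ (by fun_prop) (fun x hx => by rw [hn _ (by linarith), sub_self]) E Q hE hQ
      (by rw [e1]; exact hfin _ _) ?_ (by rw [e'']; exact hQn)
    rw [e2]
    exact (gagliardoSq_mono s (Ioo_subset_Ioo_right (by linarith)) g).trans hgag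
  rw [gagliardoSq_eq_lintegral_prod hg] at hgag hR hLe ⊢
  set F : ℝ × ℝ → ℝ≥0∞ := fun z =>
    ENNReal.ofReal ((g z.1 - g z.2) ^ 2 / |z.1 - z.2| ^ (1 + 2 * s)) with hF
  have hFm : Measurable F := by fun_prop
  set far : Set (ℝ × ℝ) := (Ioo b c ×ˢ Ioo b c) ∩ {z | L ≤ |z.1 - z.2|} with hfar
  have hfarm : MeasurableSet far := (measurableSet_Ioo.prod measurableSet_Ioo).inter
    (measurableSet_le measurable_const (by fun_prop))
  have hfarb : ∫⁻ z in far, F z ≤ ENNReal.ofReal (A * (2 * ℓ) * Q) := by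
    have h1 : ∫⁻ z in far, F z ≤ ∫⁻ z in far, (ENNReal.ofReal A * ENNReal.ofReal (g z.1 ^ 2) +
        ENNReal.ofReal A * ENNReal.ofReal (g z.2 ^ 2)) := by
      refine setLIntegral_mono' hfarm fun z hz => ?_
      simp only [hF]
      rw [← ENNReal.ofReal_mul hA0.le, ← ENNReal.ofReal_mul hA0.le,
        ← ENNReal.ofReal_add (by positivity) (by positivity)]
      apply ENNReal.ofReal_le_ofReal
      have hz2 : L ≤ |z.1 - z.2| := hz.2
      have h2 : L ^ (1 + 2 * s) ≤ |z.1 - z.2| ^ (1 + 2 * s) :=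
        Real.rpow_le_rpow hL.le hz2 (by linarith)
      calc (g z.1 - g z.2) ^ 2 / |z.1 - z.2| ^ (1 + 2 * s)
          ≤ (2 * (g z.1 ^ 2 + g z.2 ^ 2)) / L ^ (1 + 2 * s) := by
            gcongr
            nlinarith [sq_nonneg (g z.1 + g z.2)]
        _ = A * g z.1 ^ 2 + A * g z.2 ^ 2 := by rw [hA]; ring
    refine h1.trans ((lintegral_mono_set inter_subset_left).trans ?_)
    rw [lintegral_add_left (by fun_prop), lintegral_const_mul' _ _ ENNReal.ofReal_ne_top,
      lintegral_const_mul' _ _ ENNReal.ofReal_ne_top]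
    have hv : volume (Ioo b c) = ENNReal.ofReal ℓ := by rw [Real.volume_Ioo, hbc]
    have j1 : ∫⁻ z in Ioo b c ×ˢ Ioo b c, ENNReal.ofReal (g z.1 ^ 2) ≤
        ENNReal.ofReal (ℓ * Q) := by
      rw [Measure.volume_eq_prod, ← Measure.prod_restrict, lintegral_prod_symm _ (by fun_prop)]
      simp only
      rw [setLIntegral_const, hv, mul_comm, ENNReal.ofReal_mul hℓ.le]
      exact mul_le_mul_right hQK _
    have j2 : ∫⁻ z in Ioo b c ×ˢ Ioo b c, ENNReal.ofReal (g z.2 ^ 2) ≤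
        ENNReal.ofReal (ℓ * Q) := by
      rw [Measure.volume_eq_prod, ← Measure.prod_restrict, lintegral_prod _ (by fun_prop)]
      simp only
      rw [setLIntegral_const, hv, mul_comm, ENNReal.ofReal_mul hℓ.le]
      exact mul_le_mul_right hQK _
    refine (add_le_add (mul_le_mul_right j1 _) (mul_le_mul_right j2 _)).trans (le_of_eq ?_)
    rw [← ENNReal.ofReal_mul hA0.le, ← ENNReal.ofReal_add (by positivity) (by positivity)]
    congr 1; ring
  set Z : Set (ℝ × ℝ) := {z | g z.1 = g z.2} with hZ
  have hZm : MeasurableSet Z := measurableSet_eq_fun (by fun_prop) (by fun_prop)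
  have hZb : ∫⁻ z in Z, F z = 0 := by
    rw [setLIntegral_congr_fun (g := fun _ => 0) hZm]
    · simp
    · intro z hz
      have : g z.1 = g z.2 := hz
      simp [hF, this]
  have hcover : Ioo b c ×ˢ Ioo b c ⊆ (Ioo (-T) T ×ˢ Ioo (-T) T ∪ far) ∪
      ((Ioo (T - L) (T + L) ×ˢ Ioo (T - L) (T + L) ∪
        Ioo (-T - L) (-T + L) ×ˢ Ioo (-T - L) (-T + L)) ∪ Z) := by
    rintro ⟨x, y⟩ hxy
    rcases le_or_gt L |x - y| with hd | hd
    · exact Or.inl (Or.inr ⟨hxy, hd⟩)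
    have hd' := abs_lt.1 hd
    rcases le_or_gt T x with hx | hx <;> rcases le_or_gt T y with hy | hy
    · exact Or.inr (Or.inr ((hm x hx).trans (hm y hy).symm))
    · exact Or.inr (Or.inl (Or.inl ⟨⟨by simp only; linarith, by simp only; linarith⟩,
        ⟨by simp only; linarith, by simp only; linarith⟩⟩))
    · exact Or.inr (Or.inl (Or.inl ⟨⟨by simp only; linarith, by simp only; linarith⟩,
        ⟨by simp only; linarith, by simp only; linarith⟩⟩))
    rcases le_or_gt x (-T) with hx' | hx' <;> rcases le_or_gt y (-T) with hy' | hy'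
    · exact Or.inr (Or.inr ((hn x hx').trans (hn y hy').symm))
    · exact Or.inr (Or.inl (Or.inr ⟨⟨by simp only; linarith, by simp only; linarith⟩,
        ⟨by simp only; linarith, by simp only; linarith⟩⟩))
    · exact Or.inr (Or.inl (Or.inr ⟨⟨by simp only; linarith, by simp only; linarith⟩,
        ⟨by simp only; linarith, by simp only; linarith⟩⟩))
    · exact Or.inl (Or.inl ⟨⟨hx', hx⟩, ⟨hy', hy⟩⟩)
  calc ∫⁻ z in Ioo b c ×ˢ Ioo b c, F z
      ≤ (ENNReal.ofReal E + ENNReal.ofReal (A * (2 * ℓ) * Q)) +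
        ((ENNReal.ofReal (C * (E + Q)) + ENNReal.ofReal (C * (E + Q))) + 0) := by
        refine (lintegral_mono_set hcover).trans ((lintegral_union_le _ _ _).trans ?_)
        exact add_le_add ((lintegral_union_le _ _ _).trans (add_le_add hgag hfarb))
          ((lintegral_union_le _ _ _).trans (add_le_add
            ((lintegral_union_le _ _ _).trans (add_le_add hR hLe)) hZb.le))
    _ ≤ ENNReal.ofReal ((1 + 2 * C + A * (2 * ℓ)) * (E + Q)) := by
        rw [add_zero, ← ENNReal.ofReal_add hE (by positivity),
          ← ENNReal.ofReal_add (by positivity) (by positivity),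
          ← ENNReal.ofReal_add (by positivity) (by positivity)]
        apply ENNReal.ofReal_le_ofReal
        have : 0 ≤ A * (2 * ℓ) * E := by positivity
        nlinarith

/-! ### Norms -/

lemma normL2_le {I : Set ℝ} {g : ℝ → ℝ} {Q : ℝ} (hQ : 0 ≤ Q)
    (h : ∫⁻ x in I, ENNReal.ofReal (g x ^ 2) ≤ ENNReal.ofReal Q) :
    normL2 I g ≤ ENNReal.ofReal √Q := by
  rw [normL2, eLpNorm_eq_lintegral_rpow_enorm_toReal two_ne_zero ENNReal.ofNat_ne_top,
    Real.sqrt_eq_rpow, ← ENNReal.ofReal_rpow_of_nonneg hQ (by norm_num), ENNReal.toReal_ofNat]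
  refine ENNReal.rpow_le_rpow (le_trans (le_of_eq (lintegral_congr fun x => ?_)) h) (by norm_num)
  rw [Real.enorm_eq_ofReal_abs, ENNReal.ofReal_rpow_of_nonneg (abs_nonneg _) zero_le_two,
    Real.rpow_two, sq_abs]

lemma gagliardoSeminorm_le {s : ℝ} {I : Set ℝ} {g : ℝ → ℝ} {G : ℝ} (hG : 0 ≤ G)
    (h : gagliardoSq s I g ≤ ENNReal.ofReal G) :
    gagliardoSeminorm s I g ≤ ENNReal.ofReal √G := by
  rw [gagliardoSeminorm_eq, Real.sqrt_eq_rpow,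
    ← ENNReal.ofReal_rpow_of_nonneg hG (by norm_num)]
  exact ENNReal.rpow_le_rpow h (by norm_num)

lemma normL2_univ_eq {I : Set ℝ} (hI : MeasurableSet I) {f : ℝ → ℝ}
    (h : ∀ᵐ x, x ∉ I → f x = 0) : normL2 univ f = normL2 I f := by
  rw [normL2, normL2, Measure.restrict_univ, ← eLpNorm_indicator_eq_eLpNorm_restrict hI]
  refine eLpNorm_congr_ae ?_
  filter_upwards [h] with x hx
  by_cases hxI : x ∈ I
  · rw [indicator_of_mem hxI]
  · rw [indicator_of_notMem hxI, hx hxI]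

lemma lintegral_sq_le_of_abs_le {v : ℝ → ℝ} {M b c : ℝ} (h : ∀ x, |v x| ≤ M) :
    ∫⁻ x in Ioo b c, ENNReal.ofReal (v x ^ 2) ≤ ENNReal.ofReal (M ^ 2 * (c - b)) := by
  calc ∫⁻ x in Ioo b c, ENNReal.ofReal (v x ^ 2)
      ≤ ∫⁻ _ in Ioo b c, ENNReal.ofReal (M ^ 2) :=
        lintegral_mono fun x => ENNReal.ofReal_le_ofReal
          (sq_le_sq' (by linarith [(abs_le.1 (h x)).1]) (abs_le.1 (h x)).2)
    _ = _ := by rw [setLIntegral_const, Real.volume_Ioo, ENNReal.ofReal_mul (by positivity)]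

lemma MemHloc.gagliardoSq_ne_top {k : ℕ} {s : ℝ} {v : ℝ → ℝ} (h : MemHloc k s v) (b c : ℝ) :
    gagliardoSq s (Ioo b c) (weakDeriv k v) ≠ ∞ := by
  have := h.gagliardo_lt_top b c
  rw [gagliardoSeminorm_eq] at this
  intro htop
  rw [htop, ENNReal.top_rpow_of_pos (by norm_num)] at this
  exact lt_irrefl _ this

lemma MemHloc.normH_lt_top {k : ℕ} {s : ℝ} {v : ℝ → ℝ} (h : MemHloc k s v) (b c : ℝ) :
    normH k s (Ioo b c) v < ∞ := by
  refine ENNReal.add_lt_top.2 ⟨?_, h.gagliardo_lt_top b c⟩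
  have hae : v =ᵐ[volume] weakDeriv 0 v :=
    (weakDeriv_spec (h.exists_weakDeriv 0 (Nat.zero_le k))).ae_eq_of_zero
  rw [normL2, eLpNorm_congr_ae (ae_restrict_of_ae hae)]
  exact (h.memLp 0 (Nat.zero_le k) b c).2

lemma normH_le {k : ℕ} {s : ℝ} {v : ℝ → ℝ} {M b c G : ℝ} (hbc : b ≤ c) (hM : ∀ x, |v x| ≤ M)
    (hG : 0 ≤ G) (h : gagliardoSq s (Ioo b c) (weakDeriv k v) ≤ ENNReal.ofReal G) :
    normH k s (Ioo b c) v ≤ ENNReal.ofReal (√(M ^ 2 * (c - b)) + √G + 1) := by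
  have h0 : 0 ≤ M ^ 2 * (c - b) := mul_nonneg (sq_nonneg M) (by linarith)
  refine (add_le_add (normL2_le h0 (lintegral_sq_le_of_abs_le hM))
    (gagliardoSeminorm_le hG h)).trans ?_
  rw [← ENNReal.ofReal_add (Real.sqrt_nonneg _) (Real.sqrt_nonneg _)]
  exact ENNReal.ofReal_le_ofReal (by linarith)

/-! ### Coercivity -/

lemma IsBoundedEnergyProfile.gagliardoSq_le_max {k : ℕ} {s : ℝ} {W : ℝ → ℝ} {a : ℝ → ℝ → ℝ}
    {T S : ℝ} {v : ℝ → ℝ} (h : IsBoundedEnergyProfile k s W a T S v) {αa βa : ℝ} (hα : 0 < αa)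
    (ha : IsHomogenizationKernel αa βa a) :
    gagliardoSq s (Ioo (-T) T) (weakDeriv k v) ≤ ENNReal.ofReal (αa⁻¹ * max S 0) := by
  refine (h.gagliardoSq_le hα ha).trans (ENNReal.ofReal_le_ofReal ?_)
  gcongr
  exact le_max_left _ _

/-- Profiles are bounded, for every `k`, uniformly over intervals of length bounded below. -/
lemma exists_abs_le_of_profile_of_le {k : ℕ} {s : ℝ} (hs0 : 0 < s) (hks : 1 / 2 < (k : ℝ) + s)
    {W : ℝ → ℝ} (hW : IsDoubleWell W) {αa βa : ℝ} (hα : 0 < αa) {T₀ : ℝ} (hT₀ : 0 < T₀) (S : ℝ) :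
    ∃ M > 0, ∀ T, T₀ ≤ T → ∀ (a : ℝ → ℝ → ℝ) (v : ℝ → ℝ), IsHomogenizationKernel αa βa a →
      IsBoundedEnergyProfile k s W a T S v → ∀ x, |v x| ≤ M := by
  rcases Nat.eq_zero_or_pos k with rfl | hk
  · obtain ⟨M, hM, h⟩ := exists_abs_le_of_profile (βa := βa)
      (by simpa using hks : 1 / 2 < s) hW hα S
    exact ⟨M, hM, fun T hT a v ha hv => h T (hT₀.trans_le hT) a v ha hv⟩
  · obtain ⟨C, hC, h⟩ := exists_bound_of_profile (βa := βa) hk hs0 hW hα hT₀ S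
    exact ⟨C, hC, fun T hT a v ha hv => (h T hT a v ha hv).2⟩

lemma normH_le_of_subset {k : ℕ} {s : ℝ} {W : ℝ → ℝ} {αa βa : ℝ} (hα : 0 < αa) {a : ℝ → ℝ → ℝ}
    {v : ℝ → ℝ} (ha : IsHomogenizationKernel αa βa a) {T S M : ℝ}
    (hv : IsBoundedEnergyProfile k s W a T S v) (hM : ∀ x, |v x| ≤ M) {b c : ℝ} (hbc : b ≤ c)
    (hsub : Ioo b c ⊆ Ioo (-T) T) :
    normH k s (Ioo b c) v ≤
      ENNReal.ofReal (√(M ^ 2 * (c - b)) + √(αa⁻¹ * max S 0) + 1) :=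
  normH_le hbc hM (by positivity)
    ((gagliardoSq_mono s hsub _).trans (hv.gagliardoSq_le_max hα ha))

/-- For `s ≠ 1/2` the `H^{k+s}` norm is controlled on all intervals of a given length, also across
the endpoints of `(-T, T)`. -/
lemma exists_normH_le {k : ℕ} {s : ℝ} (hs0 : 0 < s) (hs1 : s < 1) (hs : s ≠ 1 / 2)
    {W : ℝ → ℝ} (hW : IsDoubleWell W) {αa βa : ℝ} (hα : 0 < αa) {L ℓ : ℝ}
    (hL : 0 < L) (hℓ : 0 < ℓ) (S M : ℝ) :
    ∃ C > 0, ∀ T, L ≤ T → ∀ (a : ℝ → ℝ → ℝ) (v : ℝ → ℝ), IsHomogenizationKernel αa βa a →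
      IsBoundedEnergyProfile k s W a T S v → (∀ x, |v x| ≤ M) →
      ∀ b c : ℝ, c - b = ℓ → normH k s (Ioo b c) v ≤ ENNReal.ofReal C := by
  obtain ⟨C, hC, hCb⟩ := exists_gagliardoSq_le_of_const hs0 hs1 hs hL hℓ
  set E : ℝ := αa⁻¹ * max S 0 with hE
  have hE0 : 0 ≤ E := by positivity
  suffices h : ∃ Q : ℝ, 0 ≤ Q ∧ ∀ T, L ≤ T → ∀ (a : ℝ → ℝ → ℝ) (v : ℝ → ℝ),
      IsHomogenizationKernel αa βa a → IsBoundedEnergyProfile k s W a T S v →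
      (∀ x, |v x| ≤ M) → ∀ b c : ℝ, c - b = ℓ →
      gagliardoSq s (Ioo b c) (weakDeriv k v) ≤ ENNReal.ofReal (C * (E + Q)) by
    obtain ⟨Q, hQ, h⟩ := h
    refine ⟨√(M ^ 2 * ℓ) + √(C * (E + Q)) + 1, by positivity,
      fun T hT a v ha hv hM b c hbc => ?_⟩
    have := normH_le (by linarith) hM (by positivity) (h T hT a v ha hv hM b c hbc)
    rwa [hbc] at this
  rcases Nat.eq_zero_or_pos k with rfl | hk
  · -- a bounded function with values `±1` off `(-T, T)`
    refine ⟨(2 * M) ^ 2 * (L + ℓ), by positivity, fun T hT a v ha hv hM b c hbc => ?_⟩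
    have hT0 : 0 < T := hL.trans_le hT
    have hae : weakDeriv 0 v =ᵐ[volume] v :=
      (weakDeriv_spec (hv.memHloc.exists_weakDeriv 0 le_rfl)).ae_eq_of_zero.symm
    have hg : ∀ I : Set ℝ, gagliardoSq s I (weakDeriv 0 v) = gagliardoSq s I v := fun I =>
      gagliardoSq_congr s (ae_restrict_of_ae hae)
    have hM0 : 0 ≤ M := (abs_nonneg _).trans (hM 0)
    have hdiff : ∀ y x, |v x - v y| ≤ 2 * M := fun y x => by
      have := abs_sub (v x) (v y)
      linarith [hM x, hM y]
    have hle : ∀ r : ℝ, r ≤ L + ℓ → (2 * M) ^ 2 * r ≤ (2 * M) ^ 2 * (L + ℓ) := fun r hr => by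
      gcongr
    rw [hg]
    refine hCb T hT v hv.continuous.measurable (v T) (v (-T)) (fun x hx => hv.eq_of_le hT0 hx)
      (fun x hx => hv.eq_of_le_neg hT0 hx)
      (fun b c => by rw [← hg]; exact hv.memHloc.gagliardoSq_ne_top b c) E _ hE0 (by positivity)
      (by rw [← hg]; exact hv.gagliardoSq_le_max hα ha) ?_ ?_ b c hbc ?_
    · refine (lintegral_sq_le_of_abs_le (hdiff T)).trans (ENNReal.ofReal_le_ofReal ?_)
      exact hle _ (by linarith)
    · refine (lintegral_sq_le_of_abs_le (hdiff (-T))).trans (ENNReal.ofReal_le_ofReal ?_)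
      exact hle _ (by linarith)
    · refine (lintegral_sq_le_of_abs_le (M := 2 * M) fun x => (hM x).trans (by linarith)).trans
        (ENNReal.ofReal_le_ofReal ?_)
      exact hle _ (by linarith)
  · -- a square integrable derivative that vanishes off `(-T, T)`
    obtain ⟨Q, hQ, hQb⟩ := exists_bound_of_profile (βa := βa) hk hs0 hW hα hL S
    refine ⟨Q, hQ.le, fun T hT a v ha hv hM b c hbc => ?_⟩
    have hT0 : 0 < T := hL.trans_le hT
    have hloc := (weakDeriv_spec (hv.memHloc.exists_weakDeriv k le_rfl)).2.1
    have hm := hloc.aestronglyMeasurable.aemeasurable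
    set g : ℝ → ℝ := (Ioo (-T) T).indicator (hm.mk _) with hg
    have hgm : Measurable g := hm.measurable_mk.indicator measurableSet_Ioo
    have hae : weakDeriv k v =ᵐ[volume] g := by
      filter_upwards [hm.ae_eq_mk, hv.weakDeriv_eq_zero hT0 hk le_rfl,
        (countable_singleton T).ae_notMem volume, (countable_singleton (-T)).ae_notMem volume]
        with x h1 h2 h3 h4
      by_cases hx : x ∈ Ioo (-T) T
      · rw [hg, indicator_of_mem hx, h1]
      · rw [hg, indicator_of_notMem hx]
        apply h2
        by_contra! hle
        have := abs_le.1 hle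
        exact hx ⟨lt_of_le_of_ne this.1 fun h => h4 h.symm, lt_of_le_of_ne this.2 h3⟩
    have hgag : ∀ I : Set ℝ, gagliardoSq s I (weakDeriv k v) = gagliardoSq s I g := fun I =>
      gagliardoSq_congr s (ae_restrict_of_ae hae)
    have hgL2 : ∀ I : Set ℝ, ∫⁻ x in I, ENNReal.ofReal (g x ^ 2) ≤ ENNReal.ofReal Q := by
      intro I
      refine le_trans ?_ (hQb T hT a v ha hv).1
      calc ∫⁻ x in I, ENNReal.ofReal (g x ^ 2) ≤ ∫⁻ x, ENNReal.ofReal (g x ^ 2) :=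
            setLIntegral_le_lintegral _ _
        _ = ∫⁻ x in Ioo (-T) T, ENNReal.ofReal (g x ^ 2) := by
            rw [← lintegral_indicator measurableSet_Ioo]
            refine lintegral_congr fun x => ?_
            by_cases hx : x ∈ Ioo (-T) T
            · rw [indicator_of_mem hx]
            · rw [indicator_of_notMem hx, hg, indicator_of_notMem hx]
              simp
        _ = ∫⁻ x in Ioo (-T) T, ENNReal.ofReal (weakDeriv k v x ^ 2) := by
            refine lintegral_congr_ae ?_
            filter_upwards [ae_restrict_of_ae hae] with x hx
            rw [hx]
    rw [hgag]
    refine hCb T hT g hgm 0 0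
      (fun x hx => indicator_of_notMem (fun h => absurd h.2 (not_lt.2 hx)) _)
      (fun x hx => indicator_of_notMem (fun h => absurd h.1 (not_lt.2 hx)) _)
      (fun b c => by rw [← hgag]; exact hv.memHloc.gagliardoSq_ne_top b c) E Q hE0 hQ.le
      (by rw [← hgag]; exact hv.gagliardoSq_le_max hα ha) ?_ ?_ b c hbc (hgL2 _)
    · simpa using hgL2 (Ioo (T - L) T)
    · simpa using hgL2 (Ioo (-T) (-T + L))

theorem theorem5p3 (k : ℕ) (s : ℝ) (hs0 : 0 < s) (hs1 : s < 1) (hks : 1 / 2 < (k : ℝ) + s)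
    (W : ℝ → ℝ) (hW : IsDoubleWell W) (αa βa : ℝ) (hαa : 0 < αa) :
    -- case `k ≥ 1`: the `k`-th derivatives are bounded in `L²(ℝ)`
    (1 ≤ k → ∀ τ ∈ Ioo (0 : ℝ) (1 / 2), ∀ ε₀ > (0 : ℝ), ∀ S : ℝ, ∃ C > (0 : ℝ),
      ∀ ε ∈ Ioc 0 ε₀, ∀ a v : _, IsHomogenizationKernel αa βa a →
        IsBoundedEnergyProfile k s W a (τ / ε) S v →
        normL2 univ (weakDeriv k v) = normL2 (Ioo (-(τ / ε)) (τ / ε)) (weakDeriv k v) ∧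
        normL2 (Ioo (-(τ / ε)) (τ / ε)) (weakDeriv k v) ≤ ENNReal.ofReal C) ∧
    -- case `k = 0`: sign regularizations with bounded derivatives exist, and each of them
    -- is at bounded `L²(ℝ)` distance from the profile
    (k = 0 → ∀ η ∈ Ioo (0 : ℝ) 1, ∀ S : ℝ,
      (∃ L > (0 : ℝ), ∀ τ ∈ Ioo (0 : ℝ) (1 / 2), ∀ ε > (0 : ℝ), ∀ a v : _,
        IsHomogenizationKernel αa βa a → IsBoundedEnergyProfile k s W a (τ / ε) S v →
        ∃ σ : ℝ → ℝ, IsSignRegularization η v σ ∧ ∀ x, |deriv σ x| ≤ L) ∧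
      (∃ C > (0 : ℝ), ∀ τ ∈ Ioo (0 : ℝ) (1 / 2), ∀ ε > (0 : ℝ), ∀ a v σ : _,
        IsHomogenizationKernel αa βa a → IsBoundedEnergyProfile k s W a (τ / ε) S v →
        IsSignRegularization η v σ →
        normL2 univ (v - σ) = normL2 (Ioo (-(τ / ε)) (τ / ε)) (v - σ) ∧
        normL2 (Ioo (-(τ / ε)) (τ / ε)) (v - σ) ≤ ENNReal.ofReal C)) ∧
    -- equiboundedness
    (∀ τ ∈ Ioo (0 : ℝ) (1 / 2), ∀ ε₀ > (0 : ℝ), ∀ S : ℝ, ∃ M > (0 : ℝ),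
      ∀ ε ∈ Ioc 0 ε₀, ∀ a v : _, IsHomogenizationKernel αa βa a →
        IsBoundedEnergyProfile k s W a (τ / ε) S v → ∀ x, |v x| ≤ M) ∧
    -- bound in `H^{k+s}(K)` for intervals `K` of length `ℓ` contained in `(-τ/ε, τ/ε)`
    (∀ S M : ℝ, ∀ ℓ > (0 : ℝ), ∃ C > (0 : ℝ),
      ∀ τ ∈ Ioo (0 : ℝ) (1 / 2), ∀ ε > (0 : ℝ), ∀ a v : _, IsHomogenizationKernel αa βa a →
        IsBoundedEnergyProfile k s W a (τ / ε) S v → (∀ x, |v x| ≤ M) →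
        ∀ b c : ℝ, c - b = ℓ → Ioo b c ⊆ Ioo (-(τ / ε)) (τ / ε) →
          normH k s (Ioo b c) v ≤ ENNReal.ofReal C) ∧
    -- bound in `H^{k+s}(K)` for arbitrary intervals `K` of length `ℓ`, `s ≠ 1/2`
    (s ≠ 1 / 2 → ∀ τ ∈ Ioo (0 : ℝ) (1 / 2), ∀ ε₀ > (0 : ℝ), ∀ S M : ℝ, ∀ ℓ > (0 : ℝ),
      ∃ C > (0 : ℝ), ∀ ε ∈ Ioc 0 ε₀, ∀ a v : _, IsHomogenizationKernel αa βa a →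
        IsBoundedEnergyProfile k s W a (τ / ε) S v → (∀ x, |v x| ≤ M) →
        ∀ b c : ℝ, c - b = ℓ → normH k s (Ioo b c) v ≤ ENNReal.ofReal C) ∧
    -- every `s`: along a sequence `ε n → 0`, boundedness in `H^{k+s}(K)` on each bounded interval
    (∀ τ ∈ Ioo (0 : ℝ) (1 / 2), ∀ S : ℝ, ∀ ε : ℕ → ℝ, (∀ n, 0 < ε n) →
      Tendsto ε atTop (𝓝 0) → ∀ (a : ℕ → ℝ → ℝ → ℝ) (v : ℕ → ℝ → ℝ),
      (∀ n, IsHomogenizationKernel αa βa (a n)) →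
      (∀ n, IsBoundedEnergyProfile k s W (a n) (τ / ε n) S (v n)) →
      ∀ b c : ℝ, b < c → ∃ C > (0 : ℝ), ∀ n, normH k s (Ioo b c) (v n) ≤ ENNReal.ofReal C) := by
  have hscale : ∀ {τ ε₀ ε : ℝ}, τ ∈ Ioo (0 : ℝ) (1 / 2) → ε ∈ Ioc 0 ε₀ → τ / ε₀ ≤ τ / ε :=
    fun hτ hε => div_le_div_of_nonneg_left hτ.1.le hε.1 hε.2
  refine ⟨fun hk τ hτ ε₀ hε₀ S => ?_, fun hk η hη S => ?_, fun τ hτ ε₀ hε₀ S => ?_,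
    fun S M ℓ hℓ => ?_, fun hs τ hτ ε₀ hε₀ S M ℓ hℓ => ?_,
    fun τ hτ S ε hε hlim a v ha hv b c hbc => ?_⟩
  · obtain ⟨C, hC, hCb⟩ := exists_bound_of_profile (βa := βa) hk hs0 hW hαa
      (div_pos hτ.1 hε₀) S
    refine ⟨√C, Real.sqrt_pos.2 hC, fun ε hε a v ha hv =>
      ⟨normL2_univ_eq measurableSet_Ioo ?_, normL2_le hC.le (hCb _ (hscale hτ hε) a v ha hv).1⟩⟩
    filter_upwards [hv.weakDeriv_eq_zero (div_pos hτ.1 hε.1) hk le_rfl,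
      (countable_singleton (τ / ε)).ae_notMem volume,
      (countable_singleton (-(τ / ε))).ae_notMem volume] with x h1 h2 h3 hx
    apply h1
    by_contra! hle
    have := abs_le.1 hle
    exact hx ⟨lt_of_le_of_ne this.1 fun h => h3 h.symm, lt_of_le_of_ne this.2 h2⟩
  · subst hk
    have hs : 1 / 2 < s := by simpa using hks
    constructor
    · obtain ⟨L, hL, hLb⟩ := exists_sign_regularization hs (βa := βa) hαa hη S
      exact ⟨L, hL, fun τ hτ ε hε a v ha hv => hLb _ (div_pos hτ.1 hε) W a v ha hv⟩
    · obtain ⟨M, hM, hMb⟩ := exists_abs_le_of_profile hs hW (βa := βa) hαa S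
      obtain ⟨C, hC, hCb⟩ := exists_sq_sub_sign_regularization_le hW hη hM.le
      have hQ : 0 < C * (max S 0 + 1) := by positivity
      refine ⟨√(C * (max S 0 + 1)), Real.sqrt_pos.2 hQ, fun τ hτ ε hε a v σ ha hv hσ =>
        ⟨normL2_univ_eq measurableSet_Ioo (Eventually.of_forall fun x hx => ?_),
          normL2_le hQ.le ?_⟩⟩
      · rw [Pi.sub_apply, hv.eq_of_isSignRegularization hη.1 hσ, sub_self]
        by_contra! hlt
        exact hx (abs_lt.1 hlt)
      · have hvM := hMb _ (div_pos hτ.1 hε) a v ha hv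
        calc ∫⁻ x in Ioo (-(τ / ε)) (τ / ε), ENNReal.ofReal ((v - σ) x ^ 2)
            ≤ ∫⁻ x in Ioo (-(τ / ε)) (τ / ε), ENNReal.ofReal C * ENNReal.ofReal (W (v x)) := by
              refine lintegral_mono fun x => ?_
              rw [← ENNReal.ofReal_mul hC.le]
              exact ENNReal.ofReal_le_ofReal (hCb v σ hv.continuous hvM hσ x)
          _ ≤ ENNReal.ofReal C * ENNReal.ofReal S := by
              rw [lintegral_const_mul' _ _ ENNReal.ofReal_ne_top]
              exact mul_le_mul_right hv.lintegral_potential_le _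
          _ ≤ ENNReal.ofReal (C * (max S 0 + 1)) := by
              rw [← ENNReal.ofReal_mul hC.le]
              apply ENNReal.ofReal_le_ofReal
              gcongr
              linarith [le_max_left S 0]
  · obtain ⟨M, hM, hMb⟩ := exists_abs_le_of_profile_of_le (βa := βa) hs0 hks hW hαa
      (div_pos hτ.1 hε₀) S
    exact ⟨M, hM, fun ε hε a v ha hv => hMb _ (hscale hτ hε) a v ha hv⟩
  · refine ⟨√(M ^ 2 * ℓ) + √(αa⁻¹ * max S 0) + 1, by positivity,
      fun τ hτ ε hε a v ha hv hM b c hbc hsub => ?_⟩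
    have := normH_le_of_subset hαa ha hv hM (by linarith) hsub
    rwa [hbc] at this
  · obtain ⟨C, hC, hCb⟩ := exists_normH_le (βa := βa) (k := k) hs0 hs1 hs hW hαa
      (div_pos hτ.1 hε₀) hℓ S M
    exact ⟨C, hC, fun ε hε a v ha hv hM b c hbc => hCb _ (hscale hτ hε) a v ha hv hM b c hbc⟩
  · obtain ⟨B, hB⟩ := hlim.bddAbove_range
    have hεB : ∀ n, ε n ≤ B := fun n => hB (mem_range_self n)
    have hB0 : 0 < B := (hε 0).trans_le (hεB 0)
    obtain ⟨M, hM, hMb⟩ := exists_abs_le_of_profile_of_le (βa := βa) hs0 hks hW hαa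
      (div_pos hτ.1 hB0) S
    have hvM : ∀ n x, |v n x| ≤ M := fun n =>
      hMb _ (hscale hτ ⟨hε n, hεB n⟩) (a n) (v n) (ha n) (hv n)
    -- from some index on the interval lies in `(-τ/ε, τ/ε)`
    have hR : ∀ᶠ n in atTop, ε n < τ / (|b| + |c| + 1) :=
      hlim.eventually_lt_const (div_pos hτ.1 (by positivity))
    obtain ⟨N, hN⟩ := eventually_atTop.1 hR
    set C := √(M ^ 2 * (c - b)) + √(αa⁻¹ * max S 0) + 1 with hC
    have hC0 : 0 < C := by positivity
    set D := ∑ n ∈ Finset.range N, (normH k s (Ioo b c) (v n)).toReal with hD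
    have hD0 : 0 ≤ D := Finset.sum_nonneg fun n _ => ENNReal.toReal_nonneg
    refine ⟨C + D, by positivity, fun n => ?_⟩
    rcases lt_or_ge n N with hn | hn
    · rw [← ENNReal.ofReal_toReal ((hv n).memHloc.normH_lt_top b c).ne]
      apply ENNReal.ofReal_le_ofReal
      have := Finset.single_le_sum (f := fun n => (normH k s (Ioo b c) (v n)).toReal)
        (fun n _ => ENNReal.toReal_nonneg) (Finset.mem_range.2 hn)
      linarith
    · refine (normH_le_of_subset hαa (ha n) (hv n) (hvM n) hbc.le ?_).trans
        (ENNReal.ofReal_le_ofReal (by linarith))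
      have h1 : |b| + |c| + 1 < τ / ε n := by
        rw [lt_div_iff₀ (hε n), mul_comm, ← lt_div_iff₀ (by positivity)]
        exact hN n hn
      exact Ioo_subset_Ioo (by linarith [neg_abs_le b, abs_nonneg c])
        (by linarith [le_abs_self c, abs_nonneg b])
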